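/- Let $(X,d,\mu)$ be a separable metric space with a Borel measure $\mu$ such that $0<V(x,r):=\mu(B(x,r))<\infty$ for all $x\in X$, $r>0$, and such that for some $n>0$ and some constant $C_0$ one has $V(x,\lambda r)\le C_0\lambda^nV(x,r)$ for all $x\in X$, $r>0$, $\lambda\ge 1$. Write $V_\tau(x)=V(x,\tau)$, $P_Ef=\chi_Ef$, $\sigma_p=\frac1p-\frac12$, $[t]$ for the integer part of $t$, and $\|T\|_{p\to r}$ for the norm of $T$ from $L^p(X)$ to $L^r(X)$; functions are identified with multiplication operators. Let $1\le p<2\le q\le\infty$, let $\tau>0$, $a>[n/2]+1$, and let $A$ be a bounded self-adjoint operator on $L^2(X)$ (complex scalars). For a bounded Borel function $F:\mathbb R\to\mathbb C$ let $F(A)=\int F\,dE$ be defined by the spectral theorem. Assume: (PVE$^a_{p,2}(\tau)$) there is a constant $C$ such that for all $x,y\in X$ $$\|P_{B(x,\tau)}V_\tau^{\sigma_p}AP_{B(y,\tau)}\|_{p\to2}\le C\Big(1+\frac{d(x,y)}{\tau}\Big)^{-n-a};$$ (ST$^q_{p,2}(\tau)$ on $[R_1,R_2]$, where $-\infty<R_1<R_2<\infty$)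 there is a constant $C$ such that for all bounded Borel functions $F$ with $\operatorname{supp}F\subset[R_1,R_2]$ $$\|F(A)AV_\tau^{\sigma_p}\|_{p\to2}\le C\|F\|_q ,$$ where $\|F\|_q$ is the norm of $L^q(\mathbb R)$ if $q<\infty$ and $\|F\|_\infty=\sup_{\mathbb R}|F|$ if $q=\infty$. Let $\gamma>0$ and $$s>n\Big(\frac1p-\frac12\Big)+\frac{n}{4[a]} .$$ Then there is a constant $C$, independent of $F$, such that for every bounded Borel function $F$ with $\operatorname{supp}F\subset[R_1+\gamma,R_2-\gamma]$ and $F\in W^{s,q}(\mathbb R)$, the operator $AF(A)$ extends from $L^2(X)\cap L^p(X)$ to a bounded operator on $L^p(X)$ and $$\|AF(A)\|_{p\to p}\le C\|F\|_{W^{s,q}},\qquad \|F\|_{W^{s,q}}=\big\|(1-d^2/dx^2)^{s/2}F\big\|_{L^q(\mathbb R)} .$$ In the case $q=\infty$ the function $F$ is moreover taken to be the continuous representative of its class in $W^{s,\infty}(\mathbb R)$; any Borel representative is allowed if the estimate ST holds even with the essential supremum of $|F|$ in place of the supremum. -/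

import Mathlib

open MeasureTheory ENNReal
open scoped ComplexInnerProductSpace CompactlySupported SchwartzMap NNReal

noncomputable section

namespace SpectralMultiplier

section BorelCalculus

/-- The positive functional `f ↦ ⟨x, f(A) x⟩` on `C_c(ℝ)`, where `f(A)` is the continuous functional
calculus of the bounded self-adjoint operator `A`. -/
def spectralFunctional {H : Type*} [NormedAddCommGroup H] [InnerProductSpace ℂ H] [CompleteSpace H]
    (A : H →L[ℂ] H) (x : H) : C_c(ℝ, ℝ) →ₚ[ℝ] ℝ :=
  PositiveLinearMap.mk₀
    { toFun := fun f => (⟪x, cfc (f : ℝ → ℝ) A x⟫).re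
      map_add' := by
        intro f g
        have h : cfc (⇑(f + g)) A = cfc (⇑f) A + cfc (⇑g) A := by
          have := cfc_add (a := A) (⇑f) (⇑g) (f.continuous.continuousOn) (g.continuous.continuousOn)
          exact this
        rw [h]; simp
      map_smul' := by
        intro r f
        have h : cfc (⇑(r • f)) A = r • cfc (⇑f) A := by
          have := cfc_smul (a := A) r (⇑f) (f.continuous.continuousOn)
          exact this
        rw [h]
        have : ((r • cfc (⇑f) A) x) = (r : ℂ) • (cfc (⇑f) A x) := by
          simp
        rw [this, inner_smul_right]; simp }
    (by
      intro f hf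
      have h : 0 ≤ cfc (⇑f) A := cfc_nonneg (fun t _ => hf t)
      have h2 := (ContinuousLinearMap.nonneg_iff_isPositive _).1 h
      have := h2.inner_nonneg_right x
      exact (Complex.le_def.1 this).1)

/-- The spectral measure `B ↦ ⟨x, E(B) x⟩` of a bounded self-adjoint operator `A = ∫ λ dE(λ)` at the
vector `x`: the Borel measure on `ℝ` that represents `f ↦ ⟨x, f(A) x⟩`. -/
def spectralMeasure {H : Type*} [NormedAddCommGroup H] [InnerProductSpace ℂ H] [CompleteSpace H]
    (A : H →L[ℂ] H) (x : H) : Measure ℝ :=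
  RealRMK.rieszMeasure (spectralFunctional A x)

open Classical in
/-- The operator `F(A) = ∫ F(λ) dE(λ)` for a bounded Borel function `F`: the bounded operator `T`
such that `⟨x, T x⟩ = ∫ F(λ) d⟨x, E(λ) x⟩` for all `x`. -/
def borelCalculus {H : Type*} [NormedAddCommGroup H] [InnerProductSpace ℂ H] [CompleteSpace H]
    (A : H →L[ℂ] H) (F : ℝ → ℂ) : H →L[ℂ] H :=
  if h : ∃ T : H →L[ℂ] H, ∀ x : H, ⟪x, T x⟫ = ∫ t, F t ∂(spectralMeasure A x) then h.choose else 0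

variable {H : Type*} [NormedAddCommGroup H] [InnerProductSpace ℂ H] [CompleteSpace H]

theorem integral_spectralMeasure {A : H →L[ℂ] H} (x : H) (f : C_c(ℝ, ℝ)) :
    ∫ t, f t ∂(spectralMeasure A x) = (⟪x, cfc (f : ℝ → ℝ) A x⟫).re :=
  RealRMK.integral_rieszMeasure (spectralFunctional A x) f

theorem ofReal_integral_spectralMeasure (A : H →L[ℂ] H) (x : H) (f : C_c(ℝ, ℝ)) :
    ((∫ t, f t ∂(spectralMeasure A x) : ℝ) : ℂ) = ⟪x, cfc (f : ℝ → ℝ) A x⟫ := by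
  rw [integral_spectralMeasure]
  have h : IsSelfAdjoint (cfc (f : ℝ → ℝ) A) := cfc_predicate _ _
  have h2 : ((cfc (f : ℝ → ℝ) A : H →L[ℂ] H) : H →ₗ[ℂ] H).IsSymmetric :=
    ContinuousLinearMap.isSelfAdjoint_iff_isSymmetric.1 h
  exact h2.coe_re_inner_self_apply x

instance regular_spectralMeasure (A : H →L[ℂ] H) (x : H) : (spectralMeasure A x).Regular :=
  RealRMK.regular_rieszMeasure _

theorem spectralMeasure_univ_le (A : H →L[ℂ] H) (x : H) :
    spectralMeasure A x Set.univ ≤ ENNReal.ofReal (‖x‖ ^ 2) := by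
  rw [isOpen_univ.measure_eq_iSup_isCompact]
  refine iSup_le fun K => iSup_le fun _ => iSup_le fun hK => ?_
  obtain ⟨f, hf1, -, hfc, hf01⟩ := exists_continuous_one_zero_of_isCompact hK
    (isClosed_empty (X := ℝ)) (Set.disjoint_empty K)
  let g : C_c(ℝ, ℝ) := ⟨f, hfc⟩
  have hg : ∀ t, 0 ≤ g t ∧ g t ≤ 1 := fun t => hf01 t
  refine (RealRMK.rieszMeasure_le_of_eq_one (spectralFunctional A x) (f := g)
    (fun t => (hg t).1) hK (fun t ht => hf1 ht)).trans (ENNReal.ofReal_le_ofReal ?_)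
  change (⟪x, cfc (g : ℝ → ℝ) A x⟫).re ≤ ‖x‖ ^ 2
  have h1 : ‖cfc (g : ℝ → ℝ) A‖ ≤ 1 := norm_cfc_le zero_le_one fun t _ => by
    rw [Real.norm_eq_abs, abs_of_nonneg (hg t).1]; exact (hg t).2
  calc (⟪x, cfc (g : ℝ → ℝ) A x⟫).re ≤ ‖⟪x, cfc (g : ℝ → ℝ) A x⟫‖ := Complex.re_le_norm _
    _ ≤ ‖x‖ * ‖cfc (g : ℝ → ℝ) A x‖ := norm_inner_le_norm _ _
    _ ≤ ‖x‖ * (1 * ‖x‖) := by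
        gcongr
        exact (ContinuousLinearMap.le_opNorm _ _).trans (by gcongr)
    _ = ‖x‖ ^ 2 := by ring

instance finite_spectralMeasure (A : H →L[ℂ] H) (x : H) : IsFiniteMeasure (spectralMeasure A x) :=
  ⟨(spectralMeasure_univ_le A x).trans_lt ENNReal.ofReal_lt_top⟩

theorem norm_integral_spectralMeasure_le (A : H →L[ℂ] H) (x : H) {F : ℝ → ℂ} {M : ℝ}
    (hM : ∀ t, ‖F t‖ ≤ M) : ‖∫ t, F t ∂(spectralMeasure A x)‖ ≤ M * ‖x‖ ^ 2 := by
  have hM0 : 0 ≤ M := (norm_nonneg _).trans (hM 0)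
  refine (norm_integral_le_of_norm_le_const (Filter.Eventually.of_forall hM)).trans ?_
  gcongr
  exact ENNReal.toReal_le_of_le_ofReal (by positivity) (spectralMeasure_univ_le A x)

/-- A real linear relation between spectral measures may be tested on `C_c(ℝ)`. -/
theorem sum_integral_eq_zero_of_real (A : H →L[ℂ] H) (s : Finset H) (r : H → ℝ)
    (h : ∀ f : C_c(ℝ, ℝ), ∑ v ∈ s, r v * ∫ t, f t ∂(spectralMeasure A v) = 0)
    {F : ℝ → ℂ} (hF : Measurable F) {M : ℝ} (hM : ∀ t, ‖F t‖ ≤ M) :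
    ∑ v ∈ s, (r v : ℂ) * ∫ t, F t ∂(spectralMeasure A v) = 0 := by
  have hint : ∀ (w : H → NNReal) {E : Type} [NormedAddCommGroup E] [NormedSpace ℝ E] (G : ℝ → E),
      (∀ v, Integrable G (spectralMeasure A v)) →
      ∫ t, G t ∂(∑ v ∈ s, w v • spectralMeasure A v)
        = ∑ v ∈ s, w v • ∫ t, G t ∂(spectralMeasure A v) := by
    intro w E _ _ G hG
    rw [integral_finsetSum_measure fun v _ => (hG v).smul_measure_nnreal]
    exact Finset.sum_congr rfl fun v _ => integral_smul_nnreal_measure G (w v)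
  have hr : ∀ v, ((r v).toNNReal : ℝ) - ((-r v).toNNReal : ℝ) = r v := fun v => by
    simp [Real.coe_toNNReal']
  have key : ∑ v ∈ s, (r v).toNNReal • spectralMeasure A v
      = ∑ v ∈ s, (-r v).toNNReal • spectralMeasure A v := by
    apply Measure.ext_of_integral_eq_on_compactlySupported
    intro f
    have hf : ∀ v, Integrable (⇑f) (spectralMeasure A v) := fun v => f.integrable
    rw [hint _ _ hf, hint _ _ hf, ← sub_eq_zero, ← Finset.sum_sub_distrib, ← h f]
    refine Finset.sum_congr rfl fun v _ => ?_
    rw [NNReal.smul_def, NNReal.smul_def, ← sub_smul, hr, smul_eq_mul]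
  have hFi : ∀ v, Integrable F (spectralMeasure A v) := fun v =>
    Integrable.of_bound hF.aestronglyMeasurable M (Filter.Eventually.of_forall hM)
  have h2 := congrArg (fun ν => ∫ t, F t ∂ν) key
  rw [hint _ _ hFi, hint _ _ hFi, ← sub_eq_zero, ← Finset.sum_sub_distrib] at h2
  rw [← h2]
  refine Finset.sum_congr rfl fun v _ => ?_
  rw [NNReal.smul_def, NNReal.smul_def, ← sub_smul, hr, Complex.real_smul]

theorem linearCombination_integral_eq_zero (A : H →L[ℂ] H) (u : H →₀ ℂ)
    (h : ∀ f : C_c(ℝ, ℝ),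
      Finsupp.linearCombination ℂ (fun v => ⟪v, cfc (f : ℝ → ℝ) A v⟫) u = 0)
    {F : ℝ → ℂ} (hF : Measurable F) {M : ℝ} (hM : ∀ t, ‖F t‖ ≤ M) :
    Finsupp.linearCombination ℂ (fun v => ∫ t, F t ∂(spectralMeasure A v)) u = 0 := by
  have hre := sum_integral_eq_zero_of_real A u.support (fun v => (u v).re) (fun f => by
    have := congrArg Complex.re (h f)
    simp only [Finsupp.linearCombination_apply, Finsupp.sum,
      ← ofReal_integral_spectralMeasure] at this
    simpa using this) hF hM
  have him := sum_integral_eq_zero_of_real A u.support (fun v => (u v).im) (fun f => by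
    have := congrArg Complex.im (h f)
    simp only [Finsupp.linearCombination_apply, Finsupp.sum,
      ← ofReal_integral_spectralMeasure] at this
    simpa using this) hF hM
  have : ∑ v ∈ u.support, (((u v).re : ℂ) * ∫ t, F t ∂(spectralMeasure A v)
      + Complex.I * (((u v).im : ℂ) * ∫ t, F t ∂(spectralMeasure A v))) = 0 := by
    rw [Finset.sum_add_distrib, ← Finset.mul_sum, hre, him]; simp
  rw [Finsupp.linearCombination_apply, Finsupp.sum, ← this]
  refine Finset.sum_congr rfl fun v _ => ?_
  conv_lhs => rw [← Complex.re_add_im (u v), smul_eq_mul]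
  ring

/-- The formal combination of vectors that enters the polarization identity. -/
def polar (x y : H) : H →₀ ℂ :=
  Finsupp.single (x + y) (1 / 4) - Finsupp.single (x - y) (1 / 4)
    - Finsupp.single (x + Complex.I • y) (Complex.I / 4)
    + Finsupp.single (x - Complex.I • y) (Complex.I / 4)

theorem linearCombination_polar (T : H →L[ℂ] H) (x y : H) :
    Finsupp.linearCombination ℂ (fun v => ⟪v, T v⟫) (polar x y) = ⟪x, T y⟫ := by
  simp only [polar, map_add, map_sub, Finsupp.linearCombination_single, smul_eq_mul,
    inner_add_left, inner_add_right, inner_sub_left, inner_sub_right, map_smul,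
    inner_smul_left, inner_smul_right, Complex.conj_I]
  ring_nf
  simp only [Complex.I_sq]
  ring

theorem exists_borelCalculus (A : H →L[ℂ] H) {F : ℝ → ℂ} (hF : Measurable F)
    (hb : ∃ M : ℝ, ∀ t, ‖F t‖ ≤ M) :
    ∃ T : H →L[ℂ] H, ∀ x : H, ⟪x, T x⟫ = ∫ t, F t ∂(spectralMeasure A x) := by
  obtain ⟨M, hM⟩ := hb
  have hM0 : 0 ≤ M := (norm_nonneg _).trans (hM 0)
  set L := Finsupp.linearCombination ℂ (fun v => ∫ t, F t ∂(spectralMeasure A v)) with hL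
  have hz : ∀ u : H →₀ ℂ, (∀ T : H →L[ℂ] H,
      Finsupp.linearCombination ℂ (fun v => ⟪v, T v⟫) u = 0) → L u = 0 := fun u hu =>
    linearCombination_integral_eq_zero A u (fun f => hu _) hF hM
  let B : H →ₗ⋆[ℂ] H →ₗ[ℂ] ℂ := LinearMap.mk₂'ₛₗ (starRingEnd ℂ) (RingHom.id ℂ)
    (fun x y => L (polar x y))
    (fun x x' y => by
      have := hz (polar (x + x') y - polar x y - polar x' y) (fun T => by
        simp only [map_sub, linearCombination_polar, inner_add_left]; ring)
      simp only [map_sub] at this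
      linear_combination this)
    (fun c x y => by
      have := hz (polar (c • x) y - (starRingEnd ℂ c) • polar x y) (fun T => by
        simp only [map_sub, map_smul, linearCombination_polar, inner_smul_left, smul_eq_mul]; ring)
      simp only [map_sub, map_smul] at this
      linear_combination this)
    (fun x y y' => by
      have := hz (polar x (y + y') - polar x y - polar x y') (fun T => by
        simp only [map_sub, linearCombination_polar, map_add, inner_add_right]; ring)
      simp only [map_sub] at this
      linear_combination this)
    (fun c x y => by
      have := hz (polar x (c • y) - c • polar x y) (fun T => by
        simp only [map_sub, map_smul, linearCombination_polar, inner_smul_right, smul_eq_mul]; ring)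
      simp only [map_sub, map_smul] at this
      simp only [RingHom.id_apply]
      linear_combination this)
  have hB : ∀ x y, B x y = L (polar x y) := fun _ _ => rfl
  have h1 : ∀ x y : H, ‖x‖ = 1 → ‖y‖ = 1 → ‖B x y‖ ≤ 4 * M := by
    intro x y hx hy
    have hq : ∀ v : H, ‖v‖ ≤ 2 → ‖∫ t, F t ∂(spectralMeasure A v)‖ ≤ M * 4 := fun v hv =>
      (norm_integral_spectralMeasure_le A v hM).trans (by gcongr; nlinarith [norm_nonneg v])
    have hIy : ‖Complex.I • y‖ = 1 := by rw [norm_smul, hy]; simp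
    have a1 := hq (x + y) ((norm_add_le _ _).trans (by rw [hx, hy]; norm_num))
    have a2 := hq (x - y) ((norm_sub_le _ _).trans (by rw [hx, hy]; norm_num))
    have a3 := hq (x + Complex.I • y) ((norm_add_le _ _).trans (by rw [hx, hIy]; norm_num))
    have a4 := hq (x - Complex.I • y) ((norm_sub_le _ _).trans (by rw [hx, hIy]; norm_num))
    rw [hB]
    simp only [polar, map_add, map_sub, hL, Finsupp.linearCombination_single, smul_eq_mul]
    refine (norm_add_le _ _).trans ?_
    refine (add_le_add_left (norm_sub_le _ _) _).trans ?_
    refine (add_le_add_left (add_le_add_left (norm_sub_le _ _) _) _).trans ?_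
    simp only [norm_mul, norm_div, norm_one, Complex.norm_I, Complex.norm_ofNat]
    linarith
  have hC : ∀ x y, ‖B x y‖ ≤ (4 * M) * ‖x‖ * ‖y‖ := by
    intro x y
    by_cases hx : x = 0
    · simp [hx]
    by_cases hy : y = 0
    · simp [hy]
    have hx' : ‖x‖ ≠ 0 := norm_ne_zero_iff.2 hx
    have hy' : ‖y‖ ≠ 0 := norm_ne_zero_iff.2 hy
    have := h1 (((‖x‖ : ℂ)⁻¹) • x) (((‖y‖ : ℂ)⁻¹) • y)
      (by rw [norm_smul]; simp [hx']) (by rw [norm_smul]; simp [hy'])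
    simp only [map_smulₛₗ, LinearMap.smul_apply, norm_smul, RingHom.id_apply] at this
    simp only [norm_inv, RCLike.norm_conj, Complex.norm_real, norm_norm] at this
    have h3 : ‖B x y‖ = ‖x‖ * ‖y‖ * (‖x‖⁻¹ * (‖y‖⁻¹ * ‖B x y‖)) := by field_simp
    rw [h3]
    nlinarith [mul_le_mul_of_nonneg_left this (mul_nonneg (norm_nonneg x) (norm_nonneg y))]
  let S := InnerProductSpace.continuousLinearMapOfBilin (B.mkContinuous₂ (4 * M) hC)
  refine ⟨S.adjoint, fun x => ?_⟩
  rw [ContinuousLinearMap.adjoint_inner_right,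
    InnerProductSpace.continuousLinearMapOfBilin_apply, LinearMap.mkContinuous₂_apply, hB]
  have := hz (polar x x - Finsupp.single x 1) (fun T => by
    rw [map_sub, linearCombination_polar]; simp)
  rw [map_sub, sub_eq_zero] at this
  rw [this, hL]; simp

/-- The defining property of `F(A)`. -/
theorem inner_borelCalculus (A : H →L[ℂ] H) {F : ℝ → ℂ} (hF : Measurable F)
    (hb : ∃ M : ℝ, ∀ t, ‖F t‖ ≤ M) (x : H) :
    ⟪x, borelCalculus A F x⟫ = ∫ t, F t ∂(spectralMeasure A x) := by
  have h := exists_borelCalculus A hF hb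
  rw [borelCalculus, dif_pos h]
  exact h.choose_spec x

end BorelCalculus

/-- A Borel measure of homogeneous type with doubling exponent `n`: balls have positive finite
measure, and `V(x, lr) ≤ C l ^ n V(x, r)` for all `l ≥ 1`, where `V(x, r) = μ (B(x, r))`. -/
structure IsDoublingMeasure {X : Type*} [MetricSpace X] [MeasurableSpace X] (μ : Measure X)
    (n : ℝ) : Prop where
  ball_pos : ∀ (x : X) (r : ℝ), 0 < r → 0 < μ (Metric.ball x r)
  ball_lt_top : ∀ (x : X) (r : ℝ), 0 < r → μ (Metric.ball x r) < ∞
  doubling : ∃ C : ℝ, ∀ (x : X) (r l : ℝ), 0 < r → 1 ≤ l →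
    μ (Metric.ball x (l * r)) ≤ ENNReal.ofReal (C * l ^ n) * μ (Metric.ball x r)

/-- The exponent `σ_p = 1/p - 1/2`. -/
def sigma (p : ℝ≥0∞) : ℝ := 1 / p.toReal - 1 / 2

/-- The function `V_τ ^ σ`, that is, `z ↦ μ (B(z, τ)) ^ σ`. -/
def volPow {X : Type*} [MetricSpace X] [MeasurableSpace X] (μ : Measure X) (τ σ : ℝ) (z : X) : ℝ :=
  (μ (Metric.ball z τ)).toReal ^ σ

/-- The polynomial off-diagonal estimate
`‖P_{B(x,τ)} V_τ^{σ_p} A P_{B(y,τ)}‖_{p → 2} ≤ C (1 + d(x,y)/τ)^{-n-a}` for all `x`, `y`. The operator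
norm is computed on `L²` functions; those in `L^p` are dense there, and for the others the
right-hand side is infinite. -/
def PVE {X : Type*} [MetricSpace X] [MeasurableSpace X] [BorelSpace X] {μ : Measure X}
    (A : Lp ℂ 2 μ →L[ℂ] Lp ℂ 2 μ) (p : ℝ≥0∞) (n a τ : ℝ) : Prop :=
  ∃ C : ℝ, 0 < C ∧ ∀ (x y : X) (f : X → ℂ) (hf : MemLp f 2 μ),
    eLpNorm ((Metric.ball x τ).indicator fun z => (volPow μ τ (sigma p) z : ℂ) *
        A ((hf.indicator (s := Metric.ball y τ) measurableSet_ball).toLp) z) 2 μ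
      ≤ ENNReal.ofReal (C * (1 + dist x y / τ) ^ (-n - a)) * eLpNorm f p μ

/-- The restriction type estimate `‖F(A) A V_τ^{σ_p}‖_{p → 2} ≤ C N(F)` for all bounded Borel functions
`F` supported in `[b, e]`, where `N` is a given norm. The operator norm is computed on the dense
set of those `f` in `L^p` for which `V_τ^{σ_p} f` is in `L²`. -/
def RestrictionEstimate {X : Type*} [MetricSpace X] [MeasurableSpace X]
    {μ : Measure X} (A : Lp ℂ 2 μ →L[ℂ] Lp ℂ 2 μ) (p : ℝ≥0∞) (τ b e : ℝ)
    (N : (ℝ → ℂ) → ℝ≥0∞) : Prop :=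
  ∃ C : ℝ≥0, ∀ F : ℝ → ℂ, Measurable F → (∃ M : ℝ, ∀ t, ‖F t‖ ≤ M) →
    Function.support F ⊆ Set.Icc b e →
    ∀ f : X → ℂ, MemLp f p μ →
    ∀ hf : MemLp (fun z => (volPow μ τ (sigma p) z : ℂ) * f z) 2 μ,
      ‖borelCalculus A F (A (hf.toLp _))‖ₑ ≤ C * N F * eLpNorm f p μ

/-- The norm `‖F‖_q` of a Borel function on the line: the `L^q` norm for Lebesgue measure when
`q < ∞`, and the supremum of `|F|` when `q = ∞`. -/
def lqNorm (q : ℝ≥0∞) (F : ℝ → ℂ) : ℝ≥0∞ :=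
  if q = ∞ then ⨆ t, ‖F t‖ₑ else eLpNorm F q volume

/-- The Stein-Tomas type estimate `‖F(A) A V_τ^{σ_p}‖_{p → 2} ≤ C ‖F‖_q` on `[b, e]`. -/
def ST {X : Type*} [MetricSpace X] [MeasurableSpace X]
    {μ : Measure X} (A : Lp ℂ 2 μ →L[ℂ] Lp ℂ 2 μ) (p q : ℝ≥0∞) (τ b e : ℝ) : Prop :=
  RestrictionEstimate A p τ b e (lqNorm q)

/-- The symbol `(1 + (2πξ)²)^{s/2}` of `(1 - d²/dx²)^{s/2}`, for the Fourier transform with kernel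
`e^{-2πixξ}`. -/
def besselSymbol (s ξ : ℝ) : ℂ := (((1 + (2 * Real.pi * ξ) ^ 2) ^ (s / 2) : ℝ) : ℂ)

theorem besselSymbol_hasTemperateGrowth (s : ℝ) : (besselSymbol s).HasTemperateGrowth := by
  have h := Function.hasTemperateGrowth_one_add_norm_sq_rpow ℝ (s / 2)
  have h2 : (fun ξ : ℝ => 2 * Real.pi * ξ).HasTemperateGrowth := by fun_prop
  have h4 : besselSymbol s = Complex.ofRealCLM ∘ ((fun x : ℝ => (1 + ‖x‖ ^ 2) ^ (s / 2)) ∘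
      fun ξ : ℝ => 2 * Real.pi * ξ) := by
    ext ξ
    simp [besselSymbol]
  rw [h4]
  exact Complex.ofRealCLM.hasTemperateGrowth.comp (h.comp h2)

/-- The operator `(1 - d²/dx²)^{s/2}` on tempered distributions on the line. -/
def besselOp (s : ℝ) : 𝓢'(ℝ, ℂ) →L[ℂ] 𝓢'(ℝ, ℂ) :=
  TemperedDistribution.fourierMultiplierCLM ℂ (besselSymbol s)

/-- The Sobolev norm `‖F‖_{W^{s,q}} = ‖(1 - d²/dx²)^{s/2} F‖_q` of a function on the line, for `s ≥ 0`;
it is infinite when `F` is not in `W^{s,q}`, that is, when `F` is not in `L^q` or the distribution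
`(1 - d²/dx²)^{s/2} F` is not given by an `L^q` function `g`. (There is at most one such `g`.) -/
def sobolevNorm (s : ℝ) (q : ℝ≥0∞) [Fact (1 ≤ q)] (F : ℝ → ℂ) : ℝ≥0∞ :=
  ⨅ (hF : MemLp F q volume) (g : Lp ℂ q (volume : Measure ℝ))
    (_ : besselOp s (hF.toLp F : 𝓢'(ℝ, ℂ)) = (g : 𝓢'(ℝ, ℂ))), ‖g‖ₑ

/-- The bounded operator `S` on `L^p` extends the operator `T` on `L²`: they agree on `L² ∩ L^p`. -/
def Extends {X : Type*} [MeasurableSpace X] {μ : Measure X} {p : ℝ≥0∞} [Fact (1 ≤ p)]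
    (S : Lp ℂ p μ →L[ℂ] Lp ℂ p μ) (T : Lp ℂ 2 μ →L[ℂ] Lp ℂ 2 μ) : Prop :=
  ∀ (f : X → ℂ) (h2 : MemLp f 2 μ) (hp : MemLp f p μ), S (hp.toLp f) =ᵐ[μ] T (h2.toLp f)

end SpectralMultiplier

end

/-! Write σ = 1/p - 1/2. The function F is cut dyadically in frequency. Each piece is multiplied by
a fixed bump, so that it is a Schwartz function G supported in [R₁, R₂], to which the restriction
estimate applies. At frequency R = 2^l two quantities are known, up to the factor ‖F‖_{W^{s,q}}:
‖G‖_q ≲ R^{-s}, and ∫ |Ĝ(ξ)| (1 + 2π|ξ|)^k dξ ≲ R^{k+1/2-s} (`exists_dyadic_decomposition`).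

For one piece, let f live in a ball B(z, ρτ). On that ball V_τ^{-σ} ≲ ρ^{nσ} V(z, ρτ)^{-σ}, so the
restriction estimate bounds ‖G(A)Af‖₂ by R^{-s} ρ^{nσ} V(z, ρτ)^{-σ} ‖f‖_p, and Hölder's inequality
near the ball removes V(z, ρτ)^{-σ}. Away from the ball one uses weights w^k, where w is Lipschitz
at scale τ and grows like the distance to z in units of τ. The polynomial decay of the blocks of A,
of order n + a > n + k, makes the commutator of A with w^k of lower order (`norm_commutator_le`).
Gronwall's inequality then shows that e^{iξA} enlarges the weighted norm at most by a constant times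
(1 + |ξ|)^k (`norm_weight_unitaryGroup_le`), and integration against Ĝ gives the same for G(A) with
the factor R^{k+1/2-s} (`norm_weight_borelCalculus_le`). The weighted norm of Af is controlled by
the off-diagonal estimate (`enorm_weight_apply_le`).

On the annulus at distance 2^m ρτ the weight gains (2^m ρ)^{-k}, Hölder's inequality costs 2^{mnσ},
and the overlap of the annuli of different balls costs 2^{mn(1-1/p)}. The product is ρ^{-k}
2^{m(n/2-k)}, summable for k > n/2 (`eLpNorm_apply_le`). Hence ‖G(A)A‖_{p→p} ≲ ρ^{nσ} (R^{-s} +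
ρ^{-k} R^{k+1/2-s}). The choice ρ = R^{1+1/(2k)} balances the two terms and leaves
R^{nσ(1+1/(2k))-s} (`eLpNorm_dyadic_piece_le`).

The sum over l converges when s > nσ + nσ/(2k). The order k is any real number with 1 ≤ k and n/2 <
k < a. As k approaches a the threshold approaches nσ + nσ/(2a), which is at most nσ + n/(4[a])
because σ ≤ 1/2 (`exists_order`). The partial sums converge to F in the norm of the restriction
estimate, so they converge strongly in L² on functions with bounded support, and Fatou's lemma
carries the L^p bound to the limit. -/

noncomputable section
namespace SpectralMultiplier

/-! ### Borel calculus, the unitary group, and weighted bounds along it -/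

section FunctionalCalculus

open scoped FourierTransform

variable {H : Type*} [NormedAddCommGroup H] [InnerProductSpace ℂ H] [CompleteSpace H]

omit [CompleteSpace H] in
theorem clm_ext_of_inner {S T : H →L[ℂ] H} (h : ∀ x : H, ⟪x, S x⟫ = ⟪x, T x⟫) : S = T := by
  have h2 : (S : H →ₗ[ℂ] H) = T := by
    refine (ext_inner_map _ _).1 fun x => ?_
    have := congrArg (starRingEnd ℂ) (h x)
    rw [inner_conj_symm, inner_conj_symm] at this
    exact this
  ext x
  exact congrArg (fun f : H →ₗ[ℂ] H => f x) h2

theorem borelCalculus_eq_of_inner {A T : H →L[ℂ] H} {F : ℝ → ℂ} (hF : Measurable F)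
    (hb : ∃ M : ℝ, ∀ t, ‖F t‖ ≤ M)
    (h : ∀ x : H, ⟪x, T x⟫ = ∫ t, F t ∂(spectralMeasure A x)) : borelCalculus A F = T :=
  clm_ext_of_inner fun x => by rw [inner_borelCalculus A hF hb, h]

theorem integrable_spectralMeasure (A : H →L[ℂ] H) (x : H) {F : ℝ → ℂ} (hF : Measurable F)
    (hb : ∃ M : ℝ, ∀ t, ‖F t‖ ≤ M) : Integrable F (spectralMeasure A x) := by
  obtain ⟨M, hM⟩ := hb
  exact Integrable.of_bound hF.aestronglyMeasurable M (Filter.Eventually.of_forall hM)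

theorem borelCalculus_sub (A : H →L[ℂ] H) {F G : ℝ → ℂ} (hF : Measurable F) (hG : Measurable G)
    (hFb : ∃ M : ℝ, ∀ t, ‖F t‖ ≤ M) (hGb : ∃ M : ℝ, ∀ t, ‖G t‖ ≤ M) :
    borelCalculus A (fun t => F t - G t) = borelCalculus A F - borelCalculus A G := by
  have hb : ∃ M : ℝ, ∀ t, ‖F t - G t‖ ≤ M := by
    obtain ⟨M, hM⟩ := hFb
    obtain ⟨N, hN⟩ := hGb
    exact ⟨M + N, fun t => (norm_sub_le _ _).trans (add_le_add (hM t) (hN t))⟩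
  refine borelCalculus_eq_of_inner (hF.sub hG) hb fun x => ?_
  rw [integral_sub (integrable_spectralMeasure A x hF hFb) (integrable_spectralMeasure A x hG hGb),
    ← inner_borelCalculus A hF hFb, ← inner_borelCalculus A hG hGb, sub_apply,
    inner_sub_right]

theorem borelCalculus_sum {ι : Type*} (A : H →L[ℂ] H) (s : Finset ι) {F : ι → ℝ → ℂ}
    (hF : ∀ i ∈ s, Measurable (F i)) (hFb : ∀ i ∈ s, ∃ M : ℝ, ∀ t, ‖F i t‖ ≤ M) :
    borelCalculus A (fun t => ∑ i ∈ s, F i t) = ∑ i ∈ s, borelCalculus A (F i) := by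
  have hb : ∃ M : ℝ, ∀ t, ‖∑ i ∈ s, F i t‖ ≤ M := by
    choose! M hM using hFb
    exact ⟨∑ i ∈ s, M i, fun t => (norm_sum_le _ _).trans (Finset.sum_le_sum fun i hi => hM i hi t)⟩
  refine borelCalculus_eq_of_inner (Finset.measurable_sum _ hF) hb fun x => ?_
  rw [integral_finsetSum _ fun i hi => integrable_spectralMeasure A x (hF i hi) (hFb i hi),
    sum_apply, inner_sum]
  exact Finset.sum_congr rfl fun i hi => inner_borelCalculus A (hF i hi) (hFb i hi) x

theorem inner_borelCalculus_polar (A : H →L[ℂ] H) {F : ℝ → ℂ} (hF : Measurable F)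
    (hb : ∃ M : ℝ, ∀ t, ‖F t‖ ≤ M) (x y : H) :
    ⟪x, borelCalculus A F y⟫ =
      Finsupp.linearCombination ℂ (fun v => ∫ t, F t ∂(spectralMeasure A v)) (polar x y) := by
  rw [← linearCombination_polar]
  congr 2
  ext v
  exact inner_borelCalculus A hF hb v

/-- The formal combination `polar x (A y) - polar (A x) y` is annihilated by every f in C_c, because
f(A) commutes with the symmetric operator A. A linear relation between spectral measures that holds
on C_c holds on bounded Borel functions. -/
theorem borelCalculus_comm {A : H →L[ℂ] H} (hA : IsSelfAdjoint A) {F : ℝ → ℂ} (hF : Measurable F)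
    (hb : ∃ M : ℝ, ∀ t, ‖F t‖ ≤ M) (y : H) :
    borelCalculus A F (A y) = A (borelCalculus A F y) := by
  refine ext_inner_left ℂ fun x => ?_
  have hsymm : ∀ u v : H, ⟪u, A v⟫ = ⟪A u, v⟫ := fun u v =>
    ((ContinuousLinearMap.isSelfAdjoint_iff_isSymmetric.1 hA) u v).symm
  rw [hsymm, inner_borelCalculus_polar A hF hb, inner_borelCalculus_polar A hF hb, ← sub_eq_zero,
    ← map_sub]
  obtain ⟨M, hM⟩ := hb
  refine linearCombination_integral_eq_zero A _ (fun f => ?_) hF hM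
  rw [map_sub, linearCombination_polar, linearCombination_polar, ← hsymm, sub_eq_zero]
  have h : Commute (cfc (f : ℝ → ℝ) A) A := by
    have := cfc_commute_cfc (f : ℝ → ℝ) (fun t => t) A
    rwa [cfc_id' ℝ A] at this
  exact congrArg (fun T : H →L[ℂ] H => ⟪x, T y⟫) h.eq

theorem exists_cutoff (R : ℝ) : ∃ f : C_c(ℝ, ℝ), (∀ t, |t| ≤ R → f t = 1) ∧ ∀ t, 0 ≤ f t := by
  obtain ⟨f, hf1, -, hfc, hf01⟩ := exists_continuous_one_zero_of_isCompact
    (isCompact_Icc (a := -R) (b := R)) (isClosed_empty (X := ℝ)) (Set.disjoint_empty _)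
  exact ⟨⟨f, hfc⟩, fun t ht => hf1 (abs_le.1 ht), fun t => (hf01 t).1⟩

theorem cfc_eq_of_eqOn {A : H →L[ℂ] H} {f g : ℝ → ℝ} (h : ∀ t, |t| ≤ ‖A‖ → f t = g t) :
    cfc f A = cfc g A := by
  cases subsingleton_or_nontrivial H
  · ext x
    exact Subsingleton.elim _ _
  refine cfc_congr fun t ht => h t ?_
  have := spectrum.norm_le_norm_of_mem ht
  rwa [Real.norm_eq_abs] at this

/-- The set is open, so inner regularity reduces the claim to compact subsets. A bump that is one on
such a subset and zero where |t| ≤ ‖A‖ vanishes on the spectrum, so its functional calculus is zero.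
-/
theorem spectralMeasure_compl (A : H →L[ℂ] H) (x : H) :
    spectralMeasure A x {t | ‖A‖ < |t|} = 0 := by
  rw [(isOpen_lt continuous_const continuous_abs).measure_eq_iSup_isCompact]
  refine le_antisymm (iSup_le fun K => iSup_le fun hKs => iSup_le fun hK => ?_) (zero_le)
  obtain ⟨f, hf1, hf0, hfc, hf01⟩ := exists_continuous_one_zero_of_isCompact hK
    (isClosed_le continuous_abs (continuous_const (y := ‖A‖)))
    (Set.disjoint_left.2 fun t ht ht2 => absurd (show ‖A‖ < |t| from hKs ht) (not_lt.2 ht2))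
  let g : C_c(ℝ, ℝ) := ⟨f, hfc⟩
  refine (RealRMK.rieszMeasure_le_of_eq_one (spectralFunctional A x) (f := g)
    (fun t => (hf01 t).1) hK (fun t ht => hf1 ht)).trans ?_
  have h0 : cfc (g : ℝ → ℝ) A = 0 :=
    (cfc_eq_of_eqOn (f := g) (g := fun _ => 0) fun t ht => hf0 ht).trans (cfc_const_zero ℝ A)
  change ENNReal.ofReal (⟪x, cfc (g : ℝ → ℝ) A x⟫).re ≤ 0
  simp [h0]

/-- The Riesz measure represents compactly supported functions only. A cutoff equal to one for |t| ≤
‖A‖ changes neither side, and so admits cosines and sines. -/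
theorem integral_spectralMeasure_of_continuous (A : H →L[ℂ] H) (x : H) {f : ℝ → ℝ}
    (hf : Continuous f) :
    ((∫ t, f t ∂(spectralMeasure A x) : ℝ) : ℂ) = ⟪x, cfc f A x⟫ := by
  obtain ⟨χ, hχ, -⟩ := exists_cutoff ‖A‖
  let g : C_c(ℝ, ℝ) := ⟨⟨fun t => χ t * f t, χ.continuous.mul hf⟩, χ.hasCompactSupport.mul_right⟩
  have hg : ∀ t, g t = χ t * f t := fun t => rfl
  have h1 : cfc f A = cfc (g : ℝ → ℝ) A := cfc_eq_of_eqOn fun t ht => by rw [hg, hχ t ht, one_mul]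
  rw [h1, ← ofReal_integral_spectralMeasure]
  congr 1
  refine integral_congr_ae ?_
  have : ∀ᵐ t ∂(spectralMeasure A x), ¬ ‖A‖ < |t| := by
    rw [ae_iff]; simpa using spectralMeasure_compl A x
  filter_upwards [this] with t ht
  rw [hg, hχ t (not_lt.1 ht), one_mul]

/-- The unitary group `e^{iξA}`. -/
def unitaryGroup (A : H →L[ℂ] H) (ξ : ℝ) : H →L[ℂ] H :=
  NormedSpace.exp (ξ • (Complex.I • A))

theorem unitaryGroup_zero (A : H →L[ℂ] H) : unitaryGroup A 0 = 1 := by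
  simp [unitaryGroup]

theorem hasDerivAt_unitaryGroup (A : H →L[ℂ] H) (ξ : ℝ) :
    HasDerivAt (unitaryGroup A) (unitaryGroup A ξ * (Complex.I • A)) ξ :=
  hasDerivAt_exp_smul_const (𝕂 := ℝ) (Complex.I • A) ξ

theorem continuous_unitaryGroup (A : H →L[ℂ] H) : Continuous (unitaryGroup A) :=
  continuous_iff_continuousAt.2 fun ξ => (hasDerivAt_unitaryGroup A ξ).continuousAt

theorem unitaryGroup_comm (A : H →L[ℂ] H) (ξ : ℝ) : Commute A (unitaryGroup A ξ) :=
  (((Commute.refl A).smul_right _).smul_right _).exp_right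

/-- The spectral measure was built from the calculus of real functions, so the exponential has to be
split into its real and imaginary parts before it can be integrated. -/
theorem unitaryGroup_eq_cfc {A : H →L[ℂ] H} (hA : IsSelfAdjoint A) (ξ : ℝ) :
    unitaryGroup A ξ = cfc (fun t : ℝ => Real.cos (ξ * t)) A
      + Complex.I • cfc (fun t : ℝ => Real.sin (ξ * t)) A := by
  have hN : IsStarNormal A := hA.isStarNormal
  have hs : ξ • (Complex.I • A) = (ξ * Complex.I : ℂ) • A := by
    rw [mul_smul]; rfl
  have hN2 : IsStarNormal ((ξ * Complex.I : ℂ) • A) := by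
    rw [isStarNormal_iff, star_smul, hA.star_eq]
    exact ((Commute.refl A).smul_right _).smul_left _
  rw [unitaryGroup, hs, ← CFC.exp_eq_normedSpace_exp (𝕜 := ℂ) (p := IsStarNormal),
    ← cfc_comp_const_mul (ξ * Complex.I : ℂ) NormedSpace.exp A
      (NormedSpace.exp_continuous.continuousOn) hN,
    cfc_real_eq_complex _ hA, cfc_real_eq_complex _ hA,
    ← cfc_smul _ _ _ (Continuous.continuousOn (by fun_prop)),
    ← cfc_add _ _ _ (Continuous.continuousOn (by fun_prop)) (Continuous.continuousOn (by fun_prop))]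
  refine cfc_congr fun z hz => ?_
  have hz : (z.re : ℂ) = z := (hA.spectrumRestricts.rightInvOn hz)
  rw [← Complex.exp_eq_exp_ℂ]
  conv_lhs => rw [← hz]
  rw [show (ξ : ℂ) * Complex.I * (z.re : ℂ) = ((ξ * z.re : ℝ) : ℂ) * Complex.I by push_cast; ring,
    Complex.exp_mul_I]
  simp [smul_eq_mul, mul_comm]

theorem inner_unitaryGroup {A : H →L[ℂ] H} (hA : IsSelfAdjoint A) (ξ : ℝ) (x : H) :
    ⟪x, unitaryGroup A ξ x⟫ = ∫ t, Complex.exp ((ξ * t : ℝ) * Complex.I) ∂(spectralMeasure A x) := by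
  have hc : Continuous fun t : ℝ => Real.cos (ξ * t) := by fun_prop
  have hs : Continuous fun t : ℝ => Real.sin (ξ * t) := by fun_prop
  have hci : Integrable (fun t : ℝ => ((Real.cos (ξ * t) : ℝ) : ℂ)) (spectralMeasure A x) :=
    integrable_spectralMeasure A x (by fun_prop) ⟨1, fun t => by
      rw [Complex.norm_real]; exact Real.abs_cos_le_one _⟩
  have hsi : Integrable (fun t : ℝ => ((Real.sin (ξ * t) : ℝ) : ℂ)) (spectralMeasure A x) :=
    integrable_spectralMeasure A x (by fun_prop) ⟨1, fun t => by
      rw [Complex.norm_real]; exact Real.abs_sin_le_one _⟩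
  simp_rw [Complex.exp_mul_I, ← Complex.ofReal_cos, ← Complex.ofReal_sin]
  rw [integral_add hci (hsi.mul_const _), integral_mul_const, integral_complex_ofReal,
    integral_complex_ofReal, integral_spectralMeasure_of_continuous A x hc,
    integral_spectralMeasure_of_continuous A x hs, unitaryGroup_eq_cfc hA,
    add_apply, inner_add_right, smul_apply,
    inner_smul_right, mul_comm Complex.I]

theorem norm_unitaryGroup_apply {A : H →L[ℂ] H} (hA : IsSelfAdjoint A) (ξ : ℝ) (x : H) :
    ‖unitaryGroup A ξ x‖ = ‖x‖ := by
  have hskew : ξ • (Complex.I • A) ∈ skewAdjoint (H →L[ℂ] H) := by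
    rw [skewAdjoint.mem_iff, star_smul, star_smul, hA.star_eq]
    simp
  let _ : NormedAlgebra ℚ (H →L[ℂ] H) := .restrictScalars ℚ ℂ (H →L[ℂ] H)
  have h : unitaryGroup A ξ ∈ unitary (H →L[ℂ] H) :=
    NormedSpace.exp_mem_unitary_of_mem_skewAdjoint hskew
  exact ContinuousLinearMap.norm_map_of_mem_unitary h x

theorem unitaryGroup_neg (A : H →L[ℂ] H) (ξ : ℝ) :
    unitaryGroup (-A) ξ = unitaryGroup A (-ξ) := by
  rw [unitaryGroup, unitaryGroup, smul_neg, smul_neg, neg_smul]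

omit [CompleteSpace H] in
theorem hasDerivAt_clm_apply {S : ℝ → H →L[ℂ] H} {S' : H →L[ℂ] H} {w : ℝ → H} {w' : H} {t : ℝ}
    (hS : HasDerivAt S S' t) (hw : HasDerivAt w w' t) :
    HasDerivAt (fun t => S t (w t)) (S' (w t) + S t w') t := by
  have h1 : HasDerivAt (fun t => (S t).restrictScalars ℝ) (S'.restrictScalars ℝ) t :=
    (ContinuousLinearMap.restrictScalarsL ℂ H H ℝ ℝ).hasFDerivAt.comp_hasDerivAt t hS
  exact h1.clm_apply hw

/-- Growth of a weighted norm along the unitary group, from a commutator estimate. -/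
theorem norm_weight_unitaryGroup_le_of_nonneg {A M : H →L[ℂ] H} (hA : IsSelfAdjoint A) {c k : ℝ}
    (hc : 0 < c) (hk : 0 ≤ k)
    (h : ∀ L : ℝ, 1 ≤ L → ∀ u, ‖M (A u) - A (M u)‖ ≤ c / L * ‖M u‖ + c * L ^ (k - 1) * ‖u‖)
    (hM : ∀ u, ‖u‖ ≤ ‖M u‖) (u : H) {T : ℝ} (hT : 0 ≤ T) :
    ‖M (unitaryGroup A T u)‖ ≤ 2 * Real.exp c * (1 + T) ^ k * ‖M u‖ := by
  set U := unitaryGroup A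
  -- Conjugating back by the unitary group leaves the norm of M U(t) u unchanged, while the
  -- derivative of v contains the commutator of M and A only.
  set v : ℝ → H := fun t => U (-t) (M (U t u))
  have hv : ∀ t, HasDerivAt v (U (-t) (Complex.I • (M (A (U t u)) - A (M (U t u))))) t := by
    intro t
    have h1 : HasDerivAt (fun t => U t u) (U t (Complex.I • A u)) t := by
      simpa using hasDerivAt_clm_apply (hasDerivAt_unitaryGroup A t) (hasDerivAt_const t u)
    have h2 : HasDerivAt (fun t => M (U t u)) (M (U t (Complex.I • A u))) t :=
      (M.restrictScalars ℝ).hasFDerivAt.comp_hasDerivAt t h1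
    have h3 : HasDerivAt (fun t => U (-t)) (-(U (-t) * (Complex.I • A))) t := by
      have := (hasDerivAt_unitaryGroup A (-t)).scomp t (hasDerivAt_neg t)
      rwa [neg_one_smul] at this
    have h4 := hasDerivAt_clm_apply h3 h2
    refine h4.congr_deriv ?_
    have hcomm : U t (A u) = A (U t u) :=
      congrArg (fun S : H →L[ℂ] H => S u) (unitaryGroup_comm A t).symm.eq
    rw [map_smul, hcomm, smul_sub, map_sub]
    simp only [neg_apply, ContinuousLinearMap.mul_apply, smul_apply, map_smul]
    abel
  have hnv : ∀ t, ‖v t‖ = ‖M (U t u)‖ := fun t => norm_unitaryGroup_apply hA _ _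
  -- The commutator bound is used with L = 1 + T, the length of the time interval: the exponential
  -- in Gronwall's inequality stays below e^c, and the quotient ε/K is exactly (1 + T)^k ‖u‖.
  have hL : (1 : ℝ) ≤ 1 + T := by linarith
  have key := norm_le_gronwallBound_of_norm_deriv_right_le (f := v) (δ := ‖M u‖)
    (K := c / (1 + T)) (ε := c * (1 + T) ^ (k - 1) * ‖u‖) (a := 0) (b := T)
    (fun t _ => (hv t).continuousAt.continuousWithinAt)
    (fun t _ => (hv t).hasDerivWithinAt)
    (by rw [hnv, show U 0 = 1 from unitaryGroup_zero A]; rfl)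
    (fun t _ => by
      rw [norm_unitaryGroup_apply hA, norm_smul, Complex.norm_I, one_mul, hnv]
      refine (h _ hL _).trans_eq ?_
      rw [norm_unitaryGroup_apply hA])
    T ⟨hT, le_rfl⟩
  rw [hnv, sub_zero, gronwallBound_of_K_ne_0 (by positivity)] at key
  have h5 : c * (1 + T) ^ (k - 1) * ‖u‖ / (c / (1 + T)) = (1 + T) ^ k * ‖u‖ := by
    rw [Real.rpow_sub_one (by positivity)]
    field_simp
  have h6 : Real.exp (c / (1 + T) * T) ≤ Real.exp c := by
    refine Real.exp_le_exp.2 ?_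
    rw [div_mul_eq_mul_div, div_le_iff₀ (by positivity)]
    nlinarith
  have h7 : (1 : ℝ) ≤ (1 + T) ^ k := Real.one_le_rpow hL hk
  rw [h5] at key
  calc ‖M (U T u)‖ ≤ _ := key
    _ ≤ ‖M u‖ * Real.exp c + (1 + T) ^ k * ‖M u‖ * Real.exp c := by
        have hE : Real.exp (c / (1 + T) * T) - 1 ≤ Real.exp c := by linarith
        have hE0 : 0 ≤ Real.exp (c / (1 + T) * T) - 1 :=
          sub_nonneg.2 (Real.one_le_exp (by positivity))
        exact add_le_add (mul_le_mul_of_nonneg_left h6 (norm_nonneg _))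
          (mul_le_mul (mul_le_mul_of_nonneg_left (hM u) (by positivity)) hE hE0 (by positivity))
    _ ≤ (1 + T) ^ k * ‖M u‖ * Real.exp c + (1 + T) ^ k * ‖M u‖ * Real.exp c := by
        have : ‖M u‖ ≤ (1 + T) ^ k * ‖M u‖ := le_mul_of_one_le_left (norm_nonneg _) h7
        gcongr
    _ = _ := by ring

/-- The commutator hypothesis is invariant under A ↦ -A, and this change of sign reverses time. -/
theorem norm_weight_unitaryGroup_le {A M : H →L[ℂ] H} (hA : IsSelfAdjoint A) {c k : ℝ}
    (hc : 0 < c) (hk : 0 ≤ k)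
    (h : ∀ L : ℝ, 1 ≤ L → ∀ u, ‖M (A u) - A (M u)‖ ≤ c / L * ‖M u‖ + c * L ^ (k - 1) * ‖u‖)
    (hM : ∀ u, ‖u‖ ≤ ‖M u‖) (u : H) (T : ℝ) :
    ‖M (unitaryGroup A T u)‖ ≤ 2 * Real.exp c * (1 + |T|) ^ k * ‖M u‖ := by
  rcases le_total 0 T with hT | hT
  · rw [abs_of_nonneg hT]
    exact norm_weight_unitaryGroup_le_of_nonneg hA hc hk h hM u hT
  · have := norm_weight_unitaryGroup_le_of_nonneg (A := -A) (M := M) hA.neg hc hk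
      (fun L hL u => by
        refine le_trans (le_of_eq ?_) (h L hL u)
        rw [neg_apply, neg_apply, map_neg, ← neg_sub_neg, norm_sub_rev]
        simp) hM u (neg_nonneg.2 hT)
    rwa [unitaryGroup_neg, neg_neg, ← abs_of_nonpos hT] at this

/-- The Fourier representation `G(A) = ∫ Ĝ(ξ) e^{2πiξA} dξ`. -/
theorem borelCalculus_schwartz {A : H →L[ℂ] H} (hA : IsSelfAdjoint A) (G : 𝓢(ℝ, ℂ)) :
    Integrable (fun ξ : ℝ => (𝓕 G) ξ • unitaryGroup A (2 * Real.pi * ξ)) ∧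
    borelCalculus A G = ∫ ξ : ℝ, (𝓕 G) ξ • unitaryGroup A (2 * Real.pi * ξ) := by
  have hcont : Continuous fun ξ : ℝ => (𝓕 G) ξ • unitaryGroup A (2 * Real.pi * ξ) :=
    (𝓕 G).continuous.smul ((continuous_unitaryGroup A).comp (by fun_prop))
  have hi : Integrable (fun ξ : ℝ => (𝓕 G) ξ • unitaryGroup A (2 * Real.pi * ξ)) := by
    refine ((𝓕 G).integrable (μ := volume)).mono hcont.aestronglyMeasurable
      (Filter.Eventually.of_forall fun ξ => ?_)
    rw [norm_smul]
    refine mul_le_of_le_one_right (norm_nonneg _) ?_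
    exact ContinuousLinearMap.opNorm_le_bound _ zero_le_one fun x => by
      rw [norm_unitaryGroup_apply hA, one_mul]
  refine ⟨hi, borelCalculus_eq_of_inner G.continuous.measurable ?_ fun x => ?_⟩
  · obtain ⟨C, -, hC⟩ := G.decay 0 0
    exact ⟨C, fun t => by simpa using hC t⟩
  have h1 : ∀ ξ : ℝ, ⟪x, ((𝓕 G) ξ • unitaryGroup A (2 * Real.pi * ξ)) x⟫
      = ∫ t, (𝓕 G) ξ * Complex.exp ((2 * Real.pi * ξ * t : ℝ) * Complex.I)
        ∂(spectralMeasure A x) := fun ξ => by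
    rw [smul_apply, inner_smul_right, inner_unitaryGroup hA,
      ← integral_const_mul]
  rw [ContinuousLinearMap.integral_apply hi, ← integral_inner (hi.apply_continuousLinearMap x)]
  simp_rw [h1]
  -- After Fubini, the inner integral is the Fourier inversion formula for G at the point t.
  rw [integral_integral_swap]
  · refine integral_congr_ae (Filter.Eventually.of_forall fun t => ?_)
    have h2 : 𝓕⁻ (𝓕 G) = G := FourierTransform.fourierInv_fourier_eq G
    have h3 : (𝓕⁻ (𝓕 G)) t = G t := by rw [h2]
    simp only
    rw [← h3, SchwartzMap.fourierInv_coe, Real.fourierInv_eq']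
    refine integral_congr_ae (Filter.Eventually.of_forall fun ξ => ?_)
    simp only [smul_eq_mul, RCLike.inner_apply, conj_trivial]
    rw [mul_comm]
    congr 4
    ring
  · have := ((𝓕 G).integrable (μ := volume)).mul_prod
      (integrable_const (μ := spectralMeasure A x) (1 : ℂ))
    refine this.mono ?_ (Filter.Eventually.of_forall fun z => ?_)
    · refine Continuous.aestronglyMeasurable ?_
      have := (𝓕 G).continuous
      simp only [Function.uncurry_def]
      fun_prop
    · simp only [Function.uncurry, norm_mul, Complex.norm_exp_ofReal_mul_I, norm_one]
      exact le_rfl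

/-- The weighted norm of `G(A) u` for a Schwartz function `G`. -/
theorem norm_weight_borelCalculus_le {A M : H →L[ℂ] H} (hA : IsSelfAdjoint A) {c k : ℝ}
    (hc : 0 < c) (hk : 0 ≤ k)
    (h : ∀ L : ℝ, 1 ≤ L → ∀ u, ‖M (A u) - A (M u)‖ ≤ c / L * ‖M u‖ + c * L ^ (k - 1) * ‖u‖)
    (hM : ∀ u, ‖u‖ ≤ ‖M u‖) (G : 𝓢(ℝ, ℂ)) {β : ℝ}
    (hi : Integrable fun ξ : ℝ => ‖(𝓕 G) ξ‖ * (1 + |2 * Real.pi * ξ|) ^ k)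
    (hβ : ∫ ξ : ℝ, ‖(𝓕 G) ξ‖ * (1 + |2 * Real.pi * ξ|) ^ k ≤ β) (u : H) :
    ‖M (borelCalculus A G u)‖ ≤ 2 * Real.exp c * β * ‖M u‖ := by
  obtain ⟨hint, hG⟩ := borelCalculus_schwartz hA G
  have hcomm : M (∫ ξ : ℝ, ((𝓕 G) ξ • unitaryGroup A (2 * Real.pi * ξ)) u)
      = ∫ ξ : ℝ, M (((𝓕 G) ξ • unitaryGroup A (2 * Real.pi * ξ)) u) :=
    (M.integral_comp_comm (hint.apply_continuousLinearMap u)).symm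
  rw [hG, ContinuousLinearMap.integral_apply hint, hcomm]
  have hb : ∀ ξ : ℝ, ‖M (((𝓕 G) ξ • unitaryGroup A (2 * Real.pi * ξ)) u)‖ ≤
      ‖(𝓕 G) ξ‖ * (1 + |2 * Real.pi * ξ|) ^ k * (2 * Real.exp c * ‖M u‖) := fun ξ => by
    have h1 := norm_weight_unitaryGroup_le hA hc hk h hM u (2 * Real.pi * ξ)
    have h2 : ‖M (((𝓕 G) ξ • unitaryGroup A (2 * Real.pi * ξ)) u)‖
        = ‖(𝓕 G) ξ‖ * ‖M (unitaryGroup A (2 * Real.pi * ξ) u)‖ := by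
      rw [smul_apply, map_smul, norm_smul]
    have h3 := mul_le_mul_of_nonneg_left h1 (norm_nonneg ((𝓕 G) ξ))
    rw [h2]
    linarith
  refine (norm_integral_le_of_norm_le (hi.mul_const _) (Filter.Eventually.of_forall hb)).trans ?_
  rw [integral_mul_const]
  calc _ ≤ β * (2 * Real.exp c * ‖M u‖) := by gcongr
    _ = _ := by ring

end FunctionalCalculus

end SpectralMultiplier
end

noncomputable section
namespace SpectralMultiplier

/-! ### Schur's test for nonnegative matrices -/

section Schur

variable {ι κ : Type*}

/-- Cauchy–Schwarz for √b and √b·c. The weight b is kept to the first power in both factors, so that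
row sums and column sums can be used separately. -/
theorem ENNReal_sq_tsum_mul_le (b c : ι → ℝ≥0∞) :
    (∑' j, b j * c j) ^ 2 ≤ (∑' j, b j) * ∑' j, b j * c j ^ 2 := by
  let _ : MeasurableSpace ι := ⊤
  have hm : ∀ f : ι → ℝ≥0∞, AEMeasurable f Measure.count := fun f => measurable_from_top.aemeasurable
  have h := ENNReal.lintegral_mul_le_Lp_mul_Lq (Measure.count : Measure ι)
    Real.HolderConjugate.two_two (hm fun j => b j ^ (1 / 2 : ℝ))
    (hm fun j => b j ^ (1 / 2 : ℝ) * c j)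
  have e1 : ∀ j, b j ^ (1 / 2 : ℝ) * (b j ^ (1 / 2 : ℝ) * c j) = b j * c j := fun j => by
    rw [← mul_assoc, ← ENNReal.rpow_add_of_nonneg _ _ (by norm_num) (by norm_num)]
    norm_num
  have e2 : ∀ j, (b j ^ (1 / 2 : ℝ)) ^ (2 : ℝ) = b j := fun j => by
    rw [← ENNReal.rpow_mul]; norm_num
  have e3 : ∀ j, (b j ^ (1 / 2 : ℝ) * c j) ^ (2 : ℝ) = b j * c j ^ 2 := fun j => by
    rw [ENNReal.mul_rpow_of_nonneg _ _ (by norm_num), e2, ENNReal.rpow_two]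
  simp only [Pi.mul_apply, e1, e2, e3, lintegral_count] at h
  calc (∑' j, b j * c j) ^ 2
      ≤ ((∑' j, b j) ^ (1 / 2 : ℝ) * (∑' j, b j * c j ^ 2) ^ (1 / 2 : ℝ)) ^ 2 := by gcongr
    _ = _ := by
        rw [mul_pow, ← ENNReal.rpow_two, ← ENNReal.rpow_two, ← ENNReal.rpow_mul,
          ← ENNReal.rpow_mul]
        norm_num

theorem tsum_sq_tsum_le_of_schur {b : ι → κ → ℝ≥0∞} (c : κ → ℝ≥0∞) {K : ℝ≥0∞}
    (hrow : ∀ i, ∑' j, b i j ≤ K) (hcol : ∀ j, ∑' i, b i j ≤ K) :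
    ∑' i, (∑' j, b i j * c j) ^ 2 ≤ K ^ 2 * ∑' j, c j ^ 2 := by
  calc ∑' i, (∑' j, b i j * c j) ^ 2
      ≤ ∑' i, K * ∑' j, b i j * c j ^ 2 := ENNReal.tsum_le_tsum fun i =>
        (ENNReal_sq_tsum_mul_le _ _).trans (by gcongr; exact hrow i)
    _ = K * ∑' j, (∑' i, b i j) * c j ^ 2 := by
        rw [ENNReal.tsum_mul_left, ENNReal.tsum_comm]
        simp_rw [ENNReal.tsum_mul_right]
    _ ≤ K * ∑' j, K * c j ^ 2 := by
        gcongr with j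
        exact hcol j
    _ = _ := by rw [ENNReal.tsum_mul_left, sq, mul_assoc]

end Schur

/-! ### Multiplication operators on L² and block decompositions -/

section Blocks

variable {X : Type*} [MeasurableSpace X] {μ : Measure X}

/-- A bounded measurable real function. -/
structure IsBddMeasurable (φ : X → ℝ) : Prop where
  measurable : Measurable φ
  bounded : ∃ C, ∀ x, |φ x| ≤ C

theorem IsBddMeasurable.memLp {φ : X → ℝ} (h : IsBddMeasurable φ) :
    MemLp (fun x => (φ x : ℂ)) ∞ μ := by
  obtain ⟨C, hC⟩ := h.bounded
  exact memLp_top_of_bound (Complex.measurable_ofReal.comp h.measurable).aestronglyMeasurable C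
    (Filter.Eventually.of_forall fun x => by
      rw [Complex.norm_real]; exact hC x)

theorem IsBddMeasurable.indicator_one {s : Set X} (hs : MeasurableSet s) :
    IsBddMeasurable (s.indicator (1 : X → ℝ)) :=
  ⟨measurable_one.indicator hs, 1, fun x => by
    by_cases hx : x ∈ s <;> simp [hx]⟩

open Classical in
/-- Multiplication by a bounded measurable function as an operator on `L²`. -/
def mulOp (μ : Measure X) (φ : X → ℝ) : Lp ℂ 2 μ →L[ℂ] Lp ℂ 2 μ :=
  if h : MemLp (fun x => (φ x : ℂ)) ∞ μ then
    (ContinuousLinearMap.mul ℂ ℂ).holderL μ ∞ 2 2 h.toLp else 0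

theorem mulOp_ae {φ : X → ℝ} (h : IsBddMeasurable φ) (u : Lp ℂ 2 μ) :
    mulOp μ φ u =ᵐ[μ] fun x => (φ x : ℂ) * u x := by
  have h2 : MemLp (fun x => (φ x : ℂ)) ∞ μ := h.memLp
  rw [mulOp, dif_pos h2]
  filter_upwards [ContinuousLinearMap.coeFn_holder (r := 2) (ContinuousLinearMap.mul ℂ ℂ)
    h2.toLp u, h2.coeFn_toLp] with x hx hx2
  have : ((ContinuousLinearMap.mul ℂ ℂ).holderL μ ∞ 2 2 h2.toLp) u
    = (ContinuousLinearMap.mul ℂ ℂ).holder 2 h2.toLp u := rfl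
  rw [this, hx, hx2]
  rfl

theorem mulOp_mulOp {φ ψ χ : X → ℝ} (hφ : IsBddMeasurable φ) (hψ : IsBddMeasurable ψ)
    (hχ : IsBddMeasurable χ) (h : ∀ x, φ x * ψ x = χ x) (u : Lp ℂ 2 μ) :
    mulOp μ φ (mulOp μ ψ u) = mulOp μ χ u := by
  refine Lp.ext ?_
  filter_upwards [mulOp_ae hφ (mulOp μ ψ u), mulOp_ae hψ u, mulOp_ae hχ u] with x h1 h2 h3
  rw [h1, h2, h3, ← h, Complex.ofReal_mul, mul_assoc]

theorem mulOp_const_mul {φ χ : X → ℝ} (c : ℝ) (hφ : IsBddMeasurable φ)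
    (hχ : IsBddMeasurable χ) (h : ∀ x, c * φ x = χ x) (u : Lp ℂ 2 μ) :
    mulOp μ χ u = (c : ℂ) • mulOp μ φ u := by
  refine Lp.ext ?_
  filter_upwards [mulOp_ae hφ u, Lp.coeFn_smul (c : ℂ) (mulOp μ φ u), mulOp_ae hχ u]
    with x h1 h2 h3
  rw [h2, Pi.smul_apply, h1, h3, ← h, Complex.ofReal_mul, smul_eq_mul, mul_assoc]

theorem enorm_sq_Lp (u : Lp ℂ 2 μ) : ‖u‖ₑ ^ 2 = ∫⁻ x, ‖u x‖ₑ ^ 2 ∂μ := by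
  rw [Lp.enorm_def, eLpNorm_eq_lintegral_rpow_enorm_toReal (by norm_num) (by norm_num)]
  rw [← ENNReal.rpow_two, ← ENNReal.rpow_mul]
  norm_num

theorem isSelfAdjoint_mulOp {φ : X → ℝ} (h : IsBddMeasurable φ) : IsSelfAdjoint (mulOp μ φ) := by
  rw [ContinuousLinearMap.isSelfAdjoint_iff_isSymmetric]
  intro u v
  simp only [ContinuousLinearMap.coe_coe, L2.inner_def]
  refine integral_congr_ae ?_
  filter_upwards [mulOp_ae h u, mulOp_ae h v] with x h1 h2
  rw [h1, h2]
  simp only [RCLike.inner_apply, map_mul, Complex.conj_ofReal]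
  ring

/-- A partition into measurable sets. -/
structure IsMeasurablePartition {ι : Type*} (Q : ι → Set X) : Prop where
  measurable : ∀ i, MeasurableSet (Q i)
  disjoint : Pairwise (Function.onFun Disjoint Q)
  cover : ⋃ i, Q i = Set.univ

/-- The operator of multiplication by the characteristic function of `s`. -/
def cutOp (μ : Measure X) (s : Set X) : Lp ℂ 2 μ →L[ℂ] Lp ℂ 2 μ :=
  mulOp μ (s.indicator 1)

theorem cutOp_ae {s : Set X} (hs : MeasurableSet s) (u : Lp ℂ 2 μ) :
    cutOp μ s u =ᵐ[μ] s.indicator u := by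
  filter_upwards [mulOp_ae (IsBddMeasurable.indicator_one hs) u] with x hx
  rw [cutOp, hx]
  by_cases h : x ∈ s <;> simp [h]

theorem enorm_sq_cutOp {s : Set X} (hs : MeasurableSet s) (u : Lp ℂ 2 μ) :
    ‖cutOp μ s u‖ₑ ^ 2 = ∫⁻ x in s, ‖u x‖ₑ ^ 2 ∂μ := by
  rw [enorm_sq_Lp, ← lintegral_indicator hs]
  refine lintegral_congr_ae ?_
  filter_upwards [cutOp_ae hs u] with x hx
  rw [hx]
  by_cases h : x ∈ s <;> simp [h]

theorem cutOp_cutOp_self {s : Set X} (hs : MeasurableSet s) (u : Lp ℂ 2 μ) :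
    cutOp μ s (cutOp μ s u) = cutOp μ s u :=
  mulOp_mulOp (.indicator_one hs) (.indicator_one hs) (.indicator_one hs)
    (fun x => by by_cases h : x ∈ s <;> simp [h]) u

theorem cutOp_cutOp_of_disjoint {s t : Set X} (hs : MeasurableSet s) (ht : MeasurableSet t)
    (hst : Disjoint s t) (u : Lp ℂ 2 μ) : cutOp μ s (cutOp μ t u) = 0 := by
  refine Lp.ext ?_
  filter_upwards [cutOp_ae hs (cutOp μ t u), cutOp_ae ht u, Lp.coeFn_zero ℂ 2 μ] with x h1 h2 h3
  rw [h1, h3]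
  by_cases h : x ∈ s
  · simp [h, h2, Set.disjoint_left.1 hst h]
  · simp [h]

theorem isSelfAdjoint_cutOp {s : Set X} (hs : MeasurableSet s) : IsSelfAdjoint (cutOp μ s) :=
  isSelfAdjoint_mulOp (.indicator_one hs)

variable {ι : Type*} [Countable ι] {Q : ι → Set X}

theorem IsMeasurablePartition.tsum_enorm_sq (hQ : IsMeasurablePartition Q) (u : Lp ℂ 2 μ) :
    ∑' i, ‖cutOp μ (Q i) u‖ₑ ^ 2 = ‖u‖ₑ ^ 2 := by
  rw [enorm_sq_Lp, ← setLIntegral_univ, ← hQ.cover, lintegral_iUnion hQ.measurable hQ.disjoint]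
  exact tsum_congr fun i => enorm_sq_cutOp (hQ.measurable i) u

-- The remainder after finitely many blocks has exactly the omitted blocks, so its squared norm is a
-- tail of a convergent series.
open Classical in
theorem IsMeasurablePartition.hasSum_cutOp (hQ : IsMeasurablePartition Q) (u : Lp ℂ 2 μ) :
    HasSum (fun i => cutOp μ (Q i) u) u := by
  have h0 : Filter.Tendsto (fun s : Finset ι => ∑' i : { i // i ∉ s }, ‖cutOp μ (Q i) u‖ₑ ^ 2)
      Filter.atTop (nhds 0) := by
    refine ENNReal.tendsto_tsum_compl_atTop_zero (f := fun i => ‖cutOp μ (Q i) u‖ₑ ^ 2) ?_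
    rw [hQ.tsum_enorm_sq]
    exact (ENNReal.pow_lt_top enorm_lt_top).ne
  have h1 : ∀ s : Finset ι, ‖u - ∑ i ∈ s, cutOp μ (Q i) u‖ₑ ^ 2
      = ∑' i : { i // i ∉ s }, ‖cutOp μ (Q i) u‖ₑ ^ 2 := by
    intro s
    rw [← hQ.tsum_enorm_sq, ← tsum_subtype_eq_of_support_subset (s := {i | i ∉ s})]
    · refine tsum_congr fun ⟨i, hi⟩ => ?_
      rw [map_sub, map_sum, Finset.sum_eq_zero, sub_zero]
      intro j hj
      exact cutOp_cutOp_of_disjoint (hQ.measurable i) (hQ.measurable j)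
        (hQ.disjoint fun h => hi (h ▸ hj)) u
    · intro i hi his
      apply hi
      simp only
      rw [map_sub, map_sum, Finset.sum_eq_single_of_mem i his, cutOp_cutOp_self (hQ.measurable i),
        sub_self]
      · simp
      · intro j _ hj
        exact cutOp_cutOp_of_disjoint (hQ.measurable i) (hQ.measurable j) (hQ.disjoint hj.symm) u
  rw [HasSum, SummationFilter.unconditional_filter, tendsto_iff_edist_tendsto_0]
  simp_rw [← h1] at h0
  have h2 := (ENNReal.continuous_rpow_const (y := 1 / 2)).tendsto 0 |>.comp h0
  have h3 : ∀ s : Finset ι, edist (∑ i ∈ s, cutOp μ (Q i) u) u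
      = (‖u - ∑ i ∈ s, cutOp μ (Q i) u‖ₑ ^ 2) ^ (1 / 2 : ℝ) := fun s => by
    rw [edist_comm, edist_eq_enorm_sub, ← ENNReal.rpow_two, ← ENNReal.rpow_mul]
    norm_num
  simp_rw [h3]
  simpa [Function.comp_def] using h2

/-- The triangle inequality is applied inside each output block and orthogonality across them. The
bounds may depend on u, so they can carry any norm of the input blocks, for instance their L^p
norms. -/
theorem IsMeasurablePartition.enorm_sq_apply_le (hQ : IsMeasurablePartition Q)
    (T : Lp ℂ 2 μ →L[ℂ] Lp ℂ 2 μ) (u : Lp ℂ 2 μ) {b : ι → ι → ℝ≥0∞}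
    (h : ∀ i j, ‖cutOp μ (Q i) (T (cutOp μ (Q j) u))‖ₑ ≤ b i j) :
    ‖T u‖ₑ ^ 2 ≤ ∑' i, (∑' j, b i j) ^ 2 := by
  rw [← hQ.tsum_enorm_sq]
  refine ENNReal.tsum_le_tsum fun i => ?_
  gcongr
  have hs : HasSum (fun j => cutOp μ (Q i) (T (cutOp μ (Q j) u))) (cutOp μ (Q i) (T u)) :=
    ((hQ.hasSum_cutOp u).mapL T).mapL (cutOp μ (Q i))
  have hlim : Filter.Tendsto
      (fun s : Finset ι => ‖∑ j ∈ s, cutOp μ (Q i) (T (cutOp μ (Q j) u))‖ₑ)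
      Filter.atTop (nhds ‖cutOp μ (Q i) (T u)‖ₑ) := (continuous_enorm.tendsto _).comp hs
  refine le_of_tendsto hlim (Filter.Eventually.of_forall fun s => ?_)
  calc _ ≤ ∑ j ∈ s, ‖cutOp μ (Q i) (T (cutOp μ (Q j) u))‖ₑ := enorm_sum_le _ _
    _ ≤ ∑ j ∈ s, b i j := Finset.sum_le_sum fun j _ => h i j
    _ ≤ _ := ENNReal.sum_le_tsum s

end Blocks

end SpectralMultiplier
end

noncomputable section
namespace SpectralMultiplier

/-! ### Volume comparison, nets and partitions in a doubling space -/

section Geometry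

variable {X : Type*} [MetricSpace X] [MeasurableSpace X] {μ : Measure X}

/-- The volume of a ball as a real number. -/
def ballVol (μ : Measure X) (x : X) (r : ℝ) : ℝ := (μ (Metric.ball x r)).toReal

/-- The doubling condition with a fixed constant `D`. -/
structure IsDoublingWith (μ : Measure X) (n D : ℝ) : Prop where
  exponent_pos : 0 < n
  ball_pos : ∀ (x : X) (r : ℝ), 0 < r → 0 < μ (Metric.ball x r)
  ball_lt_top : ∀ (x : X) (r : ℝ), μ (Metric.ball x r) < ∞
  one_le : 1 ≤ D
  doubling : ∀ (x : X) (r l : ℝ), 0 < r → 1 ≤ l → ballVol μ x (l * r) ≤ D * l ^ n * ballVol μ x r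

theorem IsDoublingMeasure.exists_isDoublingWith {n : ℝ} (hn : 0 < n) (h : IsDoublingMeasure μ n) :
    ∃ D, IsDoublingWith μ n D := by
  obtain ⟨C, hC⟩ := h.doubling
  refine ⟨max C 1, hn, h.ball_pos, fun x r => ?_, le_max_right _ _, fun x r l hr hl => ?_⟩
  · rcases le_or_gt r 0 with hr | hr
    · simp [Metric.ball_eq_empty.2 hr]
    · exact h.ball_lt_top x r hr
  · have hl0 : (0 : ℝ) ≤ l ^ n := Real.rpow_nonneg (by linarith) _
    have h1 := (hC x r l hr hl).trans (mul_le_mul_left (ENNReal.ofReal_le_ofReal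
      (mul_le_mul_of_nonneg_right (le_max_left C 1) hl0)) _)
    have h2 := ENNReal.toReal_mono (ENNReal.mul_ne_top ENNReal.ofReal_ne_top
      (h.ball_lt_top x r hr).ne) h1
    rwa [ENNReal.toReal_mul, ENNReal.toReal_ofReal (by positivity)] at h2

namespace IsDoublingWith

variable {n D : ℝ} (h : IsDoublingWith μ n D)
include h

theorem vol_pos (x : X) {r : ℝ} (hr : 0 < r) : 0 < ballVol μ x r :=
  ENNReal.toReal_pos (h.ball_pos x r hr).ne' (h.ball_lt_top x r).ne

theorem vol_le {x y : X} {r R l : ℝ} (hr : 0 < r) (hl : 1 ≤ l) (hle : dist x y + R ≤ l * r) :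
    ballVol μ x R ≤ D * l ^ n * ballVol μ y r := by
  refine le_trans (ENNReal.toReal_mono (h.ball_lt_top y (l * r)).ne (measure_mono ?_))
    (h.doubling y r l hr hl)
  exact Metric.ball_subset_ball' (by linarith)

end IsDoublingWith

/-- A maximal `r`-separated set. -/
structure IsNet (S : Set X) (r : ℝ) : Prop where
  sep : ∀ x ∈ S, ∀ y ∈ S, x ≠ y → r ≤ dist x y
  cover : ∀ x, ∃ y ∈ S, dist x y < r

omit [MeasurableSpace X] in
variable (X) in
theorem exists_isNet {r : ℝ} (hr : 0 < r) : ∃ S : Set X, IsNet S r := by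
  obtain ⟨S, hS⟩ := zorn_subset {S : Set X | ∀ x ∈ S, ∀ y ∈ S, x ≠ y → r ≤ dist x y}
    (fun c hc hchain => ⟨⋃₀ c, fun x hx y hy hxy => by
      obtain ⟨s, hs, hxs⟩ := hx
      obtain ⟨t, ht, hyt⟩ := hy
      rcases hchain.total hs ht with hst | hst
      · exact hc ht x (hst hxs) y hyt hxy
      · exact hc hs x hxs y (hst hyt) hxy, fun s hs => Set.subset_sUnion_of_mem hs⟩)
  refine ⟨S, hS.prop, fun x => ?_⟩
  by_contra! hx
  have hxS : x ∉ S := fun hmem => by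
    have := hx x hmem
    rw [dist_self] at this
    linarith
  have h2 : insert x S ∈ {S : Set X | ∀ x ∈ S, ∀ y ∈ S, x ≠ y → r ≤ dist x y} := by
    intro a ha b hb hab
    rcases ha with rfl | ha <;> rcases hb with rfl | hb
    · exact absurd rfl hab
    · exact hx b hb
    · rw [dist_comm]; exact hx a ha
    · exact hS.prop a ha b hb hab
  exact hxS (hS.le_of_ge h2 (Set.subset_insert x S) (Set.mem_insert x S))

omit [MeasurableSpace X] in
theorem IsNet.disjoint {S : Set X} {r : ℝ} (hS : IsNet S r) :
    S.PairwiseDisjoint fun x => Metric.ball x (r / 2) := by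
  intro x hx y hy hxy
  exact Metric.ball_disjoint_ball (by linarith [hS.sep x hx y hy hxy])

omit [MeasurableSpace X] in
theorem IsNet.countable [TopologicalSpace.SeparableSpace X] {S : Set X} {r : ℝ} (hr : 0 < r)
    (hS : IsNet S r) : S.Countable :=
  hS.disjoint.countable_of_isOpen (fun _ _ => Metric.isOpen_ball)
    fun x _ => ⟨x, Metric.mem_ball_self (by positivity)⟩

variable [BorelSpace X]

/-- The balls of radius r/2 around the net points are disjoint and lie in B(x, 2R), while doubling
makes each of them a fixed fraction of that ball. -/
theorem IsDoublingWith.card_le {n D : ℝ} (h : IsDoublingWith μ n D) {S : Set X} {r R : ℝ}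
    (hr : 0 < r) (hS : IsNet S r) (hrR : r ≤ R) (x : X) (T : Finset S)
    (hT : ∀ y ∈ T, dist x y < R) : (T.card : ℝ) ≤ D * (8 * (R / r)) ^ n := by
  have hR : 0 < R := hr.trans_le hrR
  have h1 : ∑ y ∈ T, ballVol μ (y : X) (r / 2) ≤ ballVol μ x (2 * R) := by
    have hd : (T : Set S).PairwiseDisjoint fun y => Metric.ball (y : X) (r / 2) :=
      fun y _ z _ hyz => hS.disjoint y.2 z.2 fun hh => hyz (Subtype.ext hh)
    have h2 := measure_biUnion_finset (μ := μ) hd fun _ _ => measurableSet_ball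
    have h3 : μ (⋃ y ∈ T, Metric.ball (y : X) (r / 2)) ≤ μ (Metric.ball x (2 * R)) := by
      refine measure_mono (Set.iUnion₂_subset fun y hy => Metric.ball_subset_ball' ?_)
      have := hT y hy
      rw [dist_comm] at this
      linarith
    rw [h2] at h3
    have h4 := ENNReal.toReal_mono (h.ball_lt_top _ _).ne h3
    rwa [ENNReal.toReal_sum fun y _ => (h.ball_lt_top _ _).ne] at h4
  have h5 : ∀ y ∈ T, ballVol μ x (2 * R) ≤ D * (8 * (R / r)) ^ n * ballVol μ (y : X) (r / 2) := by
    intro y hy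
    refine h.vol_le (by positivity) ?_ ?_
    · have : 1 ≤ R / r := (one_le_div hr).2 hrR
      linarith
    · have := hT y hy
      have h6 : 8 * (R / r) * (r / 2) = 4 * R := by field_simp; norm_num
      rw [h6]; linarith
  have h7 := Finset.sum_le_sum h5
  rw [Finset.sum_const, nsmul_eq_mul, ← Finset.mul_sum] at h7
  have hV := h.vol_pos x (r := 2 * R) (by positivity)
  have hD := h.one_le
  have h8 : (T.card : ℝ) * ballVol μ x (2 * R) ≤ D * (8 * (R / r)) ^ n * ballVol μ x (2 * R) :=
    h7.trans (mul_le_mul_of_nonneg_left h1 (by positivity))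
  exact le_of_mul_le_mul_right h8 hV

theorem IsDoublingWith.tsum_indicator_le {n D : ℝ} (h : IsDoublingWith μ n D) {S : Set X}
    {r R : ℝ} (hr : 0 < r) (hS : IsNet S r) (hrR : r ≤ R) (x : X) :
    ∑' y : S, (Metric.ball x R).indicator (1 : X → ℝ≥0∞) y
      ≤ ENNReal.ofReal (D * (8 * (R / r)) ^ n) := by
  classical
  rw [ENNReal.tsum_eq_iSup_sum]
  refine iSup_le fun T => ?_
  have h1 : ∑ y ∈ T, (Metric.ball x R).indicator (1 : X → ℝ≥0∞) y
      = ((T.filter fun y : S => dist x y < R).card : ℝ≥0∞) := by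
    rw [Finset.card_filter, Nat.cast_sum]
    refine Finset.sum_congr rfl fun y _ => ?_
    simp only [Set.indicator_apply, Metric.mem_ball, dist_comm x, Pi.one_apply]
    split_ifs <;> simp
  rw [h1, ← ENNReal.ofReal_natCast]
  exact ENNReal.ofReal_le_ofReal (h.card_le hr hS hrR x _ fun y hy => (Finset.mem_filter.1 hy).2)

/-- The constant in the summation of polynomially decaying weights over a net. -/
def netConst (n D δ : ℝ) : ℝ := D * 16 ^ n * (1 - 2 ^ (-δ))⁻¹

omit [BorelSpace X] in
theorem IsDoublingWith.netConst_pos {n D δ : ℝ} (h : IsDoublingWith μ n D) (hδ : 0 < δ) :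
    0 < netConst n D δ := by
  have h1 : (2 : ℝ) ^ (-δ) < 1 := Real.rpow_lt_one_of_one_lt_of_neg (by norm_num) (by linarith)
  have h2 : 0 < (1 - (2 : ℝ) ^ (-δ))⁻¹ := inv_pos.2 (by linarith)
  have := h.one_le
  unfold netConst
  positivity

/-- The shell 2^m ≤ 1 + d/r < 2^{m+1} has at most D·16^n·2^{mn} net points, each of weight at most
2^{-m(n+δ)}. What remains is a geometric series of ratio 2^{-δ}. -/
theorem IsDoublingWith.tsum_decay_le {n D δ : ℝ} (h : IsDoublingWith μ n D) (hδ : 0 < δ)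
    {S : Set X} {r : ℝ} (hr : 0 < r) (hS : IsNet S r) (x : X) :
    ∑' y : S, ENNReal.ofReal ((1 + dist x y / r) ^ (-(n + δ)))
      ≤ ENNReal.ofReal (netConst n D δ) := by
  have hn := h.exponent_pos
  have hD := h.one_le
  set w : ℕ → ℝ := fun m => ((2 : ℝ) ^ m) ^ (-(n + δ))
  have hw : ∀ m, 0 < w m := fun m => by positivity
  have h1 : ∀ y : S, ENNReal.ofReal ((1 + dist x y / r) ^ (-(n + δ))) ≤
      ∑' m : ℕ, ENNReal.ofReal (w m) *
        (Metric.ball x (2 ^ (m + 1) * r)).indicator (1 : X → ℝ≥0∞) y := by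
    intro y
    have h0 : 0 ≤ dist x y / r := by positivity
    obtain ⟨m, hm1, hm2⟩ := exists_nat_pow_near (x := 1 + dist x (y : X) / r) (by linarith)
      (one_lt_two)
    refine le_trans ?_ (ENNReal.le_tsum m)
    have hmem : (y : X) ∈ Metric.ball x (2 ^ (m + 1) * r) := by
      rw [Metric.mem_ball, dist_comm, ← div_lt_iff₀ hr]
      linarith
    rw [Set.indicator_of_mem hmem, Pi.one_apply, mul_one]
    refine ENNReal.ofReal_le_ofReal ?_
    exact Real.rpow_le_rpow_of_nonpos (by positivity) hm1 (by linarith)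
  have h3 : ∀ m : ℕ, w m * (D * (8 * (2 ^ (m + 1) * r / r)) ^ n)
      = D * 16 ^ n * ((2 : ℝ) ^ (-δ)) ^ m := by
    intro m
    have e1 : (8 : ℝ) * (2 ^ (m + 1) * r / r) = 16 * 2 ^ m := by
      field_simp; ring
    have e2 : ((2 : ℝ) ^ m) ^ (-(n + δ)) * ((2 : ℝ) ^ m) ^ n = ((2 : ℝ) ^ (-δ)) ^ m := by
      rw [← Real.rpow_add (by positivity), ← Real.rpow_natCast, ← Real.rpow_natCast,
        ← Real.rpow_mul (by norm_num), ← Real.rpow_mul (by norm_num)]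
      congr 1; ring
    rw [e1, Real.mul_rpow (by norm_num) (by positivity), ← e2]
    simp only [w]; ring
  have h2lt : (2 : ℝ) ^ (-δ) < 1 := Real.rpow_lt_one_of_one_lt_of_neg (by norm_num) (by linarith)
  calc ∑' y : S, ENNReal.ofReal ((1 + dist x y / r) ^ (-(n + δ)))
      ≤ ∑' (y : S) (m : ℕ), ENNReal.ofReal (w m) *
        (Metric.ball x (2 ^ (m + 1) * r)).indicator (1 : X → ℝ≥0∞) y := ENNReal.tsum_le_tsum h1
    _ = ∑' m : ℕ, ENNReal.ofReal (w m) *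
        ∑' y : S, (Metric.ball x (2 ^ (m + 1) * r)).indicator (1 : X → ℝ≥0∞) y := by
        rw [ENNReal.tsum_comm]
        simp_rw [ENNReal.tsum_mul_left]
    _ ≤ ∑' m : ℕ, ENNReal.ofReal (D * 16 ^ n * ((2 : ℝ) ^ (-δ)) ^ m) := by
        refine ENNReal.tsum_le_tsum fun m => ?_
        rw [← h3, ENNReal.ofReal_mul (hw m).le]
        gcongr
        refine h.tsum_indicator_le hr hS ?_ x
        have : (1 : ℝ) ≤ 2 ^ (m + 1) := one_le_pow₀ (by norm_num)
        nlinarith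
    _ = ENNReal.ofReal (netConst n D δ) := by
        have hsum := (hasSum_geometric_of_lt_one (r := (2 : ℝ) ^ (-δ)) (by positivity)
          h2lt).mul_left (D * 16 ^ n)
        rw [← ENNReal.ofReal_tsum_of_nonneg (fun m => by positivity) hsum.summable, hsum.tsum_eq]
        rfl

/-- A measurable partition subordinate to the balls of a net. -/
theorem IsNet.exists_partition [TopologicalSpace.SeparableSpace X] {S : Set X} {r : ℝ}
    (hr : 0 < r) (hS : IsNet S r) :
    ∃ Q : S → Set X, IsMeasurablePartition Q ∧ ∀ i : S, Q i ⊆ Metric.ball (i : X) r := by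
  have hc := hS.countable hr
  have : Countable S := hc.to_subtype
  obtain ⟨e, he⟩ := exists_injective_nat S
  -- Each point is assigned to the first ball that contains it, in the order given by the
  -- enumeration e.
  refine ⟨fun i => Metric.ball (i : X) r \ ⋃ j : {j : S // e j < e i}, Metric.ball (j : X) r,
    ⟨fun i => measurableSet_ball.diff (MeasurableSet.iUnion fun j => measurableSet_ball),
      ?_, ?_⟩, fun i => Set.diff_subset⟩
  · have key : ∀ i j : S, e i < e j →
        Disjoint (Metric.ball (i : X) r \ ⋃ l : {l : S // e l < e i}, Metric.ball (l : X) r)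
          (Metric.ball (j : X) r \ ⋃ l : {l : S // e l < e j}, Metric.ball (l : X) r) := by
      intro i j hij
      refine Set.disjoint_left.2 fun x hx hx2 => hx2.2 ?_
      exact Set.mem_iUnion.2 ⟨⟨i, hij⟩, hx.1⟩
    intro i j hij
    rcases lt_or_gt_of_ne (fun hh => hij (he hh)) with hlt | hlt
    · exact key i j hlt
    · exact (key j i hlt).symm
  · refine Set.eq_univ_of_forall fun x => ?_
    have hex : ∃ m, ∃ i : S, e i = m ∧ x ∈ Metric.ball (i : X) r := by
      obtain ⟨y, hy, hxy⟩ := hS.cover x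
      exact ⟨e ⟨y, hy⟩, ⟨y, hy⟩, rfl, hxy⟩
    classical
    obtain ⟨i, hi, hxi⟩ := Nat.find_spec hex
    refine Set.mem_iUnion.2 ⟨i, hxi, fun hx => ?_⟩
    obtain ⟨⟨j, hj⟩, hxj⟩ := Set.mem_iUnion.1 hx
    exact Nat.find_min hex (hi ▸ hj) ⟨j, rfl, hxj⟩

end Geometry

end SpectralMultiplier
end

noncomputable section
namespace SpectralMultiplier

/-! ### The exponent σ_p and Hölder's inequality -/

section SigmaExponent

variable {p : ℝ≥0∞}

theorem toReal_mem_Ico (hp1 : 1 ≤ p) (hp2 : p < 2) : 1 ≤ p.toReal ∧ p.toReal < 2 := by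
  have hpt : p ≠ ∞ := (hp2.trans ENNReal.ofNat_lt_top).ne
  constructor
  · simpa using (ENNReal.ofReal_le_iff_le_toReal hpt).1 (by simpa using hp1 : ENNReal.ofReal 1 ≤ p)
  · exact (ENNReal.lt_ofReal_iff_toReal_lt hpt).1 (by simpa using hp2)

theorem sigma_pos (hp1 : 1 ≤ p) (hp2 : p < 2) : 0 < sigma p := by
  obtain ⟨h1, h2⟩ := toReal_mem_Ico hp1 hp2
  unfold sigma
  rw [sub_pos]
  exact one_div_lt_one_div_of_lt (by linarith) h2

theorem sigma_le_half (hp1 : 1 ≤ p) (hp2 : p < 2) : sigma p ≤ 1 / 2 := by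
  obtain ⟨h1, h2⟩ := toReal_mem_Ico hp1 hp2
  have : 1 / p.toReal ≤ 1 := by
    rw [div_le_one (by linarith)]; exact h1
  unfold sigma
  linarith

variable {X : Type*} [MeasurableSpace X] {μ : Measure X}

/-- Hölder's inequality on a set of finite measure. -/
theorem eLpNorm_indicator_le_two (hp2 : p < 2) {s : Set X} (hs : MeasurableSet s)
    {f : X → ℂ} (hf : AEStronglyMeasurable f μ) :
    eLpNorm (s.indicator f) p μ
      ≤ eLpNorm (s.indicator f) 2 μ * μ s ^ sigma p := by
  rw [eLpNorm_indicator_eq_eLpNorm_restrict hs, eLpNorm_indicator_eq_eLpNorm_restrict hs]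
  have := eLpNorm_le_eLpNorm_mul_rpow_measure_univ hp2.le (hf.restrict (s := s))
  simpa [sigma] using this

end SigmaExponent

/-! ### Elementary inequalities for real powers -/

section Powers

/-- Convexity of the power in the form of Bernoulli's inequality at y/x - 1, where x is the larger
number. -/
theorem abs_rpow_sub_rpow_le {x y k : ℝ} (hx : 0 < x) (hy : 0 < y) (hk : 1 ≤ k) :
    |x ^ k - y ^ k| ≤ k * |x - y| * (max x y) ^ (k - 1) := by
  wlog h : y ≤ x generalizing x y
  · have := this hy hx (le_of_not_ge h)
    rwa [abs_sub_comm, abs_sub_comm x, max_comm]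
  have h1 := one_add_mul_self_le_rpow_one_add (s := y / x - 1) (p := k)
    (by have : 0 < y / x := by positivity
        linarith) hk
  have h2 : y ^ k = x ^ k * (1 + (y / x - 1)) ^ k := by
    rw [← Real.mul_rpow hx.le (by simp; positivity)]
    congr 1; field_simp; ring
  have h3 : y ^ k ≤ x ^ k := Real.rpow_le_rpow hy.le h (by linarith)
  rw [abs_of_nonneg (sub_nonneg.2 h3), abs_of_nonneg (sub_nonneg.2 h), max_eq_left h, h2]
  have h4 : x ^ k = x ^ (k - 1) * x := by
    rw [Real.rpow_sub_one hx.ne']; field_simp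
  have h5 := mul_le_mul_of_nonneg_left h1 (Real.rpow_nonneg hx.le k)
  have h6 : x ^ k * (1 + k * (y / x - 1)) = x ^ k - k * (x - y) * x ^ (k - 1) := by
    rw [h4]; field_simp; ring
  linarith

/-- The first term dominates when w ≥ L and the second when w ≤ L. The free parameter L is later
matched with the time over which the unitary group is followed. -/
theorem rpow_sub_one_le {w L k : ℝ} (hw : 0 < w) (hL : 0 < L) (hk : 1 ≤ k) :
    w ^ (k - 1) ≤ w ^ k / L + L ^ (k - 1) := by
  rcases le_total w L with h | h
  · have := Real.rpow_le_rpow hw.le h (by linarith : 0 ≤ k - 1)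
    have h2 : 0 ≤ w ^ k / L := by positivity
    linarith
  · have h1 : w ^ (k - 1) ≤ w ^ k / L := by
      rw [Real.rpow_sub_one hw.ne']
      exact div_le_div_of_nonneg_left (by positivity) hL h
    have h2 : 0 ≤ L ^ (k - 1) := by positivity
    linarith

end Powers

/-! ### Weights that are constant on the blocks of a partition -/

section StepFunction

variable {X : Type*} [MeasurableSpace X] {μ : Measure X} {ι : Type*} {Q : ι → Set X}

theorem IsMeasurablePartition.existsUnique (hQ : IsMeasurablePartition Q) (x : X) :
    ∃! i, x ∈ Q i := by
  have hx : x ∈ ⋃ i, Q i := hQ.cover ▸ Set.mem_univ x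
  obtain ⟨i, hi⟩ := Set.mem_iUnion.1 hx
  refine ⟨i, hi, fun j hj => ?_⟩
  by_contra hij
  exact Set.disjoint_left.1 (hQ.disjoint hij) hj hi

/-- The index of the block that contains a given point. -/
def IsMeasurablePartition.index (hQ : IsMeasurablePartition Q) (x : X) : ι :=
  (hQ.existsUnique x).choose

theorem IsMeasurablePartition.mem_index (hQ : IsMeasurablePartition Q) (x : X) :
    x ∈ Q (hQ.index x) := (hQ.existsUnique x).choose_spec.1

theorem IsMeasurablePartition.index_eq (hQ : IsMeasurablePartition Q) {x : X} {i : ι}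
    (h : x ∈ Q i) : hQ.index x = i := ((hQ.existsUnique x).choose_spec.2 i h).symm

theorem IsMeasurablePartition.measurable_comp_index [Countable ι] (hQ : IsMeasurablePartition Q)
    (w : ι → ℝ) : Measurable fun x => w (hQ.index x) := by
  let _ : MeasurableSpace ι := ⊤
  refine (measurable_from_top (f := w)).comp (measurable_to_countable' fun i => ?_)
  convert hQ.measurable i
  ext x
  exact ⟨fun h => (show hQ.index x = i from h) ▸ hQ.mem_index x, fun h => hQ.index_eq h⟩

theorem IsMeasurablePartition.isBddMeasurable [Countable ι] (hQ : IsMeasurablePartition Q)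
    {w : ι → ℝ} (hw : ∃ C, ∀ i, |w i| ≤ C) : IsBddMeasurable fun x => w (hQ.index x) :=
  ⟨hQ.measurable_comp_index w, hw.imp fun _ h _ => h _⟩

/-- Multiplication by the step function with value `w i` on the block `Q i`. -/
def IsMeasurablePartition.stepOp (hQ : IsMeasurablePartition Q) (μ : Measure X) (w : ι → ℝ) :
    Lp ℂ 2 μ →L[ℂ] Lp ℂ 2 μ := mulOp μ fun x => w (hQ.index x)

variable [Countable ι]

theorem IsMeasurablePartition.stepOp_cutOp (hQ : IsMeasurablePartition Q) {w : ι → ℝ}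
    (hw : ∃ C, ∀ i, |w i| ≤ C) (i : ι) (u : Lp ℂ 2 μ) :
    hQ.stepOp μ w (cutOp μ (Q i) u) = (w i : ℂ) • cutOp μ (Q i) u := by
  have h1 := hQ.isBddMeasurable hw
  have h2 : IsBddMeasurable ((Q i).indicator (1 : X → ℝ)) := .indicator_one (hQ.measurable i)
  have h3 : IsBddMeasurable fun x => w i * (Q i).indicator (1 : X → ℝ) x := by
    refine ⟨h2.measurable.const_mul _, ?_⟩
    obtain ⟨C, hC⟩ := h2.bounded
    exact ⟨|w i| * C, fun x => by rw [abs_mul]; gcongr; exact hC x⟩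
  rw [IsMeasurablePartition.stepOp, cutOp, mulOp_mulOp h1 h2 h3,
    ← mulOp_const_mul (w i) h2 h3 fun _ => rfl]
  intro x
  by_cases hx : x ∈ Q i
  · simp [hx, hQ.index_eq hx]
  · simp [hx]

theorem IsMeasurablePartition.cutOp_stepOp (hQ : IsMeasurablePartition Q) {w : ι → ℝ}
    (hw : ∃ C, ∀ i, |w i| ≤ C) (i : ι) (u : Lp ℂ 2 μ) :
    cutOp μ (Q i) (hQ.stepOp μ w u) = (w i : ℂ) • cutOp μ (Q i) u := by
  have h1 := hQ.isBddMeasurable hw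
  have h2 : IsBddMeasurable ((Q i).indicator (1 : X → ℝ)) := .indicator_one (hQ.measurable i)
  have h3 : IsBddMeasurable fun x => w i * (Q i).indicator (1 : X → ℝ) x := by
    refine ⟨h2.measurable.const_mul _, ?_⟩
    obtain ⟨C, hC⟩ := h2.bounded
    exact ⟨|w i| * C, fun x => by rw [abs_mul]; gcongr; exact hC x⟩
  rw [IsMeasurablePartition.stepOp, cutOp, mulOp_mulOp h2 h1 h3,
    ← mulOp_const_mul (w i) h2 h3 fun _ => rfl]
  intro x
  by_cases hx : x ∈ Q i
  · simp [hx, hQ.index_eq hx]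
  · simp [hx]

end StepFunction

/-! ### Off-diagonal decay of A and the commutator with a weight -/

section OffDiagonal

variable {X : Type*} [MetricSpace X] [TopologicalSpace.SeparableSpace X] [MeasurableSpace X]
  [BorelSpace X] {μ : Measure X}

/-- The hypotheses on `A` together with a partition of `X` at scale `τ`. -/
structure BlockData (A : Lp ℂ 2 μ →L[ℂ] Lp ℂ 2 μ) (p : ℝ≥0∞) (n D a τ C : ℝ) {S : Set X}
    (Q : S → Set X) : Prop where
  doubling : IsDoublingWith μ n D
  scale_pos : 0 < τ
  one_le : 1 ≤ p
  lt_two : p < 2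
  const_pos : 0 < C
  selfAdjoint : IsSelfAdjoint A
  offDiag : ∀ (x y : X) (f : X → ℂ) (hf : MemLp f 2 μ),
    eLpNorm ((Metric.ball x τ).indicator fun z => (volPow μ τ (sigma p) z : ℂ) *
        A ((hf.indicator (s := Metric.ball y τ) measurableSet_ball).toLp) z) 2 μ
      ≤ ENNReal.ofReal (C * (1 + dist x y / τ) ^ (-n - a)) * eLpNorm f p μ
  net : IsNet S τ
  partition : IsMeasurablePartition Q
  subset_ball : ∀ i : S, Q i ⊆ Metric.ball (i : X) τ

namespace BlockData

variable {A : Lp ℂ 2 μ →L[ℂ] Lp ℂ 2 μ} {p : ℝ≥0∞} {n D a τ C : ℝ} {S : Set X} {Q : S → Set X}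
  (h : BlockData A p n D a τ C Q)
include h

theorem countable : Countable S := (h.net.countable h.scale_pos).to_subtype

omit [TopologicalSpace.SeparableSpace X] in
theorem sigma_pos : 0 < sigma p := SpectralMultiplier.sigma_pos h.one_le h.lt_two

omit [TopologicalSpace.SeparableSpace X] in
theorem sigma_le : sigma p ≤ 1 / 2 := sigma_le_half h.one_le h.lt_two

omit [TopologicalSpace.SeparableSpace X] in
theorem vol_le_of_mem {i : S} {z : X} (hz : z ∈ Q i) :
    ballVol μ (i : X) τ ≤ D * 2 ^ n * ballVol μ z τ := by
  have hd := Metric.mem_ball.1 (h.subset_ball i hz)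
  rw [dist_comm] at hd
  exact h.doubling.vol_le h.scale_pos one_le_two (by linarith)

-- On Q_i the volume V_τ is bounded below by a fixed multiple of its value at the centre i, so the
-- function V_τ^σ in the off-diagonal estimate can be traded for a number and moved to the
-- right-hand side.
omit [TopologicalSpace.SeparableSpace X] in
theorem enorm_block_le (i j : S) (f : Lp ℂ 2 μ) :
    ‖cutOp μ (Q i) (A (cutOp μ (Q j) f))‖ₑ ≤
      ENNReal.ofReal ((D * 2 ^ n) ^ sigma p * C * ballVol μ (i : X) τ ^ (-sigma p)
        * (1 + dist (i : X) j / τ) ^ (-n - a)) * eLpNorm ((Q j).indicator f) p μ := by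
  have hσ := h.sigma_pos
  have hD := h.doubling.one_le
  have hVi := h.doubling.vol_pos (i : X) h.scale_pos
  have hmem : MemLp ((Q j).indicator f) 2 μ := (Lp.memLp f).indicator (h.partition.measurable j)
  have h1 := h.offDiag i j _ hmem
  have h2 : (hmem.indicator (s := Metric.ball (j : X) τ) measurableSet_ball).toLp
      = cutOp μ (Q j) f := by
    refine Lp.ext ?_
    filter_upwards [(hmem.indicator (s := Metric.ball (j : X) τ) measurableSet_ball).coeFn_toLp,
      cutOp_ae (h.partition.measurable j) f] with z hz1 hz2
    rw [hz1, hz2, Set.indicator_indicator, Set.inter_eq_right.2 (h.subset_ball j)]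
  rw [h2] at h1
  rw [Lp.enorm_def]
  have h3 : ∀ᵐ z ∂μ, ‖cutOp μ (Q i) (A (cutOp μ (Q j) f)) z‖ ≤
      ((D * 2 ^ n) ^ sigma p * ballVol μ (i : X) τ ^ (-sigma p)) *
      ‖(Metric.ball (i : X) τ).indicator (fun z => (volPow μ τ (sigma p) z : ℂ) *
        A (cutOp μ (Q j) f) z) z‖ := by
    filter_upwards [cutOp_ae (h.partition.measurable i) (A (cutOp μ (Q j) f))] with z hz
    rw [hz]
    by_cases hzi : z ∈ Q i
    · rw [Set.indicator_of_mem hzi, Set.indicator_of_mem (h.subset_ball i hzi), norm_mul,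
        Complex.norm_real, ← mul_assoc]
      refine le_mul_of_one_le_left (norm_nonneg _) ?_
      have hVz := h.doubling.vol_pos z h.scale_pos
      have h4 := Real.rpow_le_rpow hVi.le (h.vol_le_of_mem hzi) hσ.le
      rw [Real.mul_rpow (by positivity) hVz.le] at h4
      have h5 : volPow μ τ (sigma p) z = ballVol μ z τ ^ sigma p := rfl
      rw [h5, Real.norm_of_nonneg (by positivity), Real.rpow_neg hVi.le]
      rw [mul_right_comm, ← div_eq_mul_inv, one_le_div (by positivity)]
      exact h4
    · rw [Set.indicator_of_notMem hzi, norm_zero]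
      positivity
  refine (eLpNorm_le_mul_eLpNorm_of_ae_le_mul h3 2).trans ?_
  refine (mul_le_mul_right h1 _).trans_eq ?_
  rw [← mul_assoc, ← ENNReal.ofReal_mul (by positivity)]
  congr 2
  ring

omit [TopologicalSpace.SeparableSpace X] in
theorem eLpNorm_block_le (j : S) (f : Lp ℂ 2 μ) :
    eLpNorm ((Q j).indicator f) p μ
      ≤ ENNReal.ofReal (ballVol μ (j : X) τ ^ sigma p) * ‖cutOp μ (Q j) f‖ₑ := by
  have hfin := h.doubling.ball_lt_top (j : X) τ
  have hle : μ (Q j) ≤ μ (Metric.ball (j : X) τ) := measure_mono (h.subset_ball j)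
  refine (eLpNorm_indicator_le_two h.lt_two (h.partition.measurable j)
    (Lp.aestronglyMeasurable f)).trans ?_
  rw [mul_comm, Lp.enorm_def]
  have e : eLpNorm (cutOp μ (Q j) f) 2 μ = eLpNorm ((Q j).indicator f) 2 μ :=
    eLpNorm_congr_ae (cutOp_ae (h.partition.measurable j) f)
  rw [e]
  gcongr
  rw [← ENNReal.ofReal_rpow_of_pos (h.doubling.vol_pos _ h.scale_pos), ballVol,
    ENNReal.ofReal_toReal hfin.ne]
  exact ENNReal.rpow_le_rpow hle h.sigma_pos.le

theorem norm_block_le_ratio (i j : S) :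
    ‖cutOp μ (Q i) ∘L A ∘L cutOp μ (Q j)‖ ≤ (D * 2 ^ n) ^ sigma p * C *
      (ballVol μ (j : X) τ / ballVol μ (i : X) τ) ^ sigma p *
        (1 + dist (i : X) j / τ) ^ (-n - a) := by
  have hD := h.doubling.one_le
  have hC := h.const_pos
  have hτ := h.scale_pos
  have hVi := h.doubling.vol_pos (i : X) h.scale_pos
  have hVj := h.doubling.vol_pos (j : X) h.scale_pos
  refine ContinuousLinearMap.opNorm_le_bound _ (by positivity) fun f => ?_
  have h1 := (h.enorm_block_le i j f).trans (mul_le_mul_right (h.eLpNorm_block_le j f) _)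
  have h2 : ‖cutOp μ (Q j) f‖ₑ ≤ ‖f‖ₑ := by
    have := h.countable
    have h3 := ENNReal.le_tsum (f := fun i => ‖cutOp μ (Q i) f‖ₑ ^ 2) j
    rw [h.partition.tsum_enorm_sq] at h3
    exact (ENNReal.pow_le_pow_left_iff two_ne_zero).1 h3
  have h4 := h1.trans (mul_le_mul_right (mul_le_mul_right h2 _) _)
  rw [← ofReal_norm, ← ofReal_norm, ← ENNReal.ofReal_mul (by positivity),
    ← ENNReal.ofReal_mul (by positivity), ENNReal.ofReal_le_ofReal_iff (by positivity)] at h4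
  refine h4.trans_eq ?_
  rw [Real.div_rpow hVj.le hVi.le, Real.rpow_neg hVi.le]
  field_simp

/-- The volume ratio is harmless when V(j, τ) ≤ V(i, τ). In the other case one passes to the
adjoint: A is self-adjoint, so the blocks (i, j) and (j, i) have the same norm. -/
theorem norm_block_le (i j : S) :
    ‖cutOp μ (Q i) ∘L A ∘L cutOp μ (Q j)‖ ≤
      (D * 2 ^ n) ^ sigma p * C * (1 + dist (i : X) j / τ) ^ (-n - a) := by
  have hD := h.doubling.one_le
  have hC := h.const_pos
  have hτ := h.scale_pos
  have key : ∀ i j : S, ballVol μ (j : X) τ ≤ ballVol μ (i : X) τ →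
      ‖cutOp μ (Q i) ∘L A ∘L cutOp μ (Q j)‖ ≤
        (D * 2 ^ n) ^ sigma p * C * (1 + dist (i : X) j / τ) ^ (-n - a) := by
    intro i j hij
    refine (h.norm_block_le_ratio i j).trans ?_
    have hVi := h.doubling.vol_pos (i : X) h.scale_pos
    have hVj := h.doubling.vol_pos (j : X) h.scale_pos
    have : (ballVol μ (j : X) τ / ballVol μ (i : X) τ) ^ sigma p ≤ 1 :=
      Real.rpow_le_one (by positivity) ((div_le_one hVi).2 hij) h.sigma_pos.le
    have hc0 : 0 ≤ (D * 2 ^ n) ^ sigma p * C := by positivity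
    exact mul_le_mul_of_nonneg_right (mul_le_of_le_one_right hc0 this) (by positivity)
  rcases le_total (ballVol μ (j : X) τ) (ballVol μ (i : X) τ) with hij | hij
  · exact key i j hij
  · have h1 := key j i hij
    have h2 : (cutOp μ (Q j) ∘L A ∘L cutOp μ (Q i)) =
        ContinuousLinearMap.adjoint (cutOp μ (Q i) ∘L A ∘L cutOp μ (Q j)) := by
      rw [ContinuousLinearMap.adjoint_comp, ContinuousLinearMap.adjoint_comp,
        (isSelfAdjoint_cutOp (h.partition.measurable i)).adjoint_eq,
        (isSelfAdjoint_cutOp (h.partition.measurable j)).adjoint_eq, h.selfAdjoint.adjoint_eq]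
      rfl
    rw [h2, LinearIsometryEquiv.norm_map, dist_comm] at h1
    exact h1

/-- The constant in the commutator estimate. -/
def commConst (p : ℝ≥0∞) (n D a C k : ℝ) : ℝ :=
  k * ((D * 2 ^ n) ^ sigma p * C) * netConst n D (a - k)

omit [TopologicalSpace.SeparableSpace X] in
theorem commConst_pos {k : ℝ} (hk : 1 ≤ k) (hka : k < a) : 0 < commConst p n D a C k := by
  have hD := h.doubling.one_le
  have hC := h.const_pos
  have := h.doubling.netConst_pos (δ := a - k) (by linarith)
  unfold commConst
  positivity

/-- The commutator of `A` with a weight that is Lipschitz at scale `τ`. -/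
theorem norm_commutator_le {k : ℝ} (hk : 1 ≤ k) (hka : k < a) {w : S → ℝ} (hw1 : ∀ i, 1 ≤ w i)
    (hwb : ∃ N, ∀ i, w i ≤ N) (hwl : ∀ i j : S, |w i - w j| ≤ dist (i : X) j / τ)
    {L : ℝ} (hL : 1 ≤ L) (u : Lp ℂ 2 μ) :
    ‖h.partition.stepOp μ (fun i => w i ^ k) (A u) -
        A (h.partition.stepOp μ (fun i => w i ^ k) u)‖
      ≤ commConst p n D a C k / L * ‖h.partition.stepOp μ (fun i => w i ^ k) u‖
        + commConst p n D a C k * L ^ (k - 1) * ‖u‖ := by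
  have hcount := h.countable
  have hD := h.doubling.one_le
  have hC := h.const_pos
  have hτ := h.scale_pos
  have hL0 : 0 < L := by linarith
  have hw0 : ∀ i, 0 < w i := fun i => by linarith [hw1 i]
  have hwkb : ∃ N, ∀ i, |w i ^ k| ≤ N := by
    obtain ⟨N, hN⟩ := hwb
    refine ⟨N ^ k, fun i => ?_⟩
    have := hw0 i
    rw [abs_of_pos (by positivity)]
    exact Real.rpow_le_rpow (hw0 i).le (hN i) (by linarith)
  set M := h.partition.stepOp μ (fun i => w i ^ k) with hM
  -- The commutator is naturally bounded by w^{k-1} u. The vector v is blockwise larger by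
  -- `rpow_sub_one_le`, and it is a combination of the two vectors allowed in the conclusion.
  set v : Lp ℂ 2 μ := ((L⁻¹ : ℝ) : ℂ) • M u + ((L ^ (k - 1) : ℝ) : ℂ) • u with hv
  have hPv : ∀ j, cutOp μ (Q j) v = ((w j ^ k / L + L ^ (k - 1) : ℝ) : ℂ) • cutOp μ (Q j) u := by
    intro j
    rw [hv, map_add, map_smul, map_smul, hM, h.partition.cutOp_stepOp hwkb, smul_smul, ← add_smul]
    congr 1
    push_cast
    ring
  set K := k * ((D * 2 ^ n) ^ sigma p * C) with hK
  have hK0 : 0 ≤ K := by positivity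
  set b : S → S → ℝ≥0∞ := fun i j =>
    ENNReal.ofReal K * ENNReal.ofReal ((1 + dist (i : X) j / τ) ^ (-(n + (a - k)))) with hb
  have hblock : ∀ i j, ‖cutOp μ (Q i) ((M ∘L A - A ∘L M) (cutOp μ (Q j) u))‖ₑ
      ≤ b i j * ‖cutOp μ (Q j) v‖ₑ := by
    intro i j
    have hd0 : 0 ≤ dist (i : X) j / τ := by positivity
    have e1 : cutOp μ (Q i) ((M ∘L A - A ∘L M) (cutOp μ (Q j) u))
        = ((w i ^ k - w j ^ k : ℝ) : ℂ) •
          (cutOp μ (Q i) ∘L A ∘L cutOp μ (Q j)) (cutOp μ (Q j) u) := by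
      simp only [sub_apply, ContinuousLinearMap.comp_apply, map_sub]
      rw [hM, h.partition.cutOp_stepOp hwkb, h.partition.stepOp_cutOp hwkb, map_smul, map_smul,
        ← sub_smul, cutOp_cutOp_self (h.partition.measurable j)]
      push_cast
      rfl
    rw [e1, hPv, ← ofReal_norm, ← ofReal_norm]
    simp only [hb]
    rw [← ENNReal.ofReal_mul hK0,
      ← ENNReal.ofReal_mul (by positivity)]
    refine ENNReal.ofReal_le_ofReal ?_
    rw [norm_smul, norm_smul, Complex.norm_real, Complex.norm_real, Real.norm_eq_abs]
    have h1 := (cutOp μ (Q i) ∘L A ∘L cutOp μ (Q j)).le_of_opNorm_le (h.norm_block_le i j)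
      (cutOp μ (Q j) u)
    -- One factor 1 + d/τ comes from the Lipschitz bound and k - 1 more from max(w_i, w_j) ≤ (1 +
    -- d/τ) w_j, which uses w_j ≥ 1. Decay of order n + a thus drops to n + (a - k), still summable
    -- over the net.
    have h2 : |w i ^ k - w j ^ k| ≤ k * (1 + dist (i : X) j / τ) ^ k * w j ^ (k - 1) := by
      refine (abs_rpow_sub_rpow_le (hw0 i) (hw0 j) hk).trans ?_
      have hmax : max (w i) (w j) ≤ (1 + dist (i : X) j / τ) * w j := by
        have := (abs_le.1 (hwl i j)).2
        refine max_le ?_ ?_ <;> nlinarith [hw1 j]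
      have h3 : (max (w i) (w j)) ^ (k - 1)
          ≤ (1 + dist (i : X) j / τ) ^ (k - 1) * w j ^ (k - 1) := by
        rw [← Real.mul_rpow (by positivity) (hw0 j).le]
        exact Real.rpow_le_rpow ((hw0 i).le.trans (le_max_left _ _)) hmax (by linarith)
      have h4 : (1 + dist (i : X) j / τ) ^ k
          = (1 + dist (i : X) j / τ) * (1 + dist (i : X) j / τ) ^ (k - 1) := by
        rw [Real.rpow_sub_one (by positivity)]; field_simp
      have h5 : |w i - w j| ≤ 1 + dist (i : X) j / τ := (hwl i j).trans (by linarith)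
      have hwj := hw0 j
      calc k * |w i - w j| * (max (w i) (w j)) ^ (k - 1)
          ≤ k * (1 + dist (i : X) j / τ) *
            ((1 + dist (i : X) j / τ) ^ (k - 1) * w j ^ (k - 1)) := by gcongr
        _ = _ := by rw [h4]; ring
    have h3 := rpow_sub_one_le (hw0 j) hL0 hk
    have hwj := hw0 j
    have h4 : ‖w j ^ k / L + L ^ (k - 1)‖ = w j ^ k / L + L ^ (k - 1) :=
      Real.norm_of_nonneg (by positivity)
    rw [h4]
    have h5 : (1 + dist (i : X) j / τ) ^ (-(n + (a - k)))
        = (1 + dist (i : X) j / τ) ^ k * (1 + dist (i : X) j / τ) ^ (-n - a) := by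
      rw [← Real.rpow_add (by positivity)]; congr 1; ring
    calc |w i ^ k - w j ^ k| * ‖(cutOp μ (Q i) ∘L A ∘L cutOp μ (Q j)) (cutOp μ (Q j) u)‖
        ≤ (k * (1 + dist (i : X) j / τ) ^ k * (w j ^ k / L + L ^ (k - 1))) *
          ((D * 2 ^ n) ^ sigma p * C * (1 + dist (i : X) j / τ) ^ (-n - a) *
            ‖cutOp μ (Q j) u‖) := by
          refine mul_le_mul (h2.trans ?_) h1 (norm_nonneg _) (by positivity)
          gcongr
      _ = _ := by rw [h5, hK]; ring
  have hδ : 0 < a - k := by linarith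
  have hrow : ∀ i, ∑' j, b i j ≤ ENNReal.ofReal (commConst p n D a C k) := fun i => by
    simp only [hb]
    rw [ENNReal.tsum_mul_left, commConst, ENNReal.ofReal_mul hK0]
    gcongr
    exact h.doubling.tsum_decay_le hδ hτ h.net (i : X)
  have hcol : ∀ j, ∑' i, b i j ≤ ENNReal.ofReal (commConst p n D a C k) := fun j => by
    simp only [hb]
    simp_rw [dist_comm _ (j : X)]
    rw [ENNReal.tsum_mul_left, commConst, ENNReal.ofReal_mul hK0]
    gcongr
    exact h.doubling.tsum_decay_le hδ hτ h.net (j : X)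
  have hfin := (h.partition.enorm_sq_apply_le (M ∘L A - A ∘L M) u hblock).trans
    (tsum_sq_tsum_le_of_schur (fun j => ‖cutOp μ (Q j) v‖ₑ) hrow hcol)
  rw [h.partition.tsum_enorm_sq, ← mul_pow, ENNReal.pow_le_pow_left_iff two_ne_zero,
    ← ofReal_norm, ← ofReal_norm, ← ENNReal.ofReal_mul (h.commConst_pos hk hka).le,
    ENNReal.ofReal_le_ofReal_iff (mul_nonneg (h.commConst_pos hk hka).le (norm_nonneg _))] at hfin
  have hc := h.commConst_pos hk hka
  calc ‖M (A u) - A (M u)‖ ≤ commConst p n D a C k * ‖v‖ := hfin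
    _ ≤ commConst p n D a C k * (L⁻¹ * ‖M u‖ + L ^ (k - 1) * ‖u‖) := by
        gcongr
        refine (norm_add_le _ _).trans_eq ?_
        rw [norm_smul, norm_smul, Complex.norm_real, Complex.norm_real,
          Real.norm_of_nonneg (by positivity), Real.norm_of_nonneg (by positivity)]
    _ = _ := by ring

end BlockData

end OffDiagonal

end SpectralMultiplier
end

noncomputable section
namespace SpectralMultiplier

/-! ### Sums of L^p norms over a partition -/

section Sums

/-- In each term one factor is kept and the remaining power r - 1 is bounded by that of the whole
sum. -/
theorem ENNReal_tsum_rpow_le {ι : Type*} (x : ι → ℝ≥0∞) {r : ℝ} (hr : 1 ≤ r) :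
    ∑' j, x j ^ r ≤ (∑' j, x j) ^ r := by
  have h1 : ∀ y : ℝ≥0∞, y ^ r = y * y ^ (r - 1) := fun y => by
    conv_rhs => rw [← ENNReal.rpow_one y, ← ENNReal.rpow_mul, one_mul,
      ← ENNReal.rpow_add_of_nonneg _ _ zero_le_one (by linarith)]
    congr 1; ring
  rw [h1, ← ENNReal.tsum_mul_right]
  refine ENNReal.tsum_le_tsum fun j => ?_
  rw [h1]
  gcongr
  exact ENNReal.le_tsum j

theorem ENNReal_add_sq_le (x y : ℝ≥0∞) : (x + y) ^ 2 ≤ 2 * x ^ 2 + 2 * y ^ 2 := by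
  have := ENNReal.rpow_add_le_mul_rpow_add_rpow x y (p := 2) (by norm_num)
  have e : (2 : ℝ≥0∞) ^ ((2 : ℝ) - 1) = 2 := by norm_num
  rw [e, ENNReal.rpow_two, ENNReal.rpow_two, ENNReal.rpow_two, mul_add] at this
  exact this

variable {X : Type*} [MeasurableSpace X] {μ : Measure X}

theorem IsMeasurablePartition.tsum_eLpNorm_rpow {ι : Type*} [Countable ι] {Q : ι → Set X}
    (hQ : IsMeasurablePartition Q) {p : ℝ≥0∞} (hp0 : p ≠ 0) (hpt : p ≠ ∞) (f : X → ℂ) :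
    ∑' j, eLpNorm ((Q j).indicator f) p μ ^ p.toReal = eLpNorm f p μ ^ p.toReal := by
  have hpos := ENNReal.toReal_pos hp0 hpt
  have e : ∀ g : X → ℂ, ∀ ν : Measure X, eLpNorm g p ν ^ p.toReal
      = ∫⁻ x, ‖g x‖ₑ ^ p.toReal ∂ν := fun g ν => by
    rw [eLpNorm_eq_lintegral_rpow_enorm_toReal hp0 hpt, ← ENNReal.rpow_mul,
      one_div_mul_cancel hpos.ne', ENNReal.rpow_one]
  simp_rw [eLpNorm_indicator_eq_eLpNorm_restrict (hQ.measurable _), e]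
  rw [← lintegral_iUnion hQ.measurable hQ.disjoint, hQ.cover, setLIntegral_univ]

theorem IsMeasurablePartition.tsum_eLpNorm_sq_le {ι : Type*} [Countable ι] {Q : ι → Set X}
    (hQ : IsMeasurablePartition Q) {p : ℝ≥0∞} (hp1 : 1 ≤ p) (hp2 : p < 2) (f : X → ℂ) :
    ∑' j, eLpNorm ((Q j).indicator f) p μ ^ 2 ≤ eLpNorm f p μ ^ 2 := by
  obtain ⟨h1, h2⟩ := toReal_mem_Ico hp1 hp2
  have hpt : p ≠ ∞ := (hp2.trans ENNReal.ofNat_lt_top).ne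
  have hp0 : p ≠ 0 := (zero_lt_one.trans_le hp1).ne'
  have e : ∀ y : ℝ≥0∞, y ^ 2 = (y ^ p.toReal) ^ (2 / p.toReal) := fun y => by
    rw [← ENNReal.rpow_mul, mul_div_cancel₀ _ (by linarith), ENNReal.rpow_two]
  rw [e (eLpNorm f p μ), ← hQ.tsum_eLpNorm_rpow hp0 hpt]
  simp_rw [e (eLpNorm (Set.indicator _ _) p μ)]
  exact ENNReal_tsum_rpow_le _ ((one_le_div (by linarith)).2 h2.le)

end Sums

/-! ### The weighted L² norm of A f for f supported in a ball -/

section InitialData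

variable {X : Type*} [MetricSpace X] [TopologicalSpace.SeparableSpace X] [MeasurableSpace X]
  [BorelSpace X] {μ : Measure X}

namespace BlockData

variable {A : Lp ℂ 2 μ →L[ℂ] Lp ℂ 2 μ} {p : ℝ≥0∞} {n D a τ C : ℝ} {S : Set X} {Q : S → Set X}
  (h : BlockData A p n D a τ C Q)

/-- The constant in the weighted estimate of `A f`. -/
def dataConst (p : ℝ≥0∞) (n D a C k : ℝ) : ℝ :=
  (D * 2 ^ n) ^ sigma p * C * D ^ sigma p *
    (2 * (6 ^ (n * sigma p) * netConst n D (a - k) +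
      D * 16 ^ n * 4 ^ (n * sigma p) * netConst n D (a - k) + 1))

include h

omit [TopologicalSpace.SeparableSpace X] in
theorem dataConst_pos {k : ℝ} (hka : k < a) : 0 < dataConst p n D a C k := by
  have hD := h.doubling.one_le
  have hC := h.const_pos
  have := h.doubling.netConst_pos (δ := a - k) (by linarith)
  unfold dataConst
  positivity

omit [TopologicalSpace.SeparableSpace X] in
/-- The kernel bound behind the weighted estimate of `A f`, for `f` supported near `z`. -/
theorem kernel_le {k ρ : ℝ} (hk : 1 ≤ k) (hρ : 1 ≤ ρ) {z : X}
    {i j : S} {w : ℝ} (hw1 : 1 ≤ w) (hw : w ≤ max 1 (1 + dist (i : X) z / τ - 2 * ρ))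
    (hj : dist (j : X) z / τ < 2 * ρ) :
    w ^ k * ((D * 2 ^ n) ^ sigma p * C * ballVol μ (i : X) τ ^ (-sigma p)
        * (1 + dist (i : X) j / τ) ^ (-n - a)) ≤
      ((D * 2 ^ n) ^ sigma p * C * D ^ sigma p * ballVol μ z (ρ * τ) ^ (-sigma p)) *
      (6 ^ (n * sigma p) * ρ ^ (n * sigma p) * (1 + dist (i : X) j / τ) ^ (-(n + (a - k))) +
        if 3 * ρ < dist (i : X) j / τ then
          2 ^ (n * sigma p) * (1 + dist (i : X) j / τ) ^ (-(n + (a - k) - n * sigma p)) else 0) := by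
  have hn := h.doubling.exponent_pos
  have hD := h.doubling.one_le
  have hC := h.const_pos
  have hτ := h.scale_pos
  have hσ := h.sigma_pos
  set d := dist (i : X) j / τ with hd
  have hd0 : 0 ≤ d := by positivity
  have htri : dist (i : X) z / τ < d + 2 * ρ := by
    have h1 : dist (i : X) z / τ ≤ d + dist (j : X) z / τ := by
      rw [hd, ← add_div]
      gcongr
      exact dist_triangle _ _ _
    linarith
  have hiz0 : 0 ≤ dist (i : X) z / τ := by positivity
  have hVi := h.doubling.vol_pos (i : X) h.scale_pos
  have hVz := h.doubling.vol_pos z (r := ρ * τ) (by positivity)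
  -- The shift by 2ρ in the weight is made for this: every j that matters is within 2ρτ of z, so the
  -- weight at i is at most 1 + d, with no power of ρ.
  have hwd : w ^ k ≤ (1 + d) ^ k := by
    refine Real.rpow_le_rpow (by linarith) (hw.trans (max_le ?_ ?_)) (by linarith) <;> linarith
  have hV : ballVol μ (i : X) τ ^ (-sigma p) ≤
      D ^ sigma p * (ρ + dist (i : X) z / τ) ^ (n * sigma p) * ballVol μ z (ρ * τ) ^ (-sigma p) := by
    have h1 : ballVol μ z (ρ * τ) ≤ D * (ρ + dist (i : X) z / τ) ^ n * ballVol μ (i : X) τ := by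
      refine h.doubling.vol_le hτ (by linarith) ?_
      rw [dist_comm z, add_mul, div_mul_cancel₀ _ hτ.ne']
      linarith
    have h2 := Real.rpow_le_rpow hVz.le h1 hσ.le
    rw [Real.mul_rpow (by positivity) hVi.le, Real.mul_rpow (by positivity) (by positivity),
      ← Real.rpow_mul (by positivity)] at h2
    rw [Real.rpow_neg hVi.le, Real.rpow_neg hVz.le, ← div_eq_mul_inv, inv_eq_one_div,
      div_le_div_iff₀ (by positivity) (by positivity), one_mul]
    exact h2
  have hexp : (1 + d) ^ k * (1 + d) ^ (-n - a) = (1 + d) ^ (-(n + (a - k))) := by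
    rw [← Real.rpow_add (by positivity)]; congr 1; ring
  have hfac : (ρ + dist (i : X) z / τ) ^ (n * sigma p) * (1 + d) ^ (-(n + (a - k))) ≤
      6 ^ (n * sigma p) * ρ ^ (n * sigma p) * (1 + d) ^ (-(n + (a - k))) +
        if 3 * ρ < d then
          2 ^ (n * sigma p) * (1 + d) ^ (-(n + (a - k) - n * sigma p)) else 0 := by
    -- Since dist(i, z)/τ < d + 2ρ, the base ρ + dist(i, z)/τ is below 6ρ when d ≤ 3ρ and below 2(1
    -- + d) when d > 3ρ.
    split_ifs with hfar
    · have h1 : (ρ + dist (i : X) z / τ) ^ (n * sigma p)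
          ≤ 2 ^ (n * sigma p) * (1 + d) ^ (n * sigma p) := by
        rw [← Real.mul_rpow (by norm_num) (by positivity)]
        exact Real.rpow_le_rpow (by positivity) (by linarith) (by positivity)
      have h2 : (1 + d) ^ (n * sigma p) * (1 + d) ^ (-(n + (a - k)))
          = (1 + d) ^ (-(n + (a - k) - n * sigma p)) := by
        rw [← Real.rpow_add (by positivity)]; congr 1; ring
      have h3 : 0 ≤ 6 ^ (n * sigma p) * ρ ^ (n * sigma p) * (1 + d) ^ (-(n + (a - k))) := by
        positivity
      calc _ ≤ 2 ^ (n * sigma p) * (1 + d) ^ (n * sigma p) * (1 + d) ^ (-(n + (a - k))) := by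
            gcongr
        _ = 2 ^ (n * sigma p) * (1 + d) ^ (-(n + (a - k) - n * sigma p)) := by
            rw [mul_assoc, h2]
        _ ≤ _ := by linarith
    · rw [add_zero, ← Real.mul_rpow (by norm_num) (by positivity)]
      gcongr
      linarith
  calc w ^ k * ((D * 2 ^ n) ^ sigma p * C * ballVol μ (i : X) τ ^ (-sigma p)
        * (1 + d) ^ (-n - a))
      ≤ (1 + d) ^ k * ((D * 2 ^ n) ^ sigma p * C *
        (D ^ sigma p * (ρ + dist (i : X) z / τ) ^ (n * sigma p) *
          ballVol μ z (ρ * τ) ^ (-sigma p)) * (1 + d) ^ (-n - a)) := by gcongr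
    _ = ((D * 2 ^ n) ^ sigma p * C * D ^ sigma p * ballVol μ z (ρ * τ) ^ (-sigma p)) *
        ((ρ + dist (i : X) z / τ) ^ (n * sigma p) * ((1 + d) ^ k * (1 + d) ^ (-n - a))) := by ring
    _ ≤ _ := by
        rw [hexp]
        gcongr

-- Squaring produces the exponent -(n - 2nσ) - (a - k) besides the summable one, and d ≥ ρ turns it
-- into ρ^{-(n-2nσ)}, as σ ≤ 1/2. This factor offsets the ρ^n blocks counted by Cauchy–Schwarz and
-- leaves ρ^{2nσ}, the square of the desired power.
omit [TopologicalSpace.SeparableSpace X] in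
theorem far_kernel_sq_le {k ρ d : ℝ} (hka : k < a) (hρ : 1 ≤ ρ) (hd : ρ ≤ d) :
    (2 ^ (n * sigma p) * (1 + d) ^ (-(n + (a - k) - n * sigma p))) ^ 2 ≤
      4 ^ (n * sigma p) * ρ ^ (-(n - 2 * (n * sigma p))) * (1 + d) ^ (-(n + (a - k))) := by
  have hn := h.doubling.exponent_pos
  have hσ := h.sigma_le
  have h2 : n * sigma p ≤ n * (1 / 2) := by gcongr
  have hd1 : 0 < 1 + d := by linarith
  have e1 : (1 + d) ^ (-(n + (a - k) - n * sigma p)) * (1 + d) ^ (-(n + (a - k) - n * sigma p))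
      = (1 + d) ^ (-(n - 2 * (n * sigma p)) + -(a - k)) * (1 + d) ^ (-(n + (a - k))) := by
    rw [← Real.rpow_add hd1, ← Real.rpow_add hd1]; congr 1; ring
  have e2 : (1 + d) ^ (-(n - 2 * (n * sigma p)) + -(a - k)) ≤ ρ ^ (-(n - 2 * (n * sigma p))) := by
    rw [Real.rpow_add hd1]
    have h3 : (1 + d) ^ (-(a - k)) ≤ 1 :=
      Real.rpow_le_one_of_one_le_of_nonpos (by linarith) (by linarith)
    have h4 : (1 + d) ^ (-(n - 2 * (n * sigma p))) ≤ ρ ^ (-(n - 2 * (n * sigma p))) :=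
      Real.rpow_le_rpow_of_nonpos (by linarith) (by linarith) (by linarith)
    calc _ ≤ (1 + d) ^ (-(n - 2 * (n * sigma p))) * 1 := by gcongr
      _ ≤ _ := by rw [mul_one]; exact h4
  have e3 : (2 : ℝ) ^ (n * sigma p) * 2 ^ (n * sigma p) = 4 ^ (n * sigma p) := by
    rw [← Real.mul_rpow (by norm_num) (by norm_num)]; norm_num
  calc _ = (2 : ℝ) ^ (n * sigma p) * 2 ^ (n * sigma p) *
        ((1 + d) ^ (-(n + (a - k) - n * sigma p)) * (1 + d) ^ (-(n + (a - k) - n * sigma p))) := by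
        ring
    _ = 4 ^ (n * sigma p) * ((1 + d) ^ (-(n - 2 * (n * sigma p)) + -(a - k)) *
        (1 + d) ^ (-(n + (a - k)))) := by rw [e3, e1]
    _ ≤ 4 ^ (n * sigma p) * (ρ ^ (-(n - 2 * (n * sigma p))) * (1 + d) ^ (-(n + (a - k)))) := by
        gcongr
    _ = _ := by ring

/-- The near part of the kernel is summed by Schur's test. The far part decays too slowly for that
and is handled by Cauchy–Schwarz over the at most constant times ρ^n blocks near z. Both are closed
by the bound of the ℓ² sum of the norms ‖1_{Q_j} f‖_p by ‖f‖_p, valid for p < 2. -/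
theorem enorm_weight_apply_le {k ρ : ℝ} (hk : 1 ≤ k) (hka : k < a) (hρ : 1 ≤ ρ) {z : X}
    {w : S → ℝ} (hw1 : ∀ i, 1 ≤ w i) (hwb : ∃ N, ∀ i, w i ≤ N)
    (hw : ∀ i : S, w i ≤ max 1 (1 + dist (i : X) z / τ - 2 * ρ)) (f : Lp ℂ 2 μ)
    (hf : ∀ᵐ x ∂μ, x ∉ Metric.ball z (ρ * τ) → f x = 0) :
    ‖h.partition.stepOp μ (fun i => w i ^ k) (A f)‖ₑ ≤
      ENNReal.ofReal (dataConst p n D a C k * (ρ ^ (n * sigma p) *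
        ballVol μ z (ρ * τ) ^ (-sigma p))) * eLpNorm f p μ := by
  have hcount := h.countable
  have hn := h.doubling.exponent_pos
  have hD := h.doubling.one_le
  have hC := h.const_pos
  have hτ := h.scale_pos
  have hδ : 0 < a - k := by linarith
  have hN := h.doubling.netConst_pos hδ
  have hVz := h.doubling.vol_pos z (r := ρ * τ) (by positivity)
  have hρ0 : 0 < ρ := by linarith
  have hwkb : ∃ N, ∀ i, |w i ^ k| ≤ N := by
    obtain ⟨N, hN⟩ := hwb
    refine ⟨N ^ k, fun i => ?_⟩
    have := hw1 i
    rw [abs_of_pos (Real.rpow_pos_of_pos (by linarith) _)]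
    exact Real.rpow_le_rpow (by linarith) (hN i) (by linarith)
  set M := h.partition.stepOp μ (fun i => w i ^ k) with hM
  set c : S → ℝ≥0∞ := fun j => eLpNorm ((Q j).indicator f) p μ with hc
  set P := (D * 2 ^ n) ^ sigma p * C * D ^ sigma p * ballVol μ z (ρ * τ) ^ (-sigma p) with hP
  have hP0 : 0 < P := by positivity
  set e : S → S → ℝ := fun i j => (1 + dist (i : X) j / τ) ^ (-(n + (a - k))) with he
  have he0 : ∀ i j, 0 ≤ e i j := fun i j => by positivity
  set E := (6 : ℝ) ^ (n * sigma p) * ρ ^ (n * sigma p) with hE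
  -- Blocks have radius τ ≤ ρτ, so f vanishes on every block whose centre is not in the doubled
  -- ball. Inserting J therefore loses nothing and makes the number of terms finite.
  set J : S → ℝ≥0∞ := fun j => (Metric.ball z (2 * ρ * τ)).indicator 1 (j : X) with hJ
  set g : S → S → ℝ := fun i j => if 3 * ρ < dist (i : X) j / τ then
    2 ^ (n * sigma p) * (1 + dist (i : X) j / τ) ^ (-(n + (a - k) - n * sigma p)) else 0 with hg
  have hg0 : ∀ i j, 0 ≤ g i j := fun i j => by
    simp only [hg]; split_ifs <;> positivity
  have hzero : ∀ j : S, ¬ dist (j : X) z / τ < 2 * ρ → c j = 0 := by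
    intro j hj
    simp only [hc]
    have h0 : (Q j).indicator f =ᵐ[μ] 0 := by
      filter_upwards [hf] with x hx
      by_cases hxj : x ∈ Q j
      · rw [Set.indicator_of_mem hxj]
        refine hx fun hxz => hj ?_
        have h1 := Metric.mem_ball.1 (h.subset_ball j hxj)
        have h2 := Metric.mem_ball.1 hxz
        have h3 := dist_triangle_left (j : X) z x
        rw [div_lt_iff₀ hτ]
        nlinarith
      · rw [Set.indicator_of_notMem hxj]; rfl
    rw [eLpNorm_congr_ae h0]
    exact eLpNorm_zero
  have hblock : ∀ i j, ‖cutOp μ (Q i) ((M ∘L A) (cutOp μ (Q j) f))‖ₑ ≤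
      ENNReal.ofReal P * (ENNReal.ofReal (E * e i j) * c j
        + J j * (ENNReal.ofReal (g i j) * c j)) := by
    intro i j
    rw [ContinuousLinearMap.comp_apply, hM, h.partition.cutOp_stepOp hwkb]
    have hwi : 0 < w i := by linarith [hw1 i]
    have h1 : ‖((w i ^ k : ℝ) : ℂ) • cutOp μ (Q i) (A (cutOp μ (Q j) f))‖ₑ ≤
        ENNReal.ofReal (w i ^ k * ((D * 2 ^ n) ^ sigma p * C * ballVol μ (i : X) τ ^ (-sigma p)
        * (1 + dist (i : X) j / τ) ^ (-n - a))) * c j := by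
      rw [enorm_smul, ENNReal.ofReal_mul (by positivity), mul_assoc]
      gcongr
      · rw [← ofReal_norm, Complex.norm_real, Real.norm_of_nonneg (by positivity)]
      · exact h.enorm_block_le i j f
    refine h1.trans ?_
    by_cases hj : dist (j : X) z / τ < 2 * ρ
    · have hJj : J j = 1 := by
        simp only [hJ]
        rw [Set.indicator_of_mem]
        · rfl
        · rw [Metric.mem_ball]; exact (div_lt_iff₀ hτ).1 hj
      have e2 : ENNReal.ofReal P * (ENNReal.ofReal (E * e i j) * c j
          + J j * (ENNReal.ofReal (g i j) * c j)) = ENNReal.ofReal (P * (E * e i j + g i j)) * c j := by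
        rw [hJj, one_mul, ← add_mul,
          ← ENNReal.ofReal_add (mul_nonneg (by positivity) (he0 i j)) (hg0 i j),
          ENNReal.ofReal_mul hP0.le, mul_assoc (ENNReal.ofReal P)]
      rw [e2]
      exact mul_le_mul_left (ENNReal.ofReal_le_ofReal (h.kernel_le hk hρ (hw1 i) (hw i) hj)) _
    · rw [hzero j hj]; simp
  have hrow : ∀ i, ∑' j, ENNReal.ofReal (E * e i j) ≤ ENNReal.ofReal (E * netConst n D (a - k)) :=
    fun i => by
      simp_rw [ENNReal.ofReal_mul (show 0 ≤ E by positivity)]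
      rw [ENNReal.tsum_mul_left]
      gcongr
      exact h.doubling.tsum_decay_le hδ hτ h.net (i : X)
  have hcole : ∀ j, ∑' i, ENNReal.ofReal (e i j) ≤ ENNReal.ofReal (netConst n D (a - k)) :=
    fun j => by
      simp only [he]
      simp_rw [dist_comm _ (j : X)]
      exact h.doubling.tsum_decay_le hδ hτ h.net (j : X)
  have hcol : ∀ j, ∑' i, ENNReal.ofReal (E * e i j) ≤ ENNReal.ofReal (E * netConst n D (a - k)) :=
    fun j => by
      simp_rw [ENNReal.ofReal_mul (show 0 ≤ E by positivity)]
      rw [ENNReal.tsum_mul_left]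
      gcongr
      exact hcole j
  have hnear := tsum_sq_tsum_le_of_schur c hrow hcol
  set G := (4 : ℝ) ^ (n * sigma p) * ρ ^ (-(n - 2 * (n * sigma p))) with hG
  have hfar1 : ∀ i, (∑' j, J j * (ENNReal.ofReal (g i j) * c j)) ^ 2 ≤
      ENNReal.ofReal (D * (8 * (2 * ρ)) ^ n) *
        ∑' j, ENNReal.ofReal (G * e i j) * c j ^ 2 := by
    intro i
    refine (ENNReal_sq_tsum_mul_le _ _).trans ?_
    have h1 := h.doubling.tsum_indicator_le hτ h.net (R := 2 * ρ * τ) (by nlinarith) z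
    rw [mul_div_cancel_right₀ _ hτ.ne'] at h1
    refine mul_le_mul' h1 (ENNReal.tsum_le_tsum fun j => ?_)
    have hJ1 : J j ≤ 1 := by
      simp only [hJ]
      exact Set.indicator_le_self' (fun _ _ => zero_le) _
    refine (mul_le_of_le_one_left' hJ1).trans ?_
    rw [mul_pow, ← ENNReal.ofReal_pow (hg0 i j)]
    gcongr
    simp only [hg]
    split_ifs with hfar
    · exact h.far_kernel_sq_le hka hρ (by linarith)
    · have : 0 ≤ G * e i j := mul_nonneg (by positivity) (he0 i j)
      simpa using this
  have hfar : ∑' i, (∑' j, J j * (ENNReal.ofReal (g i j) * c j)) ^ 2 ≤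
      ENNReal.ofReal (D * (8 * (2 * ρ)) ^ n * (G * netConst n D (a - k))) * ∑' j, c j ^ 2 := by
    calc _ ≤ ∑' i, ENNReal.ofReal (D * (8 * (2 * ρ)) ^ n) *
          ∑' j, ENNReal.ofReal (G * e i j) * c j ^ 2 := ENNReal.tsum_le_tsum hfar1
      _ = ENNReal.ofReal (D * (8 * (2 * ρ)) ^ n) *
          ∑' j, (∑' i, ENNReal.ofReal (G * e i j)) * c j ^ 2 := by
          rw [ENNReal.tsum_mul_left, ENNReal.tsum_comm]
          simp_rw [ENNReal.tsum_mul_right]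
      _ ≤ ENNReal.ofReal (D * (8 * (2 * ρ)) ^ n) *
          ∑' j, ENNReal.ofReal (G * netConst n D (a - k)) * c j ^ 2 := by
          gcongr with j
          simp_rw [ENNReal.ofReal_mul (show 0 ≤ G by positivity)]
          rw [ENNReal.tsum_mul_left]
          gcongr
          exact hcole j
      _ = _ := by rw [ENNReal.tsum_mul_left,
            ENNReal.ofReal_mul (p := D * (8 * (2 * ρ)) ^ n) (by positivity),
            mul_assoc (ENNReal.ofReal (D * (8 * (2 * ρ)) ^ n))]
  have hsum := h.partition.tsum_eLpNorm_sq_le (μ := μ) h.one_le h.lt_two f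
  set N₀ := netConst n D (a - k)
  have htotal := h.partition.enorm_sq_apply_le (M ∘L A) f hblock
  have hcomb : ‖M (A f)‖ₑ ^ 2 ≤ ENNReal.ofReal (P ^ 2 * (2 * (E * N₀) ^ 2 +
      2 * (D * (8 * (2 * ρ)) ^ n * (G * N₀)))) * eLpNorm f p μ ^ 2 := by
    refine htotal.trans ?_
    simp_rw [ENNReal.tsum_mul_left, mul_pow (ENNReal.ofReal P), ENNReal.tsum_add]
    rw [ENNReal.tsum_mul_left, ENNReal.ofReal_mul (p := P ^ 2) (by positivity),
      ENNReal.ofReal_pow hP0.le, mul_assoc (ENNReal.ofReal P ^ 2)]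
    gcongr
    calc _ ≤ ∑' i, (2 * (∑' j, ENNReal.ofReal (E * e i j) * c j) ^ 2
          + 2 * (∑' j, J j * (ENNReal.ofReal (g i j) * c j)) ^ 2) :=
          ENNReal.tsum_le_tsum fun i => ENNReal_add_sq_le _ _
      _ = 2 * ∑' i, (∑' j, ENNReal.ofReal (E * e i j) * c j) ^ 2
          + 2 * ∑' i, (∑' j, J j * (ENNReal.ofReal (g i j) * c j)) ^ 2 := by
          rw [ENNReal.tsum_add, ENNReal.tsum_mul_left, ENNReal.tsum_mul_left]
      _ ≤ 2 * (ENNReal.ofReal (E * N₀) ^ 2 * ∑' j, c j ^ 2)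
          + 2 * (ENNReal.ofReal (D * (8 * (2 * ρ)) ^ n * (G * N₀)) * ∑' j, c j ^ 2) := by gcongr
      _ = ENNReal.ofReal (2 * (E * N₀) ^ 2 + 2 * (D * (8 * (2 * ρ)) ^ n * (G * N₀)))
          * ∑' j, c j ^ 2 := by
          rw [ENNReal.ofReal_add (by positivity) (by positivity),
            ENNReal.ofReal_mul zero_le_two, ENNReal.ofReal_mul zero_le_two,
            ENNReal.ofReal_pow (by positivity), ENNReal.ofReal_ofNat]
          ring
      _ ≤ _ := by gcongr
  rw [← ENNReal.pow_le_pow_left_iff two_ne_zero, mul_pow]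
  refine hcomb.trans ?_
  gcongr
  rw [← ENNReal.ofReal_pow (by have := h.dataConst_pos hka; positivity)]
  refine ENNReal.ofReal_le_ofReal ?_
  have hfin1 : D * (8 * (2 * ρ)) ^ n * (G * N₀)
      = D * 16 ^ n * 4 ^ (n * sigma p) * N₀ * (ρ ^ (n * sigma p)) ^ 2 := by
    have h1 : (8 * (2 * ρ)) ^ n = 16 ^ n * ρ ^ n := by
      rw [← Real.mul_rpow (by norm_num) hρ0.le]; congr 1; ring
    have h2 : ρ ^ n * ρ ^ (-(n - 2 * (n * sigma p))) = (ρ ^ (n * sigma p)) ^ 2 := by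
      rw [← Real.rpow_add hρ0, sq, ← Real.rpow_add hρ0]; congr 1; ring
    rw [h1, hG, ← h2]; ring
  rw [hfin1]
  set x := (6 : ℝ) ^ (n * sigma p) * N₀ with hx
  set y := D * 16 ^ n * 4 ^ (n * sigma p) * N₀ with hy
  have hx0 : 0 ≤ x := by positivity
  have hy0 : 0 ≤ y := by positivity
  have hEN : (E * N₀) ^ 2 = x ^ 2 * (ρ ^ (n * sigma p)) ^ 2 := by rw [hE, hx]; ring
  have hdc : dataConst p n D a C k * (ρ ^ (n * sigma p) * ballVol μ z (ρ * τ) ^ (-sigma p))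
      = P * ρ ^ (n * sigma p) * (2 * (x + y + 1)) := by
    rw [dataConst, hP]; ring
  rw [hdc, hEN]
  calc P ^ 2 * (2 * (x ^ 2 * (ρ ^ (n * sigma p)) ^ 2) + 2 * (y * (ρ ^ (n * sigma p)) ^ 2))
      = (P * ρ ^ (n * sigma p)) ^ 2 * (2 * x ^ 2 + 2 * y) := by ring
    _ ≤ (P * ρ ^ (n * sigma p)) ^ 2 * (2 * (x + y + 1)) ^ 2 := by
        gcongr
        nlinarith
    _ = _ := by ring

end BlockData

end InitialData

end SpectralMultiplier
end

noncomputable section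
namespace SpectralMultiplier

/-! ### Hölder, Minkowski and pointwise bounds for L² series -/

section Inequalities

/-- Hölder's inequality for the measure J dν. For an indicator J the first factor is an overlap
count, which is paid only to the power p - 1; for a convolution kernel J it gives Young's
inequality. -/
theorem ENNReal_rpow_lintegral_mul_le {ι : Type*} [MeasurableSpace ι] {ν : Measure ι}
    {J c : ι → ℝ≥0∞} (hJ : AEMeasurable J ν) (hc : AEMeasurable c ν) {p : ℝ} (hp : 1 ≤ p) :
    (∫⁻ j, J j * c j ∂ν) ^ p ≤ (∫⁻ j, J j ∂ν) ^ (p - 1) * ∫⁻ j, J j * c j ^ p ∂ν := by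
  rcases hp.eq_or_lt with rfl | hp1
  · simp
  have hp0 : 0 < p := by linarith
  have hpq := Real.HolderConjugate.conjExponent hp1
  set q := p.conjExponent with hq
  have hq0 : 0 < q := hpq.symm.pos
  have h := ENNReal.lintegral_mul_le_Lp_mul_Lq ν hpq.symm
    (hJ.pow_const (1 / q)) ((hJ.pow_const (1 / p)).mul hc)
  have e1 : ∀ j, J j ^ (1 / q) * (J j ^ (1 / p) * c j) = J j * c j := fun j => by
    rw [← mul_assoc, ← ENNReal.rpow_add_of_nonneg _ _ (by positivity) (by positivity)]
    have := hpq.symm.inv_add_inv_eq_one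
    rw [one_div, one_div, this, ENNReal.rpow_one]
  have e2 : ∀ j, (J j ^ (1 / q)) ^ q = J j := fun j => by
    rw [← ENNReal.rpow_mul, one_div_mul_cancel hq0.ne', ENNReal.rpow_one]
  have e3 : ∀ j, (J j ^ (1 / p) * c j) ^ p = J j * c j ^ p := fun j => by
    rw [ENNReal.mul_rpow_of_nonneg _ _ hp0.le, ← ENNReal.rpow_mul, one_div_mul_cancel hp0.ne',
      ENNReal.rpow_one]
  simp only [Pi.mul_apply, e1, e2, e3] at h
  have h2 := ENNReal.rpow_le_rpow h hp0.le
  rw [ENNReal.mul_rpow_of_nonneg _ _ hp0.le, ← ENNReal.rpow_mul, ← ENNReal.rpow_mul,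
    one_div_mul_cancel hp0.ne', ENNReal.rpow_one] at h2
  have e4 : 1 / q * p = p - 1 := by
    have := hpq.symm.inv_add_inv_eq_one
    field_simp at this ⊢
    linarith
  rwa [e4] at h2

theorem ENNReal_rpow_tsum_mul_le {ι : Type*} (J c : ι → ℝ≥0∞) {p : ℝ} (hp : 1 ≤ p) :
    (∑' j, J j * c j) ^ p ≤ (∑' j, J j) ^ (p - 1) * ∑' j, J j * c j ^ p := by
  let _ : MeasurableSpace ι := ⊤
  have hm : ∀ f : ι → ℝ≥0∞, AEMeasurable f Measure.count := fun f =>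
    measurable_from_top.aemeasurable
  simpa only [lintegral_count] using ENNReal_rpow_lintegral_mul_le (hm J) (hm c) hp

variable {X : Type*} [MeasurableSpace X] {μ : Measure X}

/-- Minkowski's inequality for a series of nonnegative functions. -/
theorem lintegral_rpow_tsum_le {f : ℕ → X → ℝ≥0∞} (hf : ∀ m, AEMeasurable (f m) μ) {p : ℝ}
    (hp : 1 ≤ p) :
    (∫⁻ x, (∑' m, f m x) ^ p ∂μ) ^ (1 / p) ≤ ∑' m, (∫⁻ x, f m x ^ p ∂μ) ^ (1 / p) := by
  have hp0 : 0 < p := by linarith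
  have hfin : ∀ N, (∫⁻ x, (∑ m ∈ Finset.range N, f m x) ^ p ∂μ) ^ (1 / p)
      ≤ ∑ m ∈ Finset.range N, (∫⁻ x, f m x ^ p ∂μ) ^ (1 / p) := by
    intro N
    induction N with
    | zero => simp [hp0]
    | succ N ih =>
      simp_rw [Finset.sum_range_succ]
      refine le_trans (ENNReal.lintegral_Lp_add_le (f := fun x => ∑ m ∈ Finset.range N, f m x)
        (Finset.aemeasurable_fun_sum _ fun m _ => hf m) (hf N) hp) ?_
      gcongr
  have hlim : Filter.Tendsto (fun N => ∫⁻ x, (∑ m ∈ Finset.range N, f m x) ^ p ∂μ)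
      Filter.atTop (nhds (∫⁻ x, (∑' m, f m x) ^ p ∂μ)) := by
    refine lintegral_tendsto_of_tendsto_of_monotone
      (fun N => (Finset.aemeasurable_fun_sum _ fun m _ => hf m).pow_const p)
      (Filter.Eventually.of_forall fun x => ?_) (Filter.Eventually.of_forall fun x => ?_)
    · intro a b hab
      exact ENNReal.rpow_le_rpow (Finset.sum_le_sum_of_subset (Finset.range_mono hab)) hp0.le
    · exact ((ENNReal.continuous_rpow_const (y := p)).tendsto _).comp
        (ENNReal.tendsto_nat_tsum fun m => f m x)
  have hlim2 := ((ENNReal.continuous_rpow_const (y := 1 / p)).tendsto _).comp hlim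
  exact le_of_tendsto hlim2 (Filter.Eventually.of_forall fun N =>
    (hfin N).trans (ENNReal.sum_le_tsum _))

/-- Convergence in L² gives almost everywhere convergence along a sequence of partial sums, and each
partial sum obeys the triangle inequality. -/
theorem ae_enorm_le_tsum {ι : Type*} [Countable ι] {g : ι → Lp ℂ 2 μ} {G : Lp ℂ 2 μ}
    (h : HasSum g G) : ∀ᵐ x ∂μ, ‖G x‖ₑ ≤ ∑' i, ‖g i x‖ₑ := by
  obtain ⟨ns, -, hns⟩ := (tendstoInMeasure_of_tendsto_Lp h).exists_seq_tendsto_ae'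
  have hsum : ∀ᵐ x ∂μ, ∀ s : Finset ι, (∑ i ∈ s, g i : Lp ℂ 2 μ) x = ∑ i ∈ s, g i x := by
    rw [ae_all_iff]
    intro s
    filter_upwards [Lp.coeFn_finsetSum s g] with x hx
    rw [hx, Finset.sum_apply]
  filter_upwards [hns, hsum] with x hx hx2
  refine le_of_tendsto ((continuous_enorm.tendsto _).comp hx) (Filter.Eventually.of_forall fun m => ?_)
  simp only [Function.comp_apply, hx2]
  exact (enorm_sum_le _ _).trans (ENNReal.sum_le_tsum _)

end Inequalities

/-! ### From local and weighted L² estimates to an L^p bound -/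

section Localization

variable {X : Type*} [MetricSpace X] [MeasurableSpace X] [BorelSpace X] {μ : Measure X}

/-- The dyadic annuli around `z` at scale `R`, starting with a ball. -/
def annulus (z : X) (R : ℝ) : ℕ → Set X
  | 0 => Metric.ball z (2 ^ 2 * R)
  | m + 1 => Metric.ball z (2 ^ (m + 3) * R) \ Metric.ball z (2 ^ (m + 2) * R)

theorem measurableSet_annulus (z : X) (R : ℝ) (m : ℕ) : MeasurableSet (annulus z R m) := by
  cases m with
  | zero => exact measurableSet_ball
  | succ m => exact measurableSet_ball.diff measurableSet_ball

omit [MeasurableSpace X] [BorelSpace X] in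
theorem annulus_subset_ball (z : X) (R : ℝ) (m : ℕ) :
    annulus z R m ⊆ Metric.ball z (2 ^ (m + 2) * R) := by
  cases m with
  | zero => exact subset_rfl
  | succ m => exact Set.diff_subset

omit [MeasurableSpace X] [BorelSpace X] in
theorem exists_mem_annulus (z : X) {R : ℝ} (hR : 0 < R) (x : X) : ∃ m, x ∈ annulus z R m := by
  classical
  have hex : ∃ m : ℕ, x ∈ Metric.ball z (2 ^ (m + 2) * R) := by
    obtain ⟨m, hm⟩ := pow_unbounded_of_one_lt (dist x z / R) (one_lt_two)
    refine ⟨m, ?_⟩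
    rw [Metric.mem_ball, ← div_lt_iff₀ hR]
    exact hm.trans_le (pow_le_pow_right₀ one_le_two (by omega))
  have hspec := Nat.find_spec hex
  have hmin : ∀ m, m < Nat.find hex → x ∉ Metric.ball z (2 ^ (m + 2) * R) :=
    fun m hm => Nat.find_min hex hm
  generalize Nat.find hex = N at hspec hmin
  cases N with
  | zero => exact ⟨0, hspec⟩
  | succ m => exact ⟨m + 1, hspec, hmin m (Nat.lt_succ_self m)⟩

namespace BlockData

variable [TopologicalSpace.SeparableSpace X]
variable {A : Lp ℂ 2 μ →L[ℂ] Lp ℂ 2 μ} {p : ℝ≥0∞} {n D a τ C : ℝ} {S : Set X} {Q : S → Set X}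
  (h : BlockData A p n D a τ C Q)

/-- Admissible weights around the ball of center `z` and radius `ρ τ`. -/
structure IsWeight (τ ρ : ℝ) (z : X) {S : Set X} (w : S → ℝ) : Prop where
  one_le : ∀ i, 1 ≤ w i
  bounded : ∃ N, ∀ i, w i ≤ N
  lipschitz : ∀ i j : S, |w i - w j| ≤ dist (i : X) j / τ
  le_max : ∀ i : S, w i ≤ max 1 (1 + dist (i : X) z / τ - 2 * ρ)

include h

omit [TopologicalSpace.SeparableSpace X] in
theorem ball_rpow_le {ρ : ℝ} (hρ : 0 < ρ) (z : X) (m : ℕ) :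
    μ (Metric.ball z (2 ^ (m + 2) * (ρ * τ))) ^ sigma p ≤
      ENNReal.ofReal (D ^ sigma p * 4 ^ (n * sigma p) * ((2 : ℝ) ^ (n * sigma p)) ^ m *
        ballVol μ z (ρ * τ) ^ sigma p) := by
  have hD := h.doubling.one_le
  have hτ := h.scale_pos
  have hσ := h.sigma_pos
  have hV := h.doubling.vol_pos z (r := ρ * τ) (by positivity)
  have h1 : ballVol μ z (2 ^ (m + 2) * (ρ * τ)) ≤ D * (2 ^ (m + 2)) ^ n * ballVol μ z (ρ * τ) :=
    h.doubling.doubling z _ _ (by positivity) (one_le_pow₀ one_le_two)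
  have h0 : 0 ≤ ballVol μ z (2 ^ (m + 2) * (ρ * τ)) := ENNReal.toReal_nonneg
  have h2 := Real.rpow_le_rpow h0 h1 hσ.le
  have h3 : (((2 : ℝ) ^ (m + 2)) ^ n) ^ sigma p
      = 4 ^ (n * sigma p) * ((2 : ℝ) ^ (n * sigma p)) ^ m := by
    rw [← Real.rpow_mul (by positivity), ← Real.rpow_natCast, ← Real.rpow_natCast,
      ← Real.rpow_mul (by norm_num), ← Real.rpow_mul (by norm_num),
      show (4 : ℝ) = 2 ^ (2 : ℝ) by norm_num, ← Real.rpow_mul (by norm_num),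
      ← Real.rpow_add (by norm_num)]
    congr 1; push_cast; ring
  rw [Real.mul_rpow (by positivity) hV.le, Real.mul_rpow (by positivity) (by positivity), h3] at h2
  have h4 : μ (Metric.ball z (2 ^ (m + 2) * (ρ * τ)))
      = ENNReal.ofReal (ballVol μ z (2 ^ (m + 2) * (ρ * τ))) :=
    (ENNReal.ofReal_toReal (h.doubling.ball_lt_top _ _).ne).symm
  rw [h4, ENNReal.ofReal_rpow_of_nonneg h0 hσ.le]
  refine ENNReal.ofReal_le_ofReal (h2.trans_eq ?_)
  ring

-- Truncation at 2^{m+1}ρ makes the weight bounded without harm on the chosen annulus. That annulus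
-- starts at distance 2^{m+2}ρτ, and after subtracting 2ρ, and one τ for the block, at least
-- 2^{m+1}ρ remains.
omit [TopologicalSpace.SeparableSpace X] in
theorem exists_weight {ρ : ℝ} (hρ : 1 ≤ ρ) (z : X) (m : ℕ) :
    ∃ w : S → ℝ, IsWeight τ ρ z w ∧
      ∀ i : S, ∀ x ∈ Q i, x ∈ annulus z (ρ * τ) (m + 1) → 2 ^ (m + 1) * ρ ≤ w i := by
  have hτ := h.scale_pos
  have hpow : (1 : ℝ) ≤ 2 ^ (m + 1) := one_le_pow₀ one_le_two
  refine ⟨fun i => min (2 ^ (m + 1) * ρ) (max 1 (1 + dist (i : X) z / τ - 2 * ρ)),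
    ⟨fun i => le_min (by nlinarith) (le_max_left _ _), ⟨_, fun i => min_le_left _ _⟩,
      fun i j => ?_, fun i => min_le_right _ _⟩, fun i x hxi hx => le_min le_rfl ?_⟩
  · refine (abs_min_sub_min_le_max _ _ _ _).trans ?_
    rw [sub_self, abs_zero]
    refine max_le (by positivity) ((abs_max_sub_max_le_max _ _ _ _).trans ?_)
    rw [sub_self, abs_zero]
    refine max_le (by positivity) ?_
    have e : 1 + dist (i : X) z / τ - 2 * ρ - (1 + dist (j : X) z / τ - 2 * ρ)
        = (dist (i : X) z - dist (j : X) z) / τ := by ring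
    rw [e, abs_div, abs_of_pos hτ]
    gcongr
    exact abs_dist_sub_le _ _ _
  · refine le_trans ?_ (le_max_right _ _)
    have h1 : 2 ^ (m + 2) * (ρ * τ) ≤ dist x z := by
      have := hx.2
      rw [Metric.mem_ball, not_lt] at this
      exact this
    have h2 := Metric.mem_ball.1 (h.subset_ball i hxi)
    have h3 := dist_triangle x (i : X) z
    have h4 : 2 ^ (m + 2) * ρ - 1 ≤ dist (i : X) z / τ := by
      rw [le_div_iff₀ hτ]
      linarith
    have h5 : (2 : ℝ) ^ (m + 2) = 2 * 2 ^ (m + 1) := by ring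
    rw [h5] at h4
    have h6 : (2 : ℝ) ≤ 2 ^ (m + 1) := by
      calc (2 : ℝ) = 2 ^ 1 := by norm_num
        _ ≤ 2 ^ (m + 1) := pow_le_pow_right₀ one_le_two (by omega)
    nlinarith

/-- Hölder's inequality on the annulus costs a constant times 2^{mnσ} V(z, ρτ)^σ, whose volume
factor cancels the one in the hypotheses. For m = 0 the plain L² bound is used; for m ≥ 1 the weight
gives back (2^m ρ)^{-k}. -/
theorem eLpNorm_annulus_le {k ρ α β : ℝ} (hk : 1 ≤ k) (hρ : 1 ≤ ρ) (hα : 0 ≤ α) (hβ : 0 ≤ β)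
    (z : X) (u : Lp ℂ 2 μ) {N : ℝ≥0∞}
    (H1 : ‖u‖ₑ ≤ ENNReal.ofReal (α * (ρ ^ (n * sigma p) * ballVol μ z (ρ * τ) ^ (-sigma p))) * N)
    (H2 : ∀ w : S → ℝ, IsWeight τ ρ z w → ‖h.partition.stepOp μ (fun i => w i ^ k) u‖ₑ ≤
      ENNReal.ofReal (β * (ρ ^ (n * sigma p) * ballVol μ z (ρ * τ) ^ (-sigma p))) * N) (m : ℕ) :
    eLpNorm ((annulus z (ρ * τ) m).indicator u) p μ ≤
      ENNReal.ofReal (D ^ sigma p * 4 ^ (n * sigma p) *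
        (ρ ^ (n * sigma p) * (α + ρ ^ (-k) * β)) * ((2 : ℝ) ^ (n * sigma p - k)) ^ m) * N := by
  have hcount := h.countable
  have hD := h.doubling.one_le
  have hτ := h.scale_pos
  have hσ := h.sigma_pos
  have hρ0 : 0 < ρ := by linarith
  have hV := h.doubling.vol_pos z (r := ρ * τ) (by positivity)
  have hVV : ballVol μ z (ρ * τ) ^ (-sigma p) * ballVol μ z (ρ * τ) ^ sigma p = 1 := by
    rw [← Real.rpow_add hV]; simp
  have hmeas := measurableSet_annulus z (ρ * τ) m
  have key : ∀ θ : ℝ, 0 ≤ θ → eLpNorm ((annulus z (ρ * τ) m).indicator u) 2 μ ≤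
      ENNReal.ofReal (θ * (ρ ^ (n * sigma p) * ballVol μ z (ρ * τ) ^ (-sigma p))) * N →
      eLpNorm ((annulus z (ρ * τ) m).indicator u) p μ ≤ ENNReal.ofReal
        (D ^ sigma p * 4 ^ (n * sigma p) *
        (ρ ^ (n * sigma p) * θ) * ((2 : ℝ) ^ (n * sigma p)) ^ m) * N := by
    intro θ hθ hle
    refine (eLpNorm_indicator_le_two h.lt_two hmeas (Lp.aestronglyMeasurable u)).trans ?_
    refine (mul_le_mul' hle ((ENNReal.rpow_le_rpow (measure_mono (annulus_subset_ball z _ m))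
      hσ.le).trans (h.ball_rpow_le hρ0 z m))).trans_eq ?_
    rw [mul_right_comm, ← ENNReal.ofReal_mul (by positivity)]
    congr 2
    linear_combination (θ * ρ ^ (n * sigma p) * D ^ sigma p * 4 ^ (n * sigma p) *
      ((2 : ℝ) ^ (n * sigma p)) ^ m) * hVV
  cases m with
  | zero =>
    refine (key α hα ((eLpNorm_indicator_le _).trans ?_)).trans ?_
    · rw [← Lp.enorm_def]; exact H1
    · refine mul_le_mul_left (ENNReal.ofReal_le_ofReal ?_) _
      simp only [pow_zero, mul_one]
      have : α ≤ α + ρ ^ (-k) * β := le_add_of_nonneg_right (by positivity)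
      gcongr
  | succ m =>
    obtain ⟨w, hw, hwx⟩ := h.exists_weight hρ z m
    have hwkb : ∃ N, ∀ i, |w i ^ k| ≤ N := by
      obtain ⟨N, hN⟩ := hw.bounded
      refine ⟨N ^ k, fun i => ?_⟩
      have := hw.one_le i
      rw [abs_of_pos (Real.rpow_pos_of_pos (by linarith) _)]
      exact Real.rpow_le_rpow (by linarith) (hN i) (by linarith)
    have hstep : eLpNorm ((annulus z (ρ * τ) (m + 1)).indicator u) 2 μ ≤
        ENNReal.ofReal ((2 ^ (m + 1) * ρ) ^ (-k)) *
          ‖h.partition.stepOp μ (fun i => w i ^ k) u‖ₑ := by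
      rw [Lp.enorm_def]
      refine eLpNorm_le_mul_eLpNorm_of_ae_le_mul ?_ 2
      filter_upwards [mulOp_ae (h.partition.isBddMeasurable hwkb) u] with x hx
      rw [IsMeasurablePartition.stepOp, hx]
      by_cases hxa : x ∈ annulus z (ρ * τ) (m + 1)
      · rw [Set.indicator_of_mem hxa, norm_mul, Complex.norm_real, ← mul_assoc]
        refine le_mul_of_one_le_left (norm_nonneg _) ?_
        have h1 := hwx _ x (h.partition.mem_index x) hxa
        have h2 : (2 ^ (m + 1) * ρ) ^ k ≤ w (h.partition.index x) ^ k :=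
          Real.rpow_le_rpow (by positivity) h1 (by linarith)
        have hpos : 0 < (2 ^ (m + 1) * ρ) ^ k := by positivity
        rw [Real.norm_of_nonneg (hpos.le.trans h2), Real.rpow_neg (by positivity), inv_mul_eq_div,
          one_le_div hpos]
        exact h2
      · rw [Set.indicator_of_notMem hxa, norm_zero]
        positivity
    have hexp : (2 ^ (m + 1) * ρ) ^ (-k) = ((2 : ℝ) ^ (-k)) ^ (m + 1) * ρ ^ (-k) := by
      rw [Real.mul_rpow (by positivity) hρ0.le, ← Real.rpow_natCast, ← Real.rpow_natCast,
        ← Real.rpow_mul (by norm_num), ← Real.rpow_mul (by norm_num), mul_comm (-k)]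
    refine (key ((2 ^ (m + 1) * ρ) ^ (-k) * β) (by positivity) (hstep.trans ?_)).trans ?_
    · refine (mul_le_mul_right (H2 w hw) _).trans_eq ?_
      rw [← mul_assoc, ← ENNReal.ofReal_mul (by positivity)]
      congr 2; ring
    · refine mul_le_mul_left (ENNReal.ofReal_le_ofReal ?_) _
      rw [hexp, sub_eq_add_neg, Real.rpow_add (by norm_num), mul_pow]
      have : 0 ≤ D ^ sigma p * 4 ^ (n * sigma p) * ρ ^ (n * sigma p) *
        ((2 : ℝ) ^ (-k)) ^ (m + 1) * ((2 : ℝ) ^ (n * sigma p)) ^ (m + 1) * α := by positivity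
      linear_combination this

/-- The constant in the passage from local estimates to the norm on `L^p`. -/
def locConst (p : ℝ≥0∞) (n D k : ℝ) : ℝ :=
  D ^ sigma p * 4 ^ (n * sigma p) * (D * 32 ^ n) ^ (1 - 1 / p.toReal) *
    (1 - 2 ^ (n / 2 - k))⁻¹

omit [BorelSpace X] [TopologicalSpace.SeparableSpace X] h in
theorem locConst_pos (h : IsDoublingWith μ n D) {k : ℝ} (hkn : n / 2 < k) :
    0 < locConst p n D k := by
  have hD := h.one_le
  have h1 : (2 : ℝ) ^ (n / 2 - k) < 1 :=
    Real.rpow_lt_one_of_one_lt_of_neg (by norm_num) (by linarith)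
  have h2 : 0 < (1 - (2 : ℝ) ^ (n / 2 - k))⁻¹ := inv_pos.2 (by linarith)
  unfold locConst
  positivity

/-- The `L^p` bound for an operator that satisfies local and weighted estimates at scale `ρ τ`. -/
theorem eLpNorm_apply_le {k ρ α β : ℝ} (hk : 1 ≤ k) (hkn : n / 2 < k) (hρ : 1 ≤ ρ) (hα : 0 ≤ α)
    (hβ : 0 ≤ β) (T : Lp ℂ 2 μ →L[ℂ] Lp ℂ 2 μ)
    (H1 : ∀ (z : X) (f : Lp ℂ 2 μ), (∀ᵐ x ∂μ, x ∉ Metric.ball z (ρ * τ) → f x = 0) →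
      ‖T f‖ₑ ≤ ENNReal.ofReal (α * (ρ ^ (n * sigma p) * ballVol μ z (ρ * τ) ^ (-sigma p)))
        * eLpNorm f p μ)
    (H2 : ∀ (z : X) (f : Lp ℂ 2 μ), (∀ᵐ x ∂μ, x ∉ Metric.ball z (ρ * τ) → f x = 0) →
      ∀ w : S → ℝ, IsWeight τ ρ z w → ‖h.partition.stepOp μ (fun i => w i ^ k) (T f)‖ₑ ≤
        ENNReal.ofReal (β * (ρ ^ (n * sigma p) * ballVol μ z (ρ * τ) ^ (-sigma p)))
          * eLpNorm f p μ) (f : Lp ℂ 2 μ) :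
    eLpNorm (T f) p μ ≤ ENNReal.ofReal (locConst p n D k *
      (ρ ^ (n * sigma p) * (α + ρ ^ (-k) * β))) * eLpNorm f p μ := by
  have hD := h.doubling.one_le
  have hn := h.doubling.exponent_pos
  have hτ := h.scale_pos
  have hρ0 : 0 < ρ := by linarith
  have hR : 0 < ρ * τ := by positivity
  obtain ⟨hp1, hp2⟩ := toReal_mem_Ico h.one_le h.lt_two
  have hpt : p ≠ ∞ := (h.lt_two.trans ENNReal.ofNat_lt_top).ne
  have hp0 : p ≠ 0 := (zero_lt_one.trans_le h.one_le).ne'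
  set P := p.toReal with hP
  have hP0 : 0 < P := by linarith
  -- A second net, at scale ρτ instead of τ: it cuts f into pieces to which the two hypotheses
  -- apply.
  obtain ⟨S', hS'⟩ := exists_isNet X hR
  obtain ⟨Q', hQ', hQ'S⟩ := hS'.exists_partition hR
  have hcount' : Countable S' := (hS'.countable hR).to_subtype
  set Γ := D ^ sigma p * 4 ^ (n * sigma p) * (ρ ^ (n * sigma p) * (α + ρ ^ (-k) * β)) with hΓ
  have hΓ0 : 0 ≤ Γ := by positivity
  set g : S' → Lp ℂ 2 μ := fun j => T (cutOp μ (Q' j) f) with hg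
  set N : S' → ℝ≥0∞ := fun j => eLpNorm ((Q' j).indicator f) p μ with hN
  have hNcut : ∀ j, eLpNorm (cutOp μ (Q' j) f) p μ = N j := fun j =>
    eLpNorm_congr_ae (cutOp_ae (hQ'.measurable j) f)
  have hsupp : ∀ j : S', ∀ᵐ x ∂μ, x ∉ Metric.ball (j : X) (ρ * τ) → cutOp μ (Q' j) f x = 0 := by
    intro j
    filter_upwards [cutOp_ae (hQ'.measurable j) f] with x hx hxb
    rw [hx, Set.indicator_of_notMem fun hxj => hxb (hQ'S j hxj)]
  have hann : ∀ (j : S') (m : ℕ), eLpNorm ((annulus (j : X) (ρ * τ) m).indicator (g j)) p μ ≤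
      ENNReal.ofReal (Γ * ((2 : ℝ) ^ (n * sigma p - k)) ^ m) * N j := by
    intro j m
    have e1 := H1 j _ (hsupp j)
    have e2 := H2 j _ (hsupp j)
    rw [hNcut] at e1
    simp_rw [hNcut] at e2
    exact h.eLpNorm_annulus_le hk hρ hα hβ j (g j) e1 e2 m
  have e : ∀ (u : X → ℂ), eLpNorm u p μ ^ P = ∫⁻ x, ‖u x‖ₑ ^ P ∂μ := fun u => by
    rw [eLpNorm_eq_lintegral_rpow_enorm_toReal hp0 hpt, ← ENNReal.rpow_mul,
      one_div_mul_cancel hP0.ne', ENNReal.rpow_one]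
  set J : ℕ → S' → X → ℝ≥0∞ := fun m j => (annulus (j : X) (ρ * τ) m).indicator 1 with hJ
  have hJm : ∀ m j, Measurable (J m j) := fun m j =>
    measurable_one.indicator (measurableSet_annulus _ _ _)
  have hgm : ∀ j, AEMeasurable (fun x => ‖g j x‖ₑ) μ := fun j =>
    (Lp.aestronglyMeasurable (g j)).enorm
  set H : ℕ → X → ℝ≥0∞ := fun m x => ∑' j, J m j x * ‖g j x‖ₑ with hH
  have hHm : ∀ m, AEMeasurable (H m) μ := fun m =>
    AEMeasurable.tsum fun j => (hJm m j).aemeasurable.mul (hgm j)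
  have hpoint : ∀ᵐ x ∂μ, ‖T f x‖ₑ ≤ ∑' m, H m x := by
    filter_upwards [ae_enorm_le_tsum ((hQ'.hasSum_cutOp f).mapL T)] with x hx
    refine hx.trans ?_
    simp only [hH]
    rw [ENNReal.tsum_comm]
    refine ENNReal.tsum_le_tsum fun j => ?_
    obtain ⟨m, hm⟩ := exists_mem_annulus (j : X) hR x
    refine le_trans ?_ (ENNReal.le_tsum m)
    simp only [hJ]
    rw [Set.indicator_of_mem hm, Pi.one_apply, one_mul]
  -- If x lies in the m-th annulus around j, then j lies in a ball around x, so the overlap is a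
  -- count of net points.
  have hoverlap : ∀ m x, ∑' j, J m j x ≤ ENNReal.ofReal (D * (8 * 2 ^ (m + 2)) ^ n) := by
    intro m x
    have h1 := h.doubling.tsum_indicator_le hR hS' (R := 2 ^ (m + 2) * (ρ * τ))
      (le_mul_of_one_le_left hR.le (one_le_pow₀ one_le_two)) x
    rw [mul_div_cancel_right₀ _ hR.ne'] at h1
    refine le_trans (ENNReal.tsum_le_tsum fun j => ?_) h1
    simp only [hJ]
    by_cases hx : x ∈ annulus (j : X) (ρ * τ) m
    · have := annulus_subset_ball _ _ _ hx
      rw [Set.indicator_of_mem hx, Set.indicator_of_mem (Metric.mem_ball_comm.1 this)]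
      rfl
    · rw [Set.indicator_of_notMem hx]; exact zero_le
  have hHp : ∀ m, (∫⁻ x, H m x ^ P ∂μ) ^ (1 / P) ≤
      ENNReal.ofReal ((D * (8 * 2 ^ (m + 2)) ^ n) ^ (1 - 1 / P) *
        (Γ * ((2 : ℝ) ^ (n * sigma p - k)) ^ m)) * eLpNorm f p μ := by
    intro m
    have h1 : ∫⁻ x, H m x ^ P ∂μ ≤ ENNReal.ofReal (D * (8 * 2 ^ (m + 2)) ^ n) ^ (P - 1) *
        (ENNReal.ofReal (Γ * ((2 : ℝ) ^ (n * sigma p - k)) ^ m) ^ P * eLpNorm f p μ ^ P) := by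
      calc ∫⁻ x, H m x ^ P ∂μ
          ≤ ∫⁻ x, ENNReal.ofReal (D * (8 * 2 ^ (m + 2)) ^ n) ^ (P - 1) *
            ∑' j : S', J m j x * ‖g j x‖ₑ ^ P ∂μ := by
            refine lintegral_mono fun x => (ENNReal_rpow_tsum_mul_le _ _ hp1).trans ?_
            exact mul_le_mul_left (ENNReal.rpow_le_rpow (hoverlap m x) (by linarith)) _
        _ = ENNReal.ofReal (D * (8 * 2 ^ (m + 2)) ^ n) ^ (P - 1) *
            ∑' j : S', eLpNorm ((annulus (j : X) (ρ * τ) m).indicator (g j)) p μ ^ P := by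
            rw [lintegral_const_mul' _ _ (ENNReal.rpow_ne_top_of_nonneg (by linarith)
              ENNReal.ofReal_ne_top), lintegral_tsum (f := fun j x => J m j x * ‖g j x‖ₑ ^ P)
                fun j => (hJm m j).aemeasurable.mul ((hgm j).pow_const P)]
            congr 2
            ext j
            rw [e]
            refine lintegral_congr fun x => ?_
            simp only [hJ]
            by_cases hx : x ∈ annulus (j : X) (ρ * τ) m <;> simp [hx, hP0]
        _ ≤ ENNReal.ofReal (D * (8 * 2 ^ (m + 2)) ^ n) ^ (P - 1) *
            ∑' j : S', ENNReal.ofReal (Γ * ((2 : ℝ) ^ (n * sigma p - k)) ^ m) ^ P * N j ^ P := by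
            gcongr with j
            rw [← ENNReal.mul_rpow_of_nonneg _ _ hP0.le]
            exact ENNReal.rpow_le_rpow (hann j m) hP0.le
        _ = _ := by rw [ENNReal.tsum_mul_left, hQ'.tsum_eLpNorm_rpow hp0 hpt]
    refine (ENNReal.rpow_le_rpow h1 (by positivity)).trans_eq ?_
    rw [← ENNReal.mul_rpow_of_nonneg _ _ hP0.le, ENNReal.mul_rpow_of_nonneg _ _ (by positivity),
      ← ENNReal.rpow_mul, ← ENNReal.rpow_mul, mul_one_div_cancel hP0.ne', ENNReal.rpow_one,
      ENNReal.ofReal_mul (p := (D * (8 * 2 ^ (m + 2)) ^ n) ^ (1 - 1 / P)) (by positivity), mul_assoc]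
    have hexp : (P - 1) * (1 / P) = 1 - 1 / P := by field_simp
    have hexp0 : 0 ≤ 1 - 1 / P := by
      rw [sub_nonneg, div_le_one hP0]; exact hp1
    rw [hexp, ENNReal.ofReal_rpow_of_nonneg (p := 1 - 1 / P) (by positivity) hexp0,
      mul_assoc (ENNReal.ofReal ((D * (8 * 2 ^ (m + 2)) ^ n) ^ (1 - 1 / P)))]
  -- The overlap exponent n(1 - 1/p) and the exponent nσ - k of a single annulus add up to n/2 - k,
  -- since σ = 1/p - 1/2.
  have hgeo : ∀ m : ℕ, (D * (8 * 2 ^ (m + 2)) ^ n) ^ (1 - 1 / P) *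
        (Γ * ((2 : ℝ) ^ (n * sigma p - k)) ^ m)
      = (D * 32 ^ n) ^ (1 - 1 / P) * Γ * ((2 : ℝ) ^ (n / 2 - k)) ^ m := by
    intro m
    have e1 : (8 : ℝ) * 2 ^ (m + 2) = 32 * 2 ^ m := by ring
    have e2 : D * (32 * (2 : ℝ) ^ m) ^ n = D * 32 ^ n * (2 ^ n) ^ m := by
      rw [Real.mul_rpow (by norm_num) (by positivity), ← Real.rpow_natCast, ← Real.rpow_natCast,
        ← Real.rpow_mul (by positivity), ← Real.rpow_mul (by positivity), mul_comm (m : ℝ), mul_assoc]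
    have e3 : (((2 : ℝ) ^ n) ^ m) ^ (1 - 1 / P) * ((2 : ℝ) ^ (n * sigma p - k)) ^ m
        = ((2 : ℝ) ^ (n / 2 - k)) ^ m := by
      rw [← Real.rpow_natCast, ← Real.rpow_natCast, ← Real.rpow_natCast,
        ← Real.rpow_mul (by positivity), ← Real.rpow_mul (by positivity), ← Real.rpow_mul (by positivity),
        ← Real.rpow_mul (by positivity), ← Real.rpow_add (by norm_num)]
      congr 1
      simp only [sigma]
      ring
    rw [e1, e2, Real.mul_rpow (by positivity) (by positivity), ← e3]
    ring
  have h2lt : (2 : ℝ) ^ (n / 2 - k) < 1 :=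
    Real.rpow_lt_one_of_one_lt_of_neg (by norm_num) (by linarith)
  calc eLpNorm (T f) p μ = (∫⁻ x, ‖T f x‖ₑ ^ P ∂μ) ^ (1 / P) :=
        eLpNorm_eq_lintegral_rpow_enorm_toReal hp0 hpt
    _ ≤ (∫⁻ x, (∑' m, H m x) ^ P ∂μ) ^ (1 / P) := by
        refine ENNReal.rpow_le_rpow (lintegral_mono_ae ?_) (by positivity)
        filter_upwards [hpoint] with x hx
        exact ENNReal.rpow_le_rpow hx hP0.le
    _ ≤ ∑' m, (∫⁻ x, H m x ^ P ∂μ) ^ (1 / P) := lintegral_rpow_tsum_le hHm hp1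
    _ ≤ ∑' m : ℕ, ENNReal.ofReal ((D * 32 ^ n) ^ (1 - 1 / P) * Γ * ((2 : ℝ) ^ (n / 2 - k)) ^ m)
        * eLpNorm f p μ := ENNReal.tsum_le_tsum fun m => by rw [← hgeo]; exact hHp m
    _ = _ := by
        have hsum := (hasSum_geometric_of_lt_one (r := (2 : ℝ) ^ (n / 2 - k)) (by positivity)
          h2lt).mul_left ((D * 32 ^ n) ^ (1 - 1 / P) * Γ)
        rw [ENNReal.tsum_mul_right,
          ← ENNReal.ofReal_tsum_of_nonneg (fun m => by positivity) hsum.summable, hsum.tsum_eq]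
        congr 2
        rw [locConst, hΓ]
        ring

end BlockData

end Localization

end SpectralMultiplier
end

noncomputable section

namespace SpectralMultiplier

/-! ### The L^p bound for G(A)A with a Schwartz function G -/

section LocalMultiplier

open scoped FourierTransform

variable {X : Type*} [MetricSpace X] [TopologicalSpace.SeparableSpace X] [MeasurableSpace X]
  [BorelSpace X] {μ : Measure X} {n D : ℝ}

namespace IsDoublingWith

variable (h : IsDoublingWith μ n D)
include h

omit [TopologicalSpace.SeparableSpace X] [BorelSpace X] in
theorem isLocallyFiniteMeasure : IsLocallyFiniteMeasure μ :=
  ⟨fun x => ⟨Metric.ball x 1, Metric.ball_mem_nhds x one_pos, h.ball_lt_top x 1⟩⟩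

/-- The volume of B(z, τ) is the measure of a section of an open set in X × X. Separability and
local finiteness provide the finiteness condition on μ that measurability of section volumes
requires. -/
theorem measurable_volPow (τ σ : ℝ) : Measurable (volPow μ τ σ) := by
  have := UniformSpace.secondCountable_of_separable X
  have := h.isLocallyFiniteMeasure
  have hm : MeasurableSet {z : X × X | dist z.2 z.1 < τ} :=
    (isOpen_lt (by fun_prop) continuous_const).measurableSet
  exact (measurable_measure_prodMk_left hm).ennreal_toReal.pow_const σ

end IsDoublingWith

namespace BlockData

variable {A : Lp ℂ 2 μ →L[ℂ] Lp ℂ 2 μ} {p : ℝ≥0∞} {a τ C : ℝ} {S : Set X} {Q : S → Set X}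
  (h : BlockData A p n D a τ C Q)
include h

omit [TopologicalSpace.SeparableSpace X] in
theorem eLpNorm_lt_top_of_ball (z : X) {r : ℝ} (f : Lp ℂ 2 μ)
    (hf : ∀ᵐ x ∂μ, x ∉ Metric.ball z r → f x = 0) : eLpNorm f p μ < ∞ := by
  have e : (f : X → ℂ) =ᵐ[μ] (Metric.ball z r).indicator f := by
    filter_upwards [hf] with x hx
    by_cases hxb : x ∈ Metric.ball z r
    · rw [Set.indicator_of_mem hxb]
    · rw [Set.indicator_of_notMem hxb, hx hxb]
  rw [eLpNorm_congr_ae e]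
  refine (eLpNorm_indicator_le_two h.lt_two measurableSet_ball
    (Lp.aestronglyMeasurable f)).trans_lt (ENNReal.mul_lt_top ?_ ?_)
  · exact (eLpNorm_indicator_le _).trans_lt (Lp.memLp f).2
  · exact ENNReal.rpow_lt_top_of_nonneg h.sigma_pos.le (h.doubling.ball_lt_top _ _).ne

/-- A restriction estimate, applied to functions that are supported in a ball. -/
theorem enorm_apply_le_of_restriction {T : Lp ℂ 2 μ →L[ℂ] Lp ℂ 2 μ} {α ρ : ℝ} (hρ : 1 ≤ ρ)
    (hα : 0 ≤ α)
    (hT : ∀ f : X → ℂ, MemLp f p μ →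
      ∀ hf : MemLp (fun z => (volPow μ τ (sigma p) z : ℂ) * f z) 2 μ,
        ‖T (hf.toLp _)‖ₑ ≤ ENNReal.ofReal α * eLpNorm f p μ)
    (z : X) (f : Lp ℂ 2 μ) (hf : ∀ᵐ x ∂μ, x ∉ Metric.ball z (ρ * τ) → f x = 0) :
    ‖T f‖ₑ ≤ ENNReal.ofReal (α * (D ^ sigma p * 2 ^ (n * sigma p)) *
      (ρ ^ (n * sigma p) * ballVol μ z (ρ * τ) ^ (-sigma p))) * eLpNorm f p μ := by
  have hD := h.doubling.one_le
  have hτ := h.scale_pos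
  have hσ := h.sigma_pos
  have hρ0 : 0 < ρ := by linarith
  have hVz := h.doubling.vol_pos z (r := ρ * τ) (by positivity)
  have hpos : ∀ x, 0 < volPow μ τ (sigma p) x := fun x =>
    Real.rpow_pos_of_pos (h.doubling.vol_pos x hτ) _
  set c : ℝ := D ^ sigma p * 2 ^ (n * sigma p) *
    (ρ ^ (n * sigma p) * ballVol μ z (ρ * τ) ^ (-sigma p)) with hc
  have hcx : ∀ x ∈ Metric.ball z (ρ * τ), (volPow μ τ (sigma p) x)⁻¹ ≤ c := by
    intro x hx
    have h1 : ballVol μ z (ρ * τ) ≤ D * (2 * ρ) ^ n * ballVol μ x τ :=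
      h.doubling.vol_le hτ (by linarith) (by
        have := Metric.mem_ball'.1 hx
        linarith)
    have hVx := h.doubling.vol_pos x hτ
    have h2 := Real.rpow_le_rpow hVz.le h1 hσ.le
    have h3 : (D * (2 * ρ) ^ n * ballVol μ x τ) ^ sigma p
        = D ^ sigma p * 2 ^ (n * sigma p) * ρ ^ (n * sigma p) * volPow μ τ (sigma p) x := by
      rw [Real.mul_rpow (by positivity) hVx.le, Real.mul_rpow (by positivity) (by positivity),
        ← Real.rpow_mul (by positivity), Real.mul_rpow (by norm_num) hρ0.le, ← mul_assoc]
      rfl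
    rw [h3] at h2
    rw [inv_le_iff_one_le_mul₀ (hpos x), hc, Real.rpow_neg hVz.le]
    have h4 : 0 < ballVol μ z (ρ * τ) ^ sigma p := Real.rpow_pos_of_pos hVz _
    have h5 := (one_le_div h4).2 h2
    refine h5.trans_eq ?_
    field_simp
  -- The restriction estimate is applied to g = V_τ^{-σ} f, so that V_τ^σ g = f. Doubling bounds
  -- V_τ^{-σ} by the number c on the ball.
  set g : X → ℂ := fun x => ((volPow μ τ (sigma p) x)⁻¹ : ℂ) * f x with hg
  have hbound : ∀ᵐ x ∂μ, ‖g x‖ ≤ c * ‖f x‖ := by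
    filter_upwards [hf] with x hx
    by_cases hxb : x ∈ Metric.ball z (ρ * τ)
    · rw [hg]
      simp only
      rw [norm_mul, norm_inv, Complex.norm_real, Real.norm_of_nonneg (hpos x).le]
      gcongr
      exact hcx x hxb
    · simp [hg, hx hxb]
  have hgm : AEStronglyMeasurable g μ := by
    have : Measurable fun x => ((volPow μ τ (sigma p) x)⁻¹ : ℂ) :=
      (Complex.measurable_ofReal.comp (h.doubling.measurable_volPow τ (sigma p))).inv
    exact this.aestronglyMeasurable.mul (Lp.aestronglyMeasurable f)
  have hgle : eLpNorm g p μ ≤ ENNReal.ofReal c * eLpNorm f p μ :=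
    eLpNorm_le_mul_eLpNorm_of_ae_le_mul hbound p
  have hfp := h.eLpNorm_lt_top_of_ball z f hf
  have hgp : MemLp g p μ :=
    ⟨hgm, hgle.trans_lt (ENNReal.mul_lt_top ENNReal.ofReal_lt_top hfp)⟩
  have hVg : (fun x => (volPow μ τ (sigma p) x : ℂ) * g x) = f := by
    ext x
    have : (volPow μ τ (sigma p) x : ℂ) ≠ 0 := Complex.ofReal_ne_zero.2 (hpos x).ne'
    simp only [hg]
    field_simp
  have hVgm : MemLp (fun x => (volPow μ τ (sigma p) x : ℂ) * g x) 2 μ := by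
    rw [hVg]; exact Lp.memLp f
  have h1 := hT g hgp hVgm
  have h2 : hVgm.toLp _ = f := by
    apply Lp.ext
    refine hVgm.coeFn_toLp.trans ?_
    rw [hVg]
  rw [h2] at h1
  refine h1.trans ((mul_le_mul_right hgle _).trans_eq ?_)
  rw [← mul_assoc, ← ENNReal.ofReal_mul hα, hc]
  congr 2
  ring

/-- The constant in `BlockData.eLpNorm_calculus_le`. -/
def calcConst (p : ℝ≥0∞) (n D a C k : ℝ) : ℝ :=
  locConst p n D k * (D ^ sigma p * 2 ^ (n * sigma p) +
    2 * Real.exp (commConst p n D a C k) * dataConst p n D a C k)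

/-- The `L^p` norm of `G(A) A` for a function `G` that satisfies a restriction estimate and has a
weighted integrable Fourier transform. -/
theorem eLpNorm_calculus_le {k ρ α β : ℝ} (hk : 1 ≤ k) (hkn : n / 2 < k) (hka : k < a)
    (hρ : 1 ≤ ρ) (hα : 0 ≤ α) (G : 𝓢(ℝ, ℂ))
    (hG : ∀ f : X → ℂ, MemLp f p μ →
      ∀ hf : MemLp (fun z => (volPow μ τ (sigma p) z : ℂ) * f z) 2 μ,
        ‖borelCalculus A G (A (hf.toLp _))‖ₑ ≤ ENNReal.ofReal α * eLpNorm f p μ)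
    (hi : Integrable fun ξ : ℝ => ‖(𝓕 G) ξ‖ * (1 + |2 * Real.pi * ξ|) ^ k)
    (hβ : ∫ ξ : ℝ, ‖(𝓕 G) ξ‖ * (1 + |2 * Real.pi * ξ|) ^ k ≤ β) (f : Lp ℂ 2 μ) :
    eLpNorm (borelCalculus A G (A f)) p μ ≤
      ENNReal.ofReal (calcConst p n D a C k * (ρ ^ (n * sigma p) * (α + ρ ^ (-k) * β)))
        * eLpNorm f p μ := by
  have hD := h.doubling.one_le
  have hρ0 : 0 < ρ := by linarith
  have hβ0 : 0 ≤ β := le_trans (integral_nonneg fun ξ => by positivity) hβ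
  have hc := h.commConst_pos hk hka
  have hd := h.dataConst_pos hka
  have hl := locConst_pos (p := p) h.doubling hkn
  have hσ := h.sigma_pos
  have H1 := h.enorm_apply_le_of_restriction hρ hα (T := borelCalculus A G ∘L A) hG
  have H2 : ∀ (z : X) (f : Lp ℂ 2 μ), (∀ᵐ x ∂μ, x ∉ Metric.ball z (ρ * τ) → f x = 0) →
      ∀ w : S → ℝ, IsWeight τ ρ z w →
        ‖h.partition.stepOp μ (fun i => w i ^ k) ((borelCalculus A G ∘L A) f)‖ₑ ≤
        ENNReal.ofReal (2 * Real.exp (commConst p n D a C k) * β * dataConst p n D a C k *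
          (ρ ^ (n * sigma p) * ballVol μ z (ρ * τ) ^ (-sigma p))) * eLpNorm f p μ := by
    intro z f hf w hw
    have hcount := h.countable
    have hwkb : ∃ N, ∀ i, |w i ^ k| ≤ N := by
      obtain ⟨N, hN⟩ := hw.bounded
      refine ⟨N ^ k, fun i => ?_⟩
      have := hw.one_le i
      rw [abs_of_pos (Real.rpow_pos_of_pos (by linarith) _)]
      exact Real.rpow_le_rpow (by linarith) (hN i) (by linarith)
    have hM : ∀ u : Lp ℂ 2 μ, ‖u‖ ≤ ‖h.partition.stepOp μ (fun i => w i ^ k) u‖ := by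
      intro u
      refine Lp.norm_le_norm_of_ae_le ?_
      filter_upwards [mulOp_ae (h.partition.isBddMeasurable hwkb) u] with x hx
      rw [IsMeasurablePartition.stepOp, hx, norm_mul, Complex.norm_real]
      refine le_mul_of_one_le_left (norm_nonneg _) ?_
      exact (Real.one_le_rpow (hw.one_le _) (by linarith)).trans (Real.le_norm_self _)
    -- The factor A alone supplies the passage from L^p to weighted L²; after it, G(A) only has to
    -- be bounded on weighted L².
    have h1 := norm_weight_borelCalculus_le h.selfAdjoint hc (by linarith)
      (fun L hL u => h.norm_commutator_le hk hka hw.one_le hw.bounded hw.lipschitz hL u) hM G hi hβ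
      (A f)
    have h2 := h.enorm_weight_apply_le hk hka hρ hw.one_le hw.bounded hw.le_max f hf
    have h3 : ‖h.partition.stepOp μ (fun i => w i ^ k) (borelCalculus A G (A f))‖ₑ ≤
        ENNReal.ofReal (2 * Real.exp (commConst p n D a C k) * β) *
          ‖h.partition.stepOp μ (fun i => w i ^ k) (A f)‖ₑ := by
      rw [← ofReal_norm, ← ofReal_norm, ← ENNReal.ofReal_mul (by positivity)]
      exact ENNReal.ofReal_le_ofReal h1
    refine h3.trans ((mul_le_mul_right h2 _).trans_eq ?_)
    rw [← mul_assoc, ← ENNReal.ofReal_mul (by positivity)]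
    congr 2
    ring
  have h1 := h.eLpNorm_apply_le hk hkn hρ (by positivity) (by positivity)
    (borelCalculus A G ∘L A) H1 H2 f
  refine h1.trans (mul_le_mul_left (ENNReal.ofReal_le_ofReal ?_) _)
  rw [calcConst, mul_assoc (locConst p n D k)]
  refine mul_le_mul_of_nonneg_left ?_ hl.le
  have e1 : 0 ≤ ρ ^ (n * sigma p) *
      (α * (2 * Real.exp (commConst p n D a C k) * dataConst p n D a C k)) := by
    positivity
  have e2 : 0 ≤ ρ ^ (n * sigma p) * (ρ ^ (-k) * β * (D ^ sigma p * 2 ^ (n * sigma p))) := by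
    positivity
  linear_combination e1 + e2

end BlockData

end LocalMultiplier

end SpectralMultiplier
end

noncomputable section

namespace SpectralMultiplier

/-! ### Young's inequality and weighted L¹ bounds of Fourier transforms -/

section FourierEstimates

open scoped FourierTransform

/-- Young's inequality for a convolution with an integrable kernel. -/
theorem eLpNorm_le_of_enorm_le_lintegral {q : ℝ≥0∞} (hq : 1 ≤ q) {u g : ℝ → ℂ} {κ : ℝ → ℝ≥0∞}
    (hκ : Measurable κ) (hg : AEStronglyMeasurable g)
    (h : ∀ x, ‖u x‖ₑ ≤ ∫⁻ y, κ (y - x) * ‖g y‖ₑ) :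
    eLpNorm u q volume ≤ (∫⁻ y, κ y) * eLpNorm g q volume := by
  have hκx : ∀ x, ∫⁻ y, κ (y - x) = ∫⁻ y, κ y := fun x => lintegral_sub_right_eq_self κ x
  rcases eq_or_ne q ∞ with rfl | hqt
  · rw [eLpNorm_exponent_top, eLpNorm_exponent_top]
    refine eLpNormEssSup_le_of_ae_enorm_bound (Filter.Eventually.of_forall fun x => ?_)
    refine (h x).trans ?_
    rw [← hκx x, ← lintegral_mul_const _ (by fun_prop)]
    refine lintegral_mono_ae ?_
    filter_upwards [enorm_ae_le_eLpNormEssSup g volume] with y hy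
    gcongr
  have hq0 : q ≠ 0 := (zero_lt_one.trans_le hq).ne'
  have hq1 : 1 ≤ q.toReal := by
    rw [← ENNReal.toReal_one]
    exact ENNReal.toReal_mono hqt hq
  set P := q.toReal with hP
  have hP0 : 0 < P := by linarith
  rw [eLpNorm_eq_lintegral_rpow_enorm_toReal hq0 hqt, eLpNorm_eq_lintegral_rpow_enorm_toReal hq0 hqt,
    ← hP]
  have hgm : AEMeasurable (fun y => ‖g y‖ₑ ^ P) := hg.enorm.pow_const P
  have h1 : ∫⁻ x, ‖u x‖ₑ ^ P ≤ (∫⁻ y, κ y) ^ P * ∫⁻ y, ‖g y‖ₑ ^ P := by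
    calc ∫⁻ x, ‖u x‖ₑ ^ P
        ≤ ∫⁻ x, (∫⁻ y, κ y) ^ (P - 1) * ∫⁻ y, κ (y - x) * ‖g y‖ₑ ^ P := by
          refine lintegral_mono fun x => ?_
          refine (ENNReal.rpow_le_rpow (h x) hP0.le).trans ?_
          refine (ENNReal_rpow_lintegral_mul_le (by fun_prop) hg.enorm hq1).trans_eq ?_
          rw [hκx]
      _ = (∫⁻ y, κ y) ^ (P - 1) * ∫⁻ y, ∫⁻ x, κ (y - x) * ‖g y‖ₑ ^ P := by
          have hm : AEMeasurable (fun z : ℝ × ℝ => κ (z.2 - z.1) * ‖g z.2‖ₑ ^ P)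
              ((volume : Measure ℝ).prod volume) :=
            (hκ.comp (measurable_snd.sub measurable_fst)).aemeasurable.mul
              (hgm.comp_quasiMeasurePreserving Measure.quasiMeasurePreserving_snd)
          rw [lintegral_const_mul'' _ hm.lintegral_prod_right', lintegral_lintegral_swap hm]
      _ = (∫⁻ y, κ y) ^ (P - 1) * ((∫⁻ y, κ y) * ∫⁻ y, ‖g y‖ₑ ^ P) := by
          congr 1
          rw [← lintegral_const_mul'' _ hgm]
          refine lintegral_congr fun y => ?_
          rw [lintegral_mul_const _ (by fun_prop), lintegral_sub_left_eq_self κ y]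
      _ = _ := by
          rw [← mul_assoc]
          congr 1
          conv_lhs => rw [← ENNReal.rpow_one (∫⁻ y, κ y), ← ENNReal.rpow_mul,
            ← ENNReal.rpow_add_of_nonneg _ _ (by linarith) (by norm_num)]
          congr 1
          ring
  refine (ENNReal.rpow_le_rpow h1 (by positivity)).trans_eq ?_
  rw [ENNReal.mul_rpow_of_nonneg _ _ (by positivity), ← ENNReal.rpow_mul,
    mul_one_div_cancel hP0.ne', ENNReal.rpow_one]

/-- The derivative on Schwartz functions on the line. -/
abbrev schwartzDeriv : 𝓢(ℝ, ℂ) →L[ℂ] 𝓢(ℝ, ℂ) := SchwartzMap.derivCLM ℂ ℂ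

theorem fourier_schwartzDeriv (u : 𝓢(ℝ, ℂ)) (ξ : ℝ) :
    𝓕 (schwartzDeriv u) ξ = (2 * Real.pi * Complex.I * ξ) * 𝓕 u ξ := by
  have h := Real.fourier_deriv (u.integrable (μ := volume)) u.differentiable
    ((schwartzDeriv u).integrable (μ := volume))
  exact congrFun h ξ

theorem fourier_schwartzDeriv_iterate (u : 𝓢(ℝ, ℂ)) (m : ℕ) (ξ : ℝ) :
    𝓕 (schwartzDeriv^[m] u) ξ = (2 * Real.pi * Complex.I * ξ) ^ m * 𝓕 u ξ := by
  induction m generalizing u with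
  | zero => simp
  | succ m ih =>
    rw [Function.iterate_succ_apply, ih, fourier_schwartzDeriv]
    ring

/-- The constant in the weighted estimate of a Fourier transform. -/
def weightConst (k : ℝ) (m : ℕ) : ℝ :=
  1 + 4 ^ m * ∫ x : ℝ, (1 + ‖x‖) ^ (-(2 * m - 2 * k))

theorem weightConst_pos (k : ℝ) (m : ℕ) : 0 < weightConst k m := by
  have : 0 ≤ ∫ x : ℝ, (1 + ‖x‖) ^ (-(2 * m - 2 * k)) := integral_nonneg fun x => by positivity
  unfold weightConst
  positivity

/-- A weighted `L¹` bound for the Fourier transform in terms of derivatives. -/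
theorem integral_norm_fourier_mul_weight_le {k R B : ℝ} {m : ℕ} (hk : 0 ≤ k)
    (hm : 2 * k + 1 < 2 * m) (hR : 0 < R) (hRk : 1 ≤ R ∨ k = 0) (hB : 0 < B) (u : 𝓢(ℝ, ℂ))
    (h0 : ∫ x, ‖u x‖ ^ 2 ≤ B ^ 2) (h1 : ∫ x, ‖(schwartzDeriv^[m] u) x‖ ^ 2 ≤ (B * R ^ m) ^ 2) :
    (Integrable fun ξ : ℝ => ‖(𝓕 u) ξ‖ * (1 + |2 * Real.pi * ξ|) ^ k) ∧
      ∫ ξ : ℝ, ‖(𝓕 u) ξ‖ * (1 + |2 * Real.pi * ξ|) ^ k ≤ weightConst k m * R ^ (k + 1 / 2) * B := by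
  have hpi := Real.pi_pos
  set J := ∫ x : ℝ, (1 + ‖x‖) ^ (-(2 * m - 2 * k)) with hJ
  have hJ0 : 0 ≤ J := integral_nonneg fun x => by positivity
  have hJi : Integrable fun x : ℝ => (1 + ‖x‖) ^ (-(2 * m - 2 * k)) :=
    integrable_one_add_norm (by simp; linarith)
  set c := 2 * Real.pi / R with hc
  have hc0 : 0 < c := by positivity
  have hJi' : Integrable fun ξ : ℝ => (1 + ‖c * ξ‖) ^ (-(2 * m - 2 * k)) :=
    hJi.comp_mul_left' hc0.ne'
  have hJc : ∫ ξ : ℝ, (1 + ‖c * ξ‖) ^ (-(2 * m - 2 * k)) ≤ R * J := by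
    rw [Measure.integral_comp_mul_left (fun x : ℝ => (1 + ‖x‖) ^ (-(2 * m - 2 * k))) c, smul_eq_mul,
      abs_of_pos (inv_pos.2 hc0), hc, inv_div]
    gcongr
    rw [div_le_iff₀ (by positivity)]
    nlinarith [Real.two_le_pi]
  have hsq : ∀ v : 𝓢(ℝ, ℂ), Integrable fun ξ => ‖𝓕 v ξ‖ ^ 2 := fun v =>
    ((𝓕 v).memLp 2).integrable_norm_pow (by norm_num)
  have hsum : Integrable fun ξ => ‖𝓕 u ξ‖ ^ 2 + (R ^ m)⁻¹ ^ 2 * ‖𝓕 (schwartzDeriv^[m] u) ξ‖ ^ 2 :=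
    (hsq u).add ((hsq _).const_mul _)
  have hsumle : ∫ ξ, (‖𝓕 u ξ‖ ^ 2 + (R ^ m)⁻¹ ^ 2 * ‖𝓕 (schwartzDeriv^[m] u) ξ‖ ^ 2)
      ≤ 2 * B ^ 2 := by
    rw [integral_add (hsq u) ((hsq _).const_mul _), integral_const_mul,
      SchwartzMap.integral_norm_sq_fourier, SchwartzMap.integral_norm_sq_fourier]
    have : (R ^ m)⁻¹ ^ 2 * ∫ x, ‖(schwartzDeriv^[m] u) x‖ ^ 2 ≤ (R ^ m)⁻¹ ^ 2 * (B * R ^ m) ^ 2 := by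
      gcongr
    have e : (R ^ m)⁻¹ ^ 2 * (B * R ^ m) ^ 2 = B ^ 2 := by
      field_simp
    linarith
  -- Cauchy–Schwarz in pointwise form: 2xy ≤ l x² + y²/l yields an integrable majorant, hence
  -- integrability and the bound together. This l makes both integrals of order R^{k+1/2} B.
  set l := R ^ (k + 1 / 2) / B with hl
  have hl0 : 0 < l := by positivity
  set Φ : ℝ → ℝ := fun ξ => (l * (‖𝓕 u ξ‖ ^ 2 + (R ^ m)⁻¹ ^ 2 * ‖𝓕 (schwartzDeriv^[m] u) ξ‖ ^ 2)
      + l⁻¹ * R ^ (2 * k) * 4 ^ m * (1 + ‖c * ξ‖) ^ (-(2 * m - 2 * k))) / 2 with hΦ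
  have hΦi : Integrable Φ := ((hsum.const_mul l).add (hJi'.const_mul _)).div_const 2
  have hpoint : ∀ ξ, ‖(𝓕 u) ξ‖ * (1 + |2 * Real.pi * ξ|) ^ k ≤ Φ ξ := by
    intro ξ
    set t := ‖c * ξ‖ with ht
    have ht0 : 0 ≤ t := norm_nonneg _
    have htR : |2 * Real.pi * ξ| = R * t := by
      rw [ht, hc, Real.norm_eq_abs, div_mul_eq_mul_div, abs_div, abs_of_pos hR]
      field_simp
    have hw : (1 + |2 * Real.pi * ξ|) ^ k ≤ R ^ k * (1 + t) ^ k := by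
      -- Scales below one occur only for the Fourier transform of the cut-off Bessel symbol, where
      -- there is no weight.
      rcases hRk with hR1 | rfl
      · rw [← Real.mul_rpow hR.le (by positivity), htR]
        refine Real.rpow_le_rpow (by positivity) ?_ hk
        nlinarith
      · simp
    have hD : ‖𝓕 (schwartzDeriv^[m] u) ξ‖ = (R * t) ^ m * ‖𝓕 u ξ‖ := by
      rw [fourier_schwartzDeriv_iterate, norm_mul, norm_pow, ← htR]
      simp [abs_mul]
    have hone : (1 + t) ^ (2 * m) ≤ 4 ^ m * (1 + t ^ (2 * m)) := by
      calc (1 + t) ^ (2 * m) ≤ 2 ^ (2 * m - 1) * (1 ^ (2 * m) + t ^ (2 * m)) :=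
            add_pow_le zero_le_one ht0 _
        _ ≤ 4 ^ m * (1 + t ^ (2 * m)) := by
            rw [one_pow, show (4 : ℝ) = 2 ^ 2 by norm_num, ← pow_mul]
            gcongr
            · norm_num
            · omega
    set N := ‖𝓕 u ξ‖ with hN
    have hN0 : 0 ≤ N := norm_nonneg _
    have hΦξ : Φ ξ = (l * (N ^ 2 * (1 + t ^ (2 * m)))
        + l⁻¹ * R ^ (2 * k) * 4 ^ m * (1 + t) ^ (-(2 * m - 2 * k))) / 2 := by
      rw [hΦ]
      simp only [hD]
      congr 3
      field_simp
      ring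
    have e1 : (1 + t) ^ (-(2 * m - 2 * k)) = ((1 + t) ^ k) ^ 2 / (1 + t) ^ (2 * m) := by
      rw [show -(2 * (m : ℝ) - 2 * k) = k * 2 - (2 * m : ℕ) by push_cast; ring,
        Real.rpow_sub (by positivity), Real.rpow_natCast, Real.rpow_mul (by positivity)]
      norm_num
    have e2 : R ^ (2 * k) = (R ^ k) ^ 2 := by
      rw [mul_comm, Real.rpow_mul hR.le]
      norm_num
    have e3 : ((1 + t) ^ k) ^ 2 / (1 + t ^ (2 * m)) ≤ 4 ^ m * (1 + t) ^ (-(2 * m - 2 * k)) := by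
      rw [e1, ← mul_div_assoc, div_le_div_iff₀ (by positivity) (by positivity)]
      calc ((1 + t) ^ k) ^ 2 * (1 + t) ^ (2 * m)
          ≤ ((1 + t) ^ k) ^ 2 * (4 ^ m * (1 + t ^ (2 * m))) := by gcongr
        _ = _ := by ring
    refine (mul_le_mul_of_nonneg_left hw hN0).trans ?_
    rw [hΦξ, e2]
    have e4 : l⁻¹ * (R ^ k) ^ 2 * (((1 + t) ^ k) ^ 2 / (1 + t ^ (2 * m))) ≤
        l⁻¹ * (R ^ k) ^ 2 * (4 ^ m * (1 + t) ^ (-(2 * m - 2 * k))) := by gcongr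
    have e5 : 2 * (N * (R ^ k * (1 + t) ^ k)) ≤ l * (N ^ 2 * (1 + t ^ (2 * m))) +
        l⁻¹ * (R ^ k) ^ 2 * (((1 + t) ^ k) ^ 2 / (1 + t ^ (2 * m))) := by
      have hT : 0 < 1 + t ^ (2 * m) := by positivity
      set T := 1 + t ^ (2 * m)
      set U := R ^ k * (1 + t) ^ k with hU
      have : l * (N ^ 2 * T) + l⁻¹ * (R ^ k) ^ 2 * (((1 + t) ^ k) ^ 2 / T) - 2 * (N * U)
          = (l * N * T - U) ^ 2 / (l * T) := by
        rw [hU]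
        field_simp
        ring
      have h2 : 0 ≤ (l * N * T - U) ^ 2 / (l * T) := by positivity
      linarith
    linarith
  have hi : Integrable fun ξ : ℝ => ‖(𝓕 u) ξ‖ * (1 + |2 * Real.pi * ξ|) ^ k := by
    refine hΦi.mono' ?_ (Filter.Eventually.of_forall fun ξ => ?_)
    · refine Continuous.aestronglyMeasurable ?_
      refine (𝓕 u).continuous.norm.mul ?_
      exact Continuous.rpow_const (by fun_prop) fun ξ => Or.inl (by positivity)
    · rw [Real.norm_of_nonneg (by positivity)]
      exact hpoint ξ
  refine ⟨hi, (integral_mono hi hΦi hpoint).trans ?_⟩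
  rw [hΦ, integral_div, integral_add (hsum.const_mul l) (hJi'.const_mul _), integral_const_mul,
    integral_const_mul]
  have e1 : l * ∫ ξ, (‖𝓕 u ξ‖ ^ 2 + (R ^ m)⁻¹ ^ 2 * ‖𝓕 (schwartzDeriv^[m] u) ξ‖ ^ 2)
      ≤ l * (2 * B ^ 2) := by gcongr
  have e2 : l⁻¹ * R ^ (2 * k) * 4 ^ m * ∫ ξ : ℝ, (1 + ‖c * ξ‖) ^ (-(2 * m - 2 * k))
      ≤ l⁻¹ * R ^ (2 * k) * 4 ^ m * (R * J) := by gcongr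
  have e3 : R ^ (2 * k) * R = R ^ (k + 1 / 2) * R ^ (k + 1 / 2) := by
    rw [← Real.rpow_add hR, ← Real.rpow_add_one hR.ne']
    congr 1; ring
  have e4 : l⁻¹ * R ^ (2 * k) * 4 ^ m * (R * J) = R ^ (k + 1 / 2) * B * 4 ^ m * J := by
    calc l⁻¹ * R ^ (2 * k) * 4 ^ m * (R * J) = l⁻¹ * (R ^ (2 * k) * R) * 4 ^ m * J := by ring
      _ = _ := by
        rw [e3, hl]
        field_simp
  have e5 : l * (2 * B ^ 2) = 2 * (R ^ (k + 1 / 2) * B) := by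
    rw [hl]; field_simp
  have e6 : 0 ≤ R ^ (k + 1 / 2) * B * 4 ^ m * J := by positivity
  rw [weightConst, ← hJ]
  linarith

end FourierEstimates

end SpectralMultiplier
end

noncomputable section

namespace SpectralMultiplier

/-! ### The Bessel symbol cut off to a dyadic frequency -/

section BesselSymbol

open scoped FourierTransform ContDiff

theorem integral_norm_sq_le_of_bound {f : ℝ → ℂ} {M L : ℝ} (hL : 0 ≤ L)
    (hf : ∀ x, ‖f x‖ ≤ M) (hs : ∀ x, L < |x| → f x = 0) : ∫ x, ‖f x‖ ^ 2 ≤ M ^ 2 * (2 * L) := by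
  have h1 : ∀ x, ‖f x‖ ^ 2 ≤ (Set.Icc (-L) L).indicator (fun _ => M ^ 2) x := by
    intro x
    by_cases hx : x ∈ Set.Icc (-L) L
    · rw [Set.indicator_of_mem hx]
      exact pow_le_pow_left₀ (norm_nonneg _) (hf x) 2
    · rw [Set.indicator_of_notMem hx, hs x, norm_zero]
      · norm_num
      · by_contra hc
        exact hx (abs_le.1 (not_lt.1 hc))
  refine (integral_mono_of_nonneg (Filter.Eventually.of_forall fun x => by positivity) ?_
    (Filter.Eventually.of_forall h1)).trans_eq ?_
  · exact (integrable_indicator_iff measurableSet_Icc).2 (integrableOn_const (by simp))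
  · rw [integral_indicator measurableSet_Icc, setIntegral_const, Measure.real, Real.volume_Icc,
      ENNReal.toReal_ofReal (by linarith), smul_eq_mul]
    ring

theorem norm_besselSymbol_le {s R ξ : ℝ} (hs : 0 ≤ s) (hR : 1 ≤ R)
    (h : R ^ 2 ≤ 1 + (2 * Real.pi * ξ) ^ 2) : ‖besselSymbol (-s) ξ‖ ≤ R ^ (-s) := by
  have hR0 : 0 < R := by linarith
  rw [besselSymbol, Complex.norm_real, Real.norm_of_nonneg (by positivity)]
  calc (1 + (2 * Real.pi * ξ) ^ 2) ^ (-s / 2) ≤ (R ^ 2) ^ (-s / 2) :=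
        Real.rpow_le_rpow_of_nonpos (by positivity) h (by linarith)
    _ = R ^ (-s) := by
        rw [← Real.rpow_natCast, ← Real.rpow_mul hR0.le]
        congr 1; push_cast; ring

theorem hasDerivAt_besselSymbol (s ξ : ℝ) : HasDerivAt (besselSymbol s)
    (((s / 2 * (1 + (2 * Real.pi * ξ) ^ 2) ^ (s / 2 - 1) *
      (2 * (2 * Real.pi * ξ) * (2 * Real.pi)) : ℝ)) : ℂ) ξ := by
  have h1 : HasDerivAt (fun x : ℝ => 1 + (2 * Real.pi * x) ^ 2)
      (2 * (2 * Real.pi * ξ) * (2 * Real.pi)) ξ := by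
    have := (((hasDerivAt_id ξ).const_mul (2 * Real.pi)).pow 2).const_add 1
    simpa using this
  have h2 := h1.rpow_const (p := s / 2) (Or.inl (by positivity))
  exact h2.ofReal_comp.congr_deriv (by congr 1; ring)

theorem norm_deriv_besselSymbol_le {s R ξ : ℝ} (hs : 0 ≤ s) (hR : 1 ≤ R)
    (h : R ^ 2 ≤ 1 + (2 * Real.pi * ξ) ^ 2) :
    ‖deriv (besselSymbol (-s)) ξ‖ ≤ 2 * Real.pi * s * (R ^ (-s) * R⁻¹) := by
  have hR0 : 0 < R := by linarith
  have hpi := Real.pi_pos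
  set t := 2 * Real.pi * ξ with ht
  have h0 : 0 < 1 + t ^ 2 := by positivity
  rw [(hasDerivAt_besselSymbol (-s) ξ).deriv, Complex.norm_real, Real.norm_eq_abs, ← ht]
  have h1 : |t| ≤ (1 + t ^ 2) ^ (1 / 2 : ℝ) := by
    rw [← Real.sqrt_eq_rpow]
    exact Real.abs_le_sqrt (by linarith)
  have h2 : (1 + t ^ 2) ^ (-s / 2 - 1) * (1 + t ^ 2) ^ (1 / 2 : ℝ) ≤ R ^ (-s) * R⁻¹ := by
    rw [← Real.rpow_add h0]
    calc (1 + t ^ 2) ^ (-s / 2 - 1 + 1 / 2) ≤ (R ^ 2) ^ (-s / 2 - 1 + 1 / 2) :=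
          Real.rpow_le_rpow_of_nonpos (by positivity) h (by linarith)
      _ = R ^ (-s) * R⁻¹ := by
          rw [← Real.rpow_natCast, ← Real.rpow_mul hR0.le, ← Real.rpow_neg_one, ← Real.rpow_add hR0]
          congr 1; push_cast; ring
  have e : |-s / 2 * (1 + t ^ 2) ^ (-s / 2 - 1) * (2 * t * (2 * Real.pi))|
      = 2 * Real.pi * s * ((1 + t ^ 2) ^ (-s / 2 - 1) * |t|) := by
    rw [abs_mul, abs_mul, abs_mul, abs_mul, abs_div, abs_neg, abs_of_nonneg hs,
      abs_of_pos (Real.rpow_pos_of_pos h0 _), abs_of_pos (by positivity : 0 < 2 * Real.pi)]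
    norm_num
    ring
  rw [e]
  have : (1 + t ^ 2) ^ (-s / 2 - 1) * |t| ≤ R ^ (-s) * R⁻¹ := by
    refine le_trans ?_ h2
    gcongr
  gcongr

/-- On the support of the cutoff 1 + (2πξ)² ≥ R², so the symbol is at most R^{-s} and a derivative
gains R^{-1}. The support condition is void for R = 1, which lets the same statement serve the
lowest frequency. -/
theorem exists_bound_cutoff_besselSymbol {χ : ℝ → ℂ} (hχ : ContDiff ℝ ∞ χ)
    (hχc : HasCompactSupport χ) {s : ℝ} (hs : 0 ≤ s) : ∃ K L : ℝ, 0 < K ∧ 0 < L ∧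
      ∀ R : ℝ, 1 ≤ R → (∀ η ∈ tsupport χ, R ^ 2 ≤ 1 + (2 * Real.pi * (R * η)) ^ 2) →
      ∀ f : ℝ → ℂ, (∀ ξ, f ξ = χ (R⁻¹ * ξ) * besselSymbol (-s) ξ) →
        (∀ ξ, ‖f ξ‖ ≤ K * R ^ (-s)) ∧ (∀ ξ, ‖deriv f ξ‖ ≤ K * R ^ (-s) * R⁻¹) ∧
        (∀ ξ, R * L < |ξ| → f ξ = 0) ∧ ∀ ξ, R * L < |ξ| → deriv f ξ = 0 := by
  have hpi := Real.pi_pos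
  obtain ⟨M0, hM0⟩ := hχc.exists_bound_of_continuous hχ.continuous
  obtain ⟨M1, hM1⟩ := hχc.deriv.exists_bound_of_continuous (hχ.continuous_deriv (by simp))
  obtain ⟨L, hL⟩ := hχc.isBounded.exists_norm_le
  have hM00 : 0 ≤ M0 := (norm_nonneg _).trans (hM0 0)
  have hM10 : 0 ≤ M1 := (norm_nonneg _).trans (hM1 0)
  set K := M0 + M1 + 2 * Real.pi * s * M0 + 1 with hK
  set L' := |L| + 1 with hL'
  have hK0 : 0 < K := by positivity
  have hL0 : 0 < L' := by positivity
  refine ⟨K, L', hK0, hL0, fun R hR hsupp f hf => ?_⟩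
  have hR0 : 0 < R := by linarith
  have hzero : ∀ ξ, R⁻¹ * ξ ∉ tsupport χ → χ (R⁻¹ * ξ) = 0 := fun ξ hξ =>
    image_eq_zero_of_notMem_tsupport hξ
  have hzero' : ∀ ξ, R⁻¹ * ξ ∉ tsupport χ → deriv χ (R⁻¹ * ξ) = 0 := fun ξ hξ =>
    image_eq_zero_of_notMem_tsupport fun h => hξ (tsupport_deriv_subset (𝕜 := ℝ) h)
  have hsupp' : ∀ ξ, R⁻¹ * ξ ∈ tsupport χ → R ^ 2 ≤ 1 + (2 * Real.pi * ξ) ^ 2 := fun ξ hξ => by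
    have := hsupp _ hξ
    rwa [mul_inv_cancel_left₀ hR0.ne'] at this
  have hout : ∀ ξ, R * L' < |ξ| → R⁻¹ * ξ ∉ tsupport χ := fun ξ hξ h => by
    have h1 := hL _ h
    rw [Real.norm_eq_abs, abs_mul, abs_of_pos (inv_pos.2 hR0), inv_mul_le_iff₀ hR0] at h1
    have h2 : R * L ≤ R * |L| := by gcongr; exact le_abs_self L
    rw [hL', mul_add, mul_one] at hξ
    linarith
  have hfb : ∀ ξ, ‖f ξ‖ ≤ K * R ^ (-s) := by
    intro ξ
    by_cases hξ : R⁻¹ * ξ ∈ tsupport χ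
    · rw [hf, norm_mul]
      have h1 := norm_besselSymbol_le hs hR (hsupp' ξ hξ)
      have h2 : ‖χ (R⁻¹ * ξ)‖ ≤ K := (hM0 _).trans (by
        have : 0 ≤ 2 * Real.pi * s * M0 := by positivity
        linarith)
      gcongr
    · rw [hf, hzero ξ hξ, zero_mul, norm_zero]
      positivity
  have hderiv : ∀ ξ, deriv f ξ = deriv χ (R⁻¹ * ξ) * R⁻¹ * besselSymbol (-s) ξ +
      χ (R⁻¹ * ξ) * deriv (besselSymbol (-s)) ξ := by
    intro ξ
    have h1 : HasDerivAt (fun ξ : ℝ => R⁻¹ * ξ) R⁻¹ ξ := by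
      simpa using (hasDerivAt_id ξ).const_mul R⁻¹
    have h2 : HasDerivAt χ (deriv χ (R⁻¹ * ξ)) (R⁻¹ * ξ) :=
      (hχ.differentiable (by simp) _).hasDerivAt
    have h3 := h2.scomp ξ h1
    have h4 := h3.mul (hasDerivAt_besselSymbol (-s) ξ)
    rw [(hasDerivAt_besselSymbol (-s) ξ).deriv]
    rw [show f = fun ξ => χ (R⁻¹ * ξ) * besselSymbol (-s) ξ from funext hf]
    refine h4.deriv.trans ?_
    simp [mul_comm]
  have hfb' : ∀ ξ, ‖deriv f ξ‖ ≤ K * R ^ (-s) * R⁻¹ := by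
    intro ξ
    rw [hderiv]
    by_cases hξ : R⁻¹ * ξ ∈ tsupport χ
    · have h1 := norm_besselSymbol_le hs hR (hsupp' ξ hξ)
      have h2 := norm_deriv_besselSymbol_le hs hR (hsupp' ξ hξ)
      refine (norm_add_le _ _).trans ?_
      have e1 : ‖deriv χ (R⁻¹ * ξ) * R⁻¹ * besselSymbol (-s) ξ‖ ≤ M1 * R⁻¹ * R ^ (-s) := by
        rw [norm_mul, norm_mul, Complex.norm_real, Real.norm_of_nonneg (inv_pos.2 hR0).le]
        have := hM1 (R⁻¹ * ξ)
        gcongr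
      have e2 : ‖χ (R⁻¹ * ξ) * deriv (besselSymbol (-s)) ξ‖ ≤
          M0 * (2 * Real.pi * s * (R ^ (-s) * R⁻¹)) := by
        rw [norm_mul]
        have := hM0 (R⁻¹ * ξ)
        gcongr
      have e3 : 0 ≤ (M0 + 1) * (R ^ (-s) * R⁻¹) := by positivity
      rw [hK]
      linear_combination e1 + e2 + e3
    · rw [hzero ξ hξ, hzero' ξ hξ]
      simp only [zero_mul, add_zero, norm_zero]
      positivity
  refine ⟨hfb, hfb', fun x hx => ?_, fun x hx => ?_⟩
  · rw [hf, hzero x (hout x hx), zero_mul]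
  · rw [hderiv, hzero x (hout x hx), hzero' x (hout x hx)]
    simp

/-- A frequency cutoff at the scale `R`, multiplied with the Bessel symbol. -/
theorem exists_cutoff_besselSymbol {χ : ℝ → ℂ} (hχ : ContDiff ℝ ∞ χ) (hχc : HasCompactSupport χ)
    {s : ℝ} (hs : 0 ≤ s) : ∃ C : ℝ, 0 < C ∧ ∀ R : ℝ, 1 ≤ R →
      (∀ η ∈ tsupport χ, R ^ 2 ≤ 1 + (2 * Real.pi * (R * η)) ^ 2) →
      ∃ m : 𝓢(ℝ, ℂ), (∀ ξ : ℝ, m ξ = χ (R⁻¹ * ξ) * besselSymbol (-s) ξ) ∧ HasCompactSupport (m : ℝ → ℂ) ∧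
        (∫⁻ x : ℝ, ‖(𝓕 m : 𝓢(ℝ, ℂ)) x‖ₑ) ≤ ENNReal.ofReal (C * R ^ (-s)) := by
  obtain ⟨K, L, hK0, hL0, hKL⟩ := exists_bound_cutoff_besselSymbol hχ hχc hs
  refine ⟨weightConst 0 1 * (K * (2 * L) ^ (1 / 2 : ℝ)),
    mul_pos (weightConst_pos 0 1) (by positivity), fun R hR hsupp => ?_⟩
  have hR0 : 0 < R := by linarith
  obtain ⟨hfb, hfb', hz, hz'⟩ := hKL R hR hsupp _ fun ξ => rfl
  set f : ℝ → ℂ := fun ξ => χ (R⁻¹ * ξ) * besselSymbol (-s) ξ with hf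
  have hfs : ContDiff ℝ ∞ f :=
    (hχ.comp (contDiff_const.mul contDiff_id)).mul (besselSymbol_hasTemperateGrowth (-s)).1
  have hfc : HasCompactSupport f :=
    (hχc.comp_homeomorph (Homeomorph.mulLeft₀ R⁻¹ (inv_pos.2 hR0).ne')).mul_right
  obtain ⟨m, hm⟩ : ∃ m : 𝓢(ℝ, ℂ), ⇑m = f := ⟨hfc.toSchwartzMap hfs, rfl⟩
  refine ⟨m, fun ξ => congrFun hm ξ, by rwa [hm], ?_⟩
  have h0 : ∫ x, ‖m x‖ ^ 2 ≤ (K * R ^ (-s)) ^ 2 * (2 * (R * L)) := by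
    rw [hm]
    exact integral_norm_sq_le_of_bound (L := R * L) (by positivity) hfb hz
  have h1 : ∫ x, ‖(schwartzDeriv^[1] m) x‖ ^ 2 ≤ (K * R ^ (-s) * R⁻¹) ^ 2 * (2 * (R * L)) := by
    have : ∀ x, (schwartzDeriv^[1] m) x = deriv f x := fun x => by rw [← hm]; rfl
    simp_rw [this]
    exact integral_norm_sq_le_of_bound (L := R * L) (by positivity) hfb' hz'
  -- Both m and R m' have L² norm at most B, of order R^{1/2-s}. The weighted bound at the scale
  -- R^{-1} contributes R^{-1/2}, and the L¹ norm of the kernel comes out as a multiple of R^{-s}.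
  set B := K * (2 * L) ^ (1 / 2 : ℝ) * (R ^ (-s) * R ^ (1 / 2 : ℝ)) with hBdef
  have hB : B ^ 2 = (K * R ^ (-s)) ^ 2 * (2 * (R * L)) := by
    rw [hBdef, mul_pow, mul_pow, mul_pow, ← Real.sqrt_eq_rpow, ← Real.sqrt_eq_rpow,
      Real.sq_sqrt (by positivity), Real.sq_sqrt hR0.le]
    ring
  have hB1 : (B * R⁻¹ ^ 1) ^ 2 = (K * R ^ (-s) * R⁻¹) ^ 2 * (2 * (R * L)) := by
    rw [mul_pow, hB]
    ring
  obtain ⟨hi, hle⟩ := integral_norm_fourier_mul_weight_le (k := 0) (R := R⁻¹) (m := 1) (B := B)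
    le_rfl (by norm_num) (inv_pos.2 hR0) (Or.inr rfl) (by positivity) m
    (h0.trans_eq hB.symm) (h1.trans_eq hB1.symm)
  simp only [Real.rpow_zero, mul_one] at hi hle
  rw [← ofReal_integral_norm_eq_lintegral_enorm ((𝓕 m).integrable (μ := volume))]
  refine ENNReal.ofReal_le_ofReal (hle.trans_eq ?_)
  have e : R⁻¹ ^ (0 + 1 / 2 : ℝ) * R ^ (1 / 2 : ℝ) = 1 := by
    rw [zero_add, ← Real.mul_rpow (by positivity) hR0.le, inv_mul_cancel₀ hR0.ne', Real.one_rpow]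
  rw [hBdef]
  linear_combination (weightConst 0 1 * K * (2 * L) ^ (1 / 2 : ℝ) * R ^ (-s)) * e

end BesselSymbol

end SpectralMultiplier
end

noncomputable section

namespace SpectralMultiplier

/-! ### Frequency pieces of a Sobolev function -/

section FrequencyPieces

open scoped FourierTransform ContDiff

theorem besselSymbol_mul_neg (s ξ : ℝ) : besselSymbol s ξ * besselSymbol (-s) ξ = 1 := by
  have h : 0 < 1 + (2 * Real.pi * ξ) ^ 2 := by positivity
  rw [besselSymbol, besselSymbol, ← Complex.ofReal_mul, ← Real.rpow_add h]
  simp [neg_div]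

/-- If `(1 - d²/dx²)^{s/2} F = g`, then a frequency piece of `F` is a convolution with `g`. -/
theorem enorm_le_lintegral_of_besselOp_eq {q : ℝ≥0∞} [Fact (1 ≤ q)] {s : ℝ} {F : ℝ → ℂ}
    (hFi : Integrable F) (hF : MemLp F q volume) {g : Lp ℂ q (volume : Measure ℝ)}
    (hg : besselOp s (hF.toLp F : 𝓢'(ℝ, ℂ)) = (g : 𝓢'(ℝ, ℂ))) {θ : ℝ → ℂ} {m u : 𝓢(ℝ, ℂ)}
    (hm : ∀ ξ, m ξ = θ ξ * besselSymbol (-s) ξ) (hmc : HasCompactSupport (m : ℝ → ℂ))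
    (hu : ∀ ξ, (𝓕 u) ξ = θ ξ * (𝓕 F) ξ) (x : ℝ) :
    ‖u x‖ₑ ≤ ∫⁻ y, ‖(𝓕 m : 𝓢(ℝ, ℂ)) (y - x)‖ₑ * ‖g y‖ₑ := by
  set e : ℝ → ℂ := fun ξ => Complex.exp ((2 * Real.pi * (ξ * x) : ℝ) * Complex.I) with he
  have hes : ContDiff ℝ ∞ e := by
    refine Complex.contDiff_exp.comp ?_
    exact (Complex.ofRealCLM.contDiff.comp
      (contDiff_const.mul (contDiff_id.mul contDiff_const))).mul contDiff_const
  obtain ⟨w, hw⟩ : ∃ w : 𝓢(ℝ, ℂ), ⇑w = fun ξ => e ξ * m ξ :=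
    ⟨(hmc.mul_left (f := e)).toSchwartzMap (hes.mul (m.smooth ⊤)), rfl⟩
  -- The identity for g is tested on 𝓕 w, which moves the symbol onto w. There it cancels the
  -- inverse symbol in m and leaves e·θ. Fourier inversion makes the left side u(x); the modulation
  -- e makes the right side an integral of g against the kernel translated by x.
  set z : 𝓢(ℝ, ℂ) := SchwartzMap.smulLeftCLM ℂ (besselSymbol s) w with hz
  have hzξ : ∀ ξ, z ξ = e ξ * θ ξ := by
    intro ξ
    rw [hz, SchwartzMap.smulLeftCLM_apply_apply (besselSymbol_hasTemperateGrowth s), hw,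
      smul_eq_mul]
    simp only [hm]
    linear_combination (e ξ * θ ξ) * besselSymbol_mul_neg s ξ
  have hwy : ∀ y, (𝓕 w) y = (𝓕 m) (y - x) := by
    intro y
    rw [SchwartzMap.fourier_coe, SchwartzMap.fourier_coe, Real.fourier_real_eq_integral_exp_smul,
      Real.fourier_real_eq_integral_exp_smul, hw]
    refine integral_congr_ae (Filter.Eventually.of_forall fun ξ => ?_)
    simp only [he, smul_eq_mul, ← mul_assoc, ← Complex.exp_add]
    congr 2
    push_cast
    ring
  have h1 := congrArg (fun T : 𝓢'(ℝ, ℂ) => T (𝓕 w)) hg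
  simp only [besselOp, TemperedDistribution.fourierMultiplierCLM_apply_apply,
    FourierTransform.fourierInv_fourier_eq, Lp.toTemperedDistribution_apply] at h1
  have h2 : ∫ y, (𝓕 z) y • (hF.toLp F) y = u x := by
    calc ∫ y, (𝓕 z) y • (hF.toLp F) y = ∫ y, (𝓕 (z : ℝ → ℂ)) y • F y := by
          refine integral_congr_ae ?_
          filter_upwards [hF.coeFn_toLp] with y hy
          rw [hy]; rfl
      _ = ∫ ξ, z ξ • (𝓕 F) ξ := by
          simpa using! VectorFourier.integral_fourierIntegral_smul_eq_flip (L := innerₗ ℝ)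
            Real.continuous_fourierChar continuous_inner z.integrable hFi
      _ = ∫ ξ, e ξ • (𝓕 u) ξ := by
          refine integral_congr_ae (Filter.Eventually.of_forall fun ξ => ?_)
          simp only [hzξ, hu, smul_eq_mul, mul_assoc]
      _ = (𝓕⁻ (𝓕 u)) x := by
          rw [SchwartzMap.fourierInv_coe, Real.fourierInv_eq']
          refine integral_congr_ae (Filter.Eventually.of_forall fun ξ => ?_)
          simp only [he, RCLike.inner_apply, conj_trivial]
          congr 3
          push_cast
          ring
      _ = u x := by rw [FourierTransform.fourierInv_fourier_eq]
  rw [← h2, hz, h1]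
  refine (enorm_integral_le_lintegral_enorm _).trans_eq (lintegral_congr fun y => ?_)
  rw [hwy, enorm_smul]

/-- The piece is a convolution of g with a kernel whose L¹ norm is of order R^{-s}, so Young's
inequality applies for every q. -/
theorem eLpNorm_frequency_piece_le {χ : ℝ → ℂ} (hχ : ContDiff ℝ ∞ χ) (hχc : HasCompactSupport χ)
    {s : ℝ} (hs : 0 ≤ s) (q : ℝ≥0∞) [Fact (1 ≤ q)] : ∃ C : ℝ, 0 < C ∧ ∀ R : ℝ, 1 ≤ R →
      (∀ η ∈ tsupport χ, R ^ 2 ≤ 1 + (2 * Real.pi * (R * η)) ^ 2) →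
      ∀ (F : ℝ → ℂ) (_ : Integrable F) (hF : MemLp F q volume) (g : Lp ℂ q (volume : Measure ℝ))
        (_ : besselOp s (hF.toLp F : 𝓢'(ℝ, ℂ)) = (g : 𝓢'(ℝ, ℂ))) (u : 𝓢(ℝ, ℂ)),
        (∀ ξ, (𝓕 u) ξ = χ (R⁻¹ * ξ) * (𝓕 F) ξ) →
        eLpNorm u q volume ≤ ENNReal.ofReal (C * R ^ (-s)) * ‖g‖ₑ := by
  obtain ⟨C, hC, h⟩ := exists_cutoff_besselSymbol hχ hχc hs
  refine ⟨C, hC, fun R hR hsupp F hFi hF g hg u hu => ?_⟩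
  obtain ⟨m, hm, hmc, hle⟩ := h R hR hsupp
  have h1 := eLpNorm_le_of_enorm_le_lintegral (q := q) Fact.out
    (κ := fun y => ‖(𝓕 m : 𝓢(ℝ, ℂ)) y‖ₑ) (𝓕 m : 𝓢(ℝ, ℂ)).continuous.enorm.measurable
    (Lp.aestronglyMeasurable g)
    (enorm_le_lintegral_of_besselOp_eq hFi hF hg (θ := fun ξ => χ (R⁻¹ * ξ)) hm hmc hu)
  rw [Lp.enorm_def]
  exact h1.trans (by gcongr)

/-- Hölder's inequality on the compact support of ψ. The case r = 2 is where the assumption 2 ≤ q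
enters: L^q information becomes L² information for Plancherel's theorem. -/
theorem exists_eLpNorm_mul_le {ψ : ℝ → ℂ} (hψ : Continuous ψ) (hψc : HasCompactSupport ψ)
    {r q : ℝ≥0∞} (hr : 1 ≤ r) (hrq : r ≤ q) : ∃ C : ℝ, 0 < C ∧ ∀ u : ℝ → ℂ, AEStronglyMeasurable u volume →
      eLpNorm (fun x => ψ x * u x) r volume ≤ ENNReal.ofReal C * eLpNorm u q volume := by
  obtain ⟨M, hM⟩ := hψc.exists_bound_of_continuous hψ
  have hM0 : 0 ≤ M := (norm_nonneg _).trans (hM 0)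
  set K := tsupport ψ
  have hK : MeasurableSet K := (isClosed_tsupport ψ).measurableSet
  set c : ℝ≥0∞ := volume K ^ (1 / r.toReal - 1 / q.toReal) with hc
  have hct : c ≠ ⊤ := by
    refine ENNReal.rpow_ne_top_of_nonneg ?_ hψc.isCompact.measure_lt_top.ne
    rcases eq_or_ne q ⊤ with rfl | hqt
    · simp
    · have hrt : r ≠ ⊤ := ne_top_of_le_ne_top hqt hrq
      have h0 : 0 < r.toReal := ENNReal.toReal_pos (zero_lt_one.trans_le hr).ne' hrt
      exact sub_nonneg.2 (one_div_le_one_div_of_le h0 (ENNReal.toReal_mono hqt hrq))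
  refine ⟨M * c.toReal + 1, by positivity, fun u hu => ?_⟩
  calc eLpNorm (fun x => ψ x * u x) r volume
      ≤ ENNReal.ofReal M * eLpNorm (K.indicator u) r volume := by
        refine eLpNorm_le_mul_eLpNorm_of_ae_le_mul (Filter.Eventually.of_forall fun x => ?_) r
        by_cases hx : x ∈ K
        · rw [Set.indicator_of_mem hx, norm_mul]
          gcongr
          exact hM x
        · rw [image_eq_zero_of_notMem_tsupport hx, zero_mul, norm_zero]
          positivity
    _ ≤ ENNReal.ofReal M * (eLpNorm u q volume * c) := by
        gcongr
        rw [eLpNorm_indicator_eq_eLpNorm_restrict hK]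
        refine (eLpNorm_le_eLpNorm_mul_rpow_measure_univ hrq hu.restrict).trans ?_
        rw [Measure.restrict_apply_univ]
        gcongr
        exact Measure.restrict_le_self
    _ = ENNReal.ofReal (M * c.toReal) * eLpNorm u q volume := by
        rw [ENNReal.ofReal_mul hM0, ENNReal.ofReal_toReal hct]
        ring
    _ ≤ _ := by
        gcongr
        linarith

/-- Derivatives of localized frequency pieces. -/
theorem eLpNorm_iterate_deriv_localized_piece_le {s : ℝ} (hs : 0 ≤ s) {q : ℝ≥0∞} [Fact (1 ≤ q)]
    (hq : 2 ≤ q) (m : ℕ) : ∀ {χ : ℝ → ℂ} (_ : ContDiff ℝ ∞ χ) (_ : HasCompactSupport χ)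
    (ψ : 𝓢(ℝ, ℂ)) (_ : HasCompactSupport (ψ : ℝ → ℂ)), ∃ C : ℝ, 0 < C ∧ ∀ R : ℝ, 1 ≤ R →
      (∀ η ∈ tsupport χ, R ^ 2 ≤ 1 + (2 * Real.pi * (R * η)) ^ 2) →
      ∀ (F : ℝ → ℂ) (_ : Integrable F) (hF : MemLp F q volume) (g : Lp ℂ q (volume : Measure ℝ))
        (_ : besselOp s (hF.toLp F : 𝓢'(ℝ, ℂ)) = (g : 𝓢'(ℝ, ℂ))) (u : 𝓢(ℝ, ℂ)),
        (∀ ξ, (𝓕 u) ξ = χ (R⁻¹ * ξ) * (𝓕 F) ξ) →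
        eLpNorm (schwartzDeriv^[m] (SchwartzMap.smulLeftCLM ℂ ψ u)) 2 volume ≤
          ENNReal.ofReal (C * R ^ m * R ^ (-s)) * ‖g‖ₑ := by
  induction m with
  | zero =>
    intro χ hχ hχc ψ hψ
    obtain ⟨C₁, hC₁, h₁⟩ := exists_eLpNorm_mul_le ψ.continuous hψ one_le_two hq
    obtain ⟨C₂, hC₂, h₂⟩ := eLpNorm_frequency_piece_le hχ hχc hs q
    refine ⟨C₁ * C₂, by positivity, fun R hR hsupp F hFi hF g hg u hu => ?_⟩
    have e : ⇑(schwartzDeriv^[0] (SchwartzMap.smulLeftCLM ℂ ψ u)) = fun x => ψ x * u x := by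
      ext x
      rw [Function.iterate_zero, id, SchwartzMap.smulLeftCLM_apply_apply ψ.hasTemperateGrowth,
        smul_eq_mul]
    rw [e]
    refine (h₁ u u.continuous.aestronglyMeasurable).trans
      ((mul_le_mul_right (h₂ R hR hsupp F hFi hF g hg u hu) _).trans_eq ?_)
    rw [← mul_assoc, ← ENNReal.ofReal_mul hC₁.le, pow_zero]
    congr 2
    ring
  | succ m ih =>
    intro χ hχ hχc ψ hψ
    -- A derivative of ψu is ψ'u plus R times ψ·(u'/R), and u'/R is again a frequency piece, with
    -- the cutoff 2πiη χ(η) whose support is no larger. This is why the induction runs over all χ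
    -- and ψ.
    set χ' : ℝ → ℂ := fun η => (2 * Real.pi * Complex.I * η) * χ η with hχ'
    have hχ's : ContDiff ℝ ∞ χ' :=
      (contDiff_const.mul Complex.ofRealCLM.contDiff).mul hχ
    have hχ'c : HasCompactSupport χ' := hχc.mul_left
    have hψ' : HasCompactSupport (schwartzDeriv ψ : ℝ → ℂ) := hψ.deriv
    obtain ⟨C₁, hC₁, h₁⟩ := ih hχ hχc (schwartzDeriv ψ) hψ'
    obtain ⟨C₂, hC₂, h₂⟩ := ih hχ's hχ'c ψ hψ
    refine ⟨C₁ + C₂, by positivity, fun R hR hsupp F hFi hF g hg u hu => ?_⟩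
    have hR0 : 0 < R := by linarith
    have hRC : (R : ℂ) ≠ 0 := Complex.ofReal_ne_zero.2 hR0.ne'
    set u' : 𝓢(ℝ, ℂ) := (R⁻¹ : ℂ) • schwartzDeriv u with hu'
    have hu'ξ : ∀ ξ, (𝓕 u') ξ = χ' (R⁻¹ * ξ) * (𝓕 F) ξ := by
      intro ξ
      rw [hu', FourierTransform.fourier_smul, SchwartzMap.smul_apply, fourier_schwartzDeriv, hu,
        smul_eq_mul, hχ']
      push_cast
      ring
    have hsupp' : ∀ η ∈ tsupport χ', R ^ 2 ≤ 1 + (2 * Real.pi * (R * η)) ^ 2 := fun η hη =>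
      hsupp η (tsupport_mul_subset_right hη)
    have e1 : schwartzDeriv (SchwartzMap.smulLeftCLM ℂ ψ u) =
        SchwartzMap.smulLeftCLM ℂ (schwartzDeriv ψ) u +
          (R : ℂ) • SchwartzMap.smulLeftCLM ℂ ψ u' := by
      ext x
      have h1 : ⇑(SchwartzMap.smulLeftCLM ℂ ψ u) = fun x => ψ x * u x := by
        ext x
        rw [SchwartzMap.smulLeftCLM_apply_apply ψ.hasTemperateGrowth, smul_eq_mul]
      rw [SchwartzMap.add_apply, SchwartzMap.smul_apply,
        SchwartzMap.smulLeftCLM_apply_apply ψ.hasTemperateGrowth,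
        SchwartzMap.smulLeftCLM_apply_apply (schwartzDeriv ψ).hasTemperateGrowth,
        SchwartzMap.derivCLM_apply, h1,
        show (fun x => ψ x * u x) = ⇑ψ * ⇑u from rfl, ((ψ.hasDerivAt x).mul (u.hasDerivAt x)).deriv, hu',
        SchwartzMap.smul_apply, SchwartzMap.derivCLM_apply, SchwartzMap.derivCLM_apply]
      simp only [smul_eq_mul]
      field_simp
    have hiter : ∀ (c : ℂ) (v : 𝓢(ℝ, ℂ)), schwartzDeriv^[m] (c • v) = c • schwartzDeriv^[m] v :=
      fun c v => Function.Commute.iterate_left (g := fun v : 𝓢(ℝ, ℂ) => c • v)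
        (fun v => map_smul schwartzDeriv c v) m v
    have e2 : ⇑(schwartzDeriv^[m + 1] (SchwartzMap.smulLeftCLM ℂ ψ u)) =
        ⇑(schwartzDeriv^[m] (SchwartzMap.smulLeftCLM ℂ (schwartzDeriv ψ) u)) +
          (R : ℂ) • ⇑(schwartzDeriv^[m] (SchwartzMap.smulLeftCLM ℂ ψ u')) := by
      rw [Function.iterate_succ_apply, e1, iterate_map_add, hiter]
      rfl
    rw [e2]
    refine (eLpNorm_add_le (SchwartzMap.continuous _).aestronglyMeasurable
      ((SchwartzMap.continuous _).aestronglyMeasurable.const_smul _) (by norm_num)).trans ?_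
    rw [eLpNorm_const_smul, ← ofReal_norm, Complex.norm_real, Real.norm_of_nonneg hR0.le]
    refine (add_le_add (h₁ R hR hsupp F hFi hF g hg u hu)
      (mul_le_mul_right (h₂ R hR hsupp' F hFi hF g hg u' hu'ξ) _)).trans ?_
    rw [← mul_assoc, ← ENNReal.ofReal_mul hR0.le, ← add_mul, ← ENNReal.ofReal_add (by positivity)
      (by positivity)]
    refine mul_le_mul_left (ENNReal.ofReal_le_ofReal ?_) _
    have h3 : C₁ * R ^ m * R ^ (-s) * 1 ≤ C₁ * R ^ m * R ^ (-s) * R := by gcongr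
    rw [pow_succ]
    linarith

end FrequencyPieces

end SpectralMultiplier
end

noncomputable section

namespace SpectralMultiplier

/-! ### The dyadic partition in frequency and weak convergence -/

section DyadicDecomposition

open scoped FourierTransform ContDiff
open Filter (Tendsto atTop)
open Topology

/-- A smooth bump that is one on `[-1, 1]` and vanishes off `[-2, 2]`. -/
def lowCutoff (η : ℝ) : ℂ := ((⟨1, 2, one_pos, one_lt_two⟩ : ContDiffBump (0 : ℝ)) η : ℝ)

/-- The difference of two dilates of `lowCutoff`; it is supported in `1/2 ≤ |η| ≤ 2`. -/
def highCutoff (η : ℝ) : ℂ := lowCutoff η - lowCutoff (2 * η)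

theorem lowCutoff_contDiff : ContDiff ℝ ∞ lowCutoff :=
  Complex.ofRealCLM.contDiff.comp (ContDiffBump.contDiff _)

theorem lowCutoff_hasCompactSupport : HasCompactSupport lowCutoff :=
  (ContDiffBump.hasCompactSupport _).comp_left Complex.ofReal_zero

theorem norm_lowCutoff_le (η : ℝ) : ‖lowCutoff η‖ ≤ 1 := by
  rw [lowCutoff, Complex.norm_real, Real.norm_of_nonneg (ContDiffBump.nonneg' _ _)]
  exact ContDiffBump.le_one _

theorem lowCutoff_eq_one {η : ℝ} (h : |η| ≤ 1) : lowCutoff η = 1 := by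
  rw [lowCutoff, ContDiffBump.one_of_mem_closedBall, Complex.ofReal_one]
  simpa using h

theorem highCutoff_contDiff : ContDiff ℝ ∞ highCutoff :=
  lowCutoff_contDiff.sub (lowCutoff_contDiff.comp (contDiff_const.mul contDiff_id))

theorem highCutoff_hasCompactSupport : HasCompactSupport highCutoff :=
  lowCutoff_hasCompactSupport.sub
    (lowCutoff_hasCompactSupport.comp_homeomorph (Homeomorph.mulLeft₀ (2 : ℝ) two_ne_zero))

theorem half_le_abs_of_mem_tsupport_highCutoff {η : ℝ} (h : η ∈ tsupport highCutoff) :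
    1 / 2 ≤ |η| := by
  have hc : IsClosed {η : ℝ | 1 / 2 ≤ |η|} := isClosed_le continuous_const continuous_abs
  refine closure_minimal (fun x hx => ?_) hc h
  by_contra hlt
  simp only [Set.mem_setOf_eq, not_le] at hlt
  refine hx ?_
  rw [highCutoff, lowCutoff_eq_one (by linarith), lowCutoff_eq_one, sub_self]
  rw [abs_mul, abs_two]
  linarith

/-- The dyadic partition of unity in frequency, rescaled to unit frequency. -/
def dyadicCutoff : ℕ → ℝ → ℂ
  | 0 => lowCutoff
  | _ + 1 => highCutoff

theorem dyadicCutoff_contDiff (l : ℕ) : ContDiff ℝ ∞ (dyadicCutoff l) := by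
  cases l
  exacts [lowCutoff_contDiff, highCutoff_contDiff]

theorem dyadicCutoff_hasCompactSupport (l : ℕ) : HasCompactSupport (dyadicCutoff l) := by
  cases l
  exacts [lowCutoff_hasCompactSupport, highCutoff_hasCompactSupport]

theorem sq_le_of_mem_tsupport_dyadicCutoff (l : ℕ) {η : ℝ} (h : η ∈ tsupport (dyadicCutoff l)) :
    ((2 : ℝ) ^ l) ^ 2 ≤ 1 + (2 * Real.pi * (2 ^ l * η)) ^ 2 := by
  cases l with
  | zero => simp only [pow_zero, one_pow]; nlinarith [sq_nonneg (2 * Real.pi * (1 * η))]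
  | succ l =>
    have h1 := half_le_abs_of_mem_tsupport_highCutoff h
    have h2 : 1 / 4 ≤ η ^ 2 := by
      rw [← sq_abs]
      nlinarith
    have hpi : 1 ≤ Real.pi ^ 2 := one_le_pow₀ (by linarith [Real.two_le_pi])
    have e : (2 * Real.pi * (2 ^ (l + 1) * η)) ^ 2
        = 4 * Real.pi ^ 2 * η ^ 2 * ((2 : ℝ) ^ (l + 1)) ^ 2 := by ring
    have h3 : 1 ≤ 4 * Real.pi ^ 2 * η ^ 2 := by nlinarith
    rw [e]
    nlinarith [sq_nonneg ((2 : ℝ) ^ (l + 1))]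

theorem sum_dyadicCutoff (L : ℕ) (ξ : ℝ) :
    ∑ l ∈ Finset.range (L + 1), dyadicCutoff l (((2 : ℝ) ^ l)⁻¹ * ξ)
      = lowCutoff (((2 : ℝ) ^ L)⁻¹ * ξ) := by
  induction L with
  | zero => simp [dyadicCutoff]
  | succ L ih =>
    rw [Finset.sum_range_succ, ih, dyadicCutoff, highCutoff]
    have : 2 * (((2 : ℝ) ^ (L + 1))⁻¹ * ξ) = ((2 : ℝ) ^ L)⁻¹ * ξ := by
      rw [pow_succ]; field_simp
    rw [this]
    ring

variable {F : ℝ → ℂ}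

/-- Finite moments of all orders make 𝓕 F smooth. Its product with a smooth compactly supported
cutoff is then a Schwartz function, whose inverse transform is the piece. -/
theorem exists_frequency_pieces (hF : ∀ n : ℕ, Integrable fun x => ‖x‖ ^ n * ‖F x‖) :
    ∃ u : ℕ → 𝓢(ℝ, ℂ), ∀ l ξ, (𝓕 (u l)) ξ = dyadicCutoff l (((2 : ℝ) ^ l)⁻¹ * ξ) * (𝓕 F) ξ := by
  have hs : ContDiff ℝ ∞ (𝓕 F) := Real.contDiff_fourier fun n _ => hF n
  have hc : ∀ l : ℕ, HasCompactSupport fun ξ : ℝ =>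
      dyadicCutoff l (((2 : ℝ) ^ l)⁻¹ * ξ) * (𝓕 F) ξ := fun l =>
    ((dyadicCutoff_hasCompactSupport l).comp_homeomorph
      (Homeomorph.mulLeft₀ (((2 : ℝ) ^ l)⁻¹) (by positivity))).mul_right
  have hd : ∀ l : ℕ, ContDiff ℝ ∞ fun ξ : ℝ =>
      dyadicCutoff l (((2 : ℝ) ^ l)⁻¹ * ξ) * (𝓕 F) ξ := fun l =>
    ((dyadicCutoff_contDiff l).comp (contDiff_const.mul contDiff_id)).mul hs
  refine ⟨fun l => 𝓕⁻ ((hc l).toSchwartzMap (hd l)), fun l ξ => ?_⟩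
  rw [FourierTransform.fourier_fourierInv_eq]
  rfl

/-- On the Fourier side the partial sums telescope to a multiplication of 𝓕 F by lowCutoff(2^{-L}ξ),
which tends to one. As 𝓕 F is bounded, dominated convergence applies. -/
theorem tendsto_integral_mul_sum_pieces (hF : Integrable F) {u : ℕ → 𝓢(ℝ, ℂ)}
    (hu : ∀ l ξ, (𝓕 (u l)) ξ = dyadicCutoff l (((2 : ℝ) ^ l)⁻¹ * ξ) * (𝓕 F) ξ) (v : 𝓢(ℝ, ℂ)) :
    Tendsto (fun L : ℕ => ∫ x, v x * (∑ l ∈ Finset.range (L + 1), u l) x) atTop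
      (𝓝 (∫ x, v x * F x)) := by
  have hsum : ∀ (L : ℕ) ξ, (𝓕 (∑ l ∈ Finset.range (L + 1), u l)) ξ
      = lowCutoff (((2 : ℝ) ^ L)⁻¹ * ξ) * (𝓕 F) ξ := by
    intro L ξ
    have : 𝓕 (∑ l ∈ Finset.range (L + 1), u l) = ∑ l ∈ Finset.range (L + 1), 𝓕 (u l) :=
      map_sum (SchwartzMap.fourierTransformCLM ℂ) _ _
    rw [this, SchwartzMap.sum_apply, ← sum_dyadicCutoff, Finset.sum_mul]
    exact Finset.sum_congr rfl fun l _ => hu l ξ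
  have e1 : ∀ L : ℕ, ∫ x, v x * (∑ l ∈ Finset.range (L + 1), u l) x
      = ∫ ξ, (𝓕⁻ v) ξ * (lowCutoff (((2 : ℝ) ^ L)⁻¹ * ξ) * (𝓕 F) ξ) := by
    intro L
    have := SchwartzMap.integral_fourier_mul_eq (𝓕⁻ v) (∑ l ∈ Finset.range (L + 1), u l)
    rw [FourierTransform.fourier_fourierInv_eq] at this
    rw [this]
    simp_rw [hsum]
  have e2 : ∫ x, v x * F x = ∫ ξ, (𝓕⁻ v) ξ * (𝓕 F) ξ := by
    have := VectorFourier.integral_fourierIntegral_smul_eq_flip (L := innerₗ ℝ)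
      Real.continuous_fourierChar continuous_inner ((𝓕⁻ v).integrable (μ := volume)) hF
    have h2 : ∫ x, (𝓕 (𝓕⁻ v)) x * F x = ∫ ξ, (𝓕⁻ v) ξ * (𝓕 F) ξ := by
      simpa [-FourierTransform.fourier_fourierInv_eq] using! this
    rwa [FourierTransform.fourier_fourierInv_eq] at h2
  simp_rw [e1, e2]
  have hcont : Continuous (𝓕 F) := VectorFourier.fourierIntegral_continuous
    Real.continuous_fourierChar continuous_inner hF
  have hb : ∀ ξ, ‖(𝓕 F) ξ‖ ≤ ∫ x, ‖F x‖ := fun ξ =>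
    VectorFourier.norm_fourierIntegral_le_integral_norm _ _ _ _ _
  refine tendsto_integral_of_dominated_convergence (fun ξ => ‖(𝓕⁻ v) ξ‖ * ∫ x, ‖F x‖)
    (fun L => ?_) (((𝓕⁻ v).integrable (μ := volume)).norm.mul_const _) (fun L => ?_) ?_
  · exact ((𝓕⁻ v).continuous.mul ((lowCutoff_contDiff.continuous.comp
      (continuous_const.mul continuous_id)).mul hcont)).aestronglyMeasurable
  · refine Filter.Eventually.of_forall fun ξ => ?_
    rw [norm_mul, norm_mul]
    have h1 := norm_lowCutoff_le (((2 : ℝ) ^ L)⁻¹ * ξ)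
    have h2 := hb ξ
    calc ‖(𝓕⁻ v) ξ‖ * (‖lowCutoff (((2 : ℝ) ^ L)⁻¹ * ξ)‖ * ‖(𝓕 F) ξ‖)
        ≤ ‖(𝓕⁻ v) ξ‖ * (1 * ∫ x, ‖F x‖) := by gcongr
      _ = _ := by rw [one_mul]
  · refine Filter.Eventually.of_forall fun ξ => ?_
    refine tendsto_const_nhds.mul ?_
    obtain ⟨L₀, hL₀⟩ := pow_unbounded_of_one_lt |ξ| (one_lt_two (α := ℝ))
    refine tendsto_const_nhds.congr' ?_
    filter_upwards [Filter.eventually_ge_atTop L₀] with L hL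
    rw [lowCutoff_eq_one, one_mul]
    rw [abs_mul, abs_of_pos (by positivity), inv_mul_le_iff₀ (by positivity), mul_one]
    exact hL₀.le.trans (pow_le_pow_right₀ one_le_two hL)

theorem integral_norm_sq_le_of_eLpNorm_le {u : 𝓢(ℝ, ℂ)} {B : ℝ} (hB : 0 ≤ B)
    (h : eLpNorm u 2 volume ≤ ENNReal.ofReal B) : ∫ x, ‖u x‖ ^ 2 ≤ B ^ 2 := by
  have h1 := SchwartzMap.norm_toLp' (f := u) (p := 2) (μ := volume) (by norm_num) (by norm_num)
  have h2 : ‖u.toLp 2 volume‖ ≤ B := by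
    rw [SchwartzMap.norm_toLp]
    exact ENNReal.toReal_le_of_le_ofReal hB h
  have h3 : 0 ≤ ∫ x, ‖u x‖ ^ 2 := integral_nonneg fun x => by positivity
  have h4 : ‖u.toLp 2 volume‖ ^ 2 = ∫ x, ‖u x‖ ^ 2 := by
    rw [h1]
    simp only [ENNReal.toReal_ofNat, Real.rpow_two]
    rw [← Real.rpow_natCast, ← Real.rpow_mul h3]
    norm_num
  rw [← h4]
  exact pow_le_pow_left₀ (norm_nonneg _) h2 2

theorem exists_schwartz_bump {b e γ : ℝ} (hbe : b < e) (hγ : 0 < γ) :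
    ∃ ψ : 𝓢(ℝ, ℂ), HasCompactSupport (ψ : ℝ → ℂ) ∧ (∀ x ∈ Set.Icc (b + γ) (e - γ), ψ x = 1) ∧
      Function.support ψ ⊆ Set.Icc b e := by
  -- The bump needs a positive inner radius even when γ is so large that the smaller interval is
  -- empty.
  set γ' := min γ ((e - b) / 4) with hγ'
  have h1 : γ' ≤ γ := min_le_left _ _
  have h2 : γ' ≤ (e - b) / 4 := min_le_right _ _
  have h3 : 0 < γ' := lt_min hγ (by linarith)
  let f : ContDiffBump ((b + e) / 2 : ℝ) :=
    ⟨(e - b) / 2 - γ', (e - b) / 2, by linarith, by linarith⟩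
  have hc : HasCompactSupport fun x => (f x : ℂ) := f.hasCompactSupport.comp_left Complex.ofReal_zero
  have hs : ContDiff ℝ ∞ fun x => (f x : ℂ) := Complex.ofRealCLM.contDiff.comp f.contDiff
  obtain ⟨ψ, hψ⟩ : ∃ ψ : 𝓢(ℝ, ℂ), ⇑ψ = fun x => (f x : ℂ) := ⟨hc.toSchwartzMap hs, rfl⟩
  refine ⟨ψ, by rwa [hψ], fun x hx => ?_, fun x hx => ?_⟩
  · have : f x = 1 := f.one_of_mem_closedBall (by
      rw [Metric.mem_closedBall, Real.dist_eq, abs_le]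
      constructor <;> simp only [f] <;> linarith [hx.1, hx.2])
    rw [hψ]
    simp only [this, Complex.ofReal_one]
  · have hx' : x ∈ Function.support f := fun h0 => hx (by
      rw [hψ]
      simp only [h0, Complex.ofReal_zero])
    rw [f.support_eq, Metric.mem_ball, Real.dist_eq, abs_lt] at hx'
    simp only [f] at hx'
    constructor <;> linarith

end DyadicDecomposition

end SpectralMultiplier
end

noncomputable section

namespace SpectralMultiplier

/-! ### Convergence in L^q and the decomposition of F -/

section DyadicDecomposition

open scoped FourierTransform ContDiff
open Filter (Tendsto atTop)
open Topology

theorem eLpNorm_fun_sub_comm {X : Type*} [MeasurableSpace X] {μ : Measure X} (f g : X → ℂ)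
    (q : ℝ≥0∞) : eLpNorm (fun x => f x - g x) q μ = eLpNorm (fun x => g x - f x) q μ :=
  eLpNorm_congr_norm_ae (Filter.Eventually.of_forall fun x => norm_sub_rev _ _)

/-- A series of Schwartz functions that converges absolutely in `L^q` and converges weakly to `F`
converges to `F` in `L^q`. -/
theorem tendsto_eLpNorm_sub_sum {q : ℝ≥0∞} [Fact (1 ≤ q)] {F : ℝ → ℂ} (hF : MemLp F q volume)
    {G : ℕ → 𝓢(ℝ, ℂ)} {c : ℕ → ℝ} (hc : Summable c)
    (hG : ∀ l, eLpNorm (G l) q volume ≤ ENNReal.ofReal (c l)) (hc0 : ∀ l, 0 ≤ c l)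
    (hw : ∀ φ : ℝ → ℝ, ContDiff ℝ ∞ φ → HasCompactSupport φ →
      Tendsto (fun L : ℕ => ∫ x, φ x • ∑ l ∈ Finset.range (L + 1), G l x) atTop
        (𝓝 (∫ x, φ x • F x))) :
    Tendsto (fun L : ℕ => eLpNorm (fun x => F x - ∑ l ∈ Finset.range (L + 1), G l x) q volume)
      atTop (𝓝 0) := by
  have hnorm : ∀ l, ‖(G l).toLp q volume‖ ≤ c l := fun l => by
    rw [SchwartzMap.norm_toLp]
    exact ENNReal.toReal_le_of_le_ofReal (hc0 l) (hG l)
  have hsum : Summable fun l => (G l).toLp q volume := Summable.of_norm_bounded hc hnorm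
  obtain ⟨H, hH⟩ := hsum
  have hpart : ∀ L : ℕ, (∑ l ∈ Finset.range (L + 1), (G l).toLp q volume : Lp ℂ q volume)
      =ᵐ[volume] fun x => ∑ l ∈ Finset.range (L + 1), G l x := by
    intro L
    have h1 : (∑ l ∈ Finset.range (L + 1), (G l).toLp q volume : Lp ℂ q volume)
        = (∑ l ∈ Finset.range (L + 1), G l).toLp q volume :=
      (map_sum (SchwartzMap.toLpCLM ℂ ℂ q volume) G _).symm
    rw [h1]
    filter_upwards [(∑ l ∈ Finset.range (L + 1), G l).coeFn_toLp q volume] with x hx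
    rw [hx, SchwartzMap.sum_apply]
  have hT : Tendsto (fun L : ℕ => eLpNorm (fun x => (∑ l ∈ Finset.range (L + 1), G l x) - H x) q
      volume) atTop (𝓝 0) := by
    have h1 := (Filter.tendsto_add_atTop_iff_nat 1).2 hH.tendsto_sum_nat
    refine ((Lp.tendsto_Lp_iff_tendsto_eLpNorm' _ H).1 h1).congr fun L => ?_
    refine eLpNorm_congr_ae ?_
    filter_upwards [hpart L] with x hx
    rw [Pi.sub_apply, hx]
  -- The absolutely convergent series has some limit H in L^q; testing against smooth compactly
  -- supported functions identifies it with F.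
  have hHF : H =ᵐ[volume] F := by
    refine ae_eq_of_integral_contDiff_smul_eq ((Lp.memLp H).locallyIntegrable Fact.out)
      (hF.locallyIntegrable Fact.out) fun φ hφ hφc => ?_
    refine tendsto_nhds_unique ?_ (hw φ hφ hφc)
    obtain ⟨K, hK, hKu⟩ := exists_eLpNorm_mul_le (ψ := fun x => (φ x : ℂ))
      (Complex.continuous_ofReal.comp hφ.continuous) (hφc.comp_left Complex.ofReal_zero)
      (r := 1) (q := q) le_rfl Fact.out
    have hm : ∀ L : ℕ, AEStronglyMeasurable (fun x => ∑ l ∈ Finset.range (L + 1), G l x) volume :=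
      fun L => (continuous_finsetSum _ fun l _ => (G l).continuous).aestronglyMeasurable
    have hi : ∀ {u : ℝ → ℂ}, MemLp u q volume → Integrable fun x => φ x • u x := by
      intro u hu
      rw [← memLp_one_iff_integrable]
      refine ⟨hφ.continuous.aestronglyMeasurable.smul hu.1, ?_⟩
      exact (hKu u hu.1).trans_lt (ENNReal.mul_lt_top ENNReal.ofReal_lt_top hu.2)
    refine tendsto_integral_of_L1' _ (hi (Lp.memLp H)).1 (Filter.Eventually.of_forall fun L => ?_) ?_
    · refine hi (u := fun x => ∑ l ∈ Finset.range (L + 1), G l x) ?_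
      exact memLp_finset_sum _ fun l _ => (G l).memLp q volume
    · refine tendsto_of_tendsto_of_tendsto_of_le_of_le tendsto_const_nhds
        (by simpa using ENNReal.Tendsto.const_mul hT (Or.inr (ENNReal.ofReal_ne_top (r := K))))
        (fun _ => zero_le) fun L => ?_
      refine le_trans (le_of_eq ?_) (hKu _ ((hm L).sub (Lp.aestronglyMeasurable H)))
      congr 1
      ext x
      simp [mul_sub]
  refine hT.congr fun L => ?_
  rw [eLpNorm_fun_sub_comm]
  refine eLpNorm_congr_ae ?_
  filter_upwards [hHF] with x hx
  rw [hx]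

/-- Decomposition of a compactly supported function in `W^{s,q}` into smooth functions that are
essentially localized at the frequencies `2^l`. -/
theorem exists_dyadic_decomposition {s : ℝ} (hs : 0 < s) {q : ℝ≥0∞} [Fact (1 ≤ q)] (hq : 2 ≤ q)
    {k : ℝ} (hk : 0 ≤ k) {b e γ : ℝ} (hbe : b < e) (hγ : 0 < γ) : ∃ C : ℝ, 0 < C ∧
      ∀ F : ℝ → ℂ, Measurable F → (∃ M : ℝ, ∀ t, ‖F t‖ ≤ M) →
      Function.support F ⊆ Set.Icc (b + γ) (e - γ) → ∀ (hF : MemLp F q volume)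
      (g : Lp ℂ q (volume : Measure ℝ)),
      besselOp s (hF.toLp F : 𝓢'(ℝ, ℂ)) = (g : 𝓢'(ℝ, ℂ)) → ∃ G : ℕ → 𝓢(ℝ, ℂ),
      (∀ l, Function.support (G l) ⊆ Set.Icc b e) ∧
      (∀ l, eLpNorm (G l) q volume ≤ ENNReal.ofReal (C * ((2 : ℝ) ^ l) ^ (-s) * ‖g‖)) ∧
      (∀ l, (Integrable fun ξ : ℝ => ‖(𝓕 (G l)) ξ‖ * (1 + |2 * Real.pi * ξ|) ^ k) ∧
        ∫ ξ : ℝ, ‖(𝓕 (G l)) ξ‖ * (1 + |2 * Real.pi * ξ|) ^ k ≤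
          C * ((2 : ℝ) ^ l) ^ (k + 1 / 2 - s) * ‖g‖) ∧
      Tendsto (fun L : ℕ => eLpNorm (fun x => F x - ∑ l ∈ Finset.range (L + 1), G l x) q volume)
        atTop (𝓝 0) := by
  obtain ⟨ψ, hψc, hψ1, hψs⟩ := exists_schwartz_bump hbe hγ
  obtain ⟨m, hm⟩ := exists_nat_gt (k + 1 / 2)
  have hm2 : 2 * k + 1 < 2 * m := by linarith
  obtain ⟨C₀, hC₀, h₀⟩ := exists_eLpNorm_mul_le ψ.continuous hψc (Fact.out : 1 ≤ q) le_rfl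
  have hcut : ∀ l : ℕ, ∃ c : ℝ, 0 < c ∧ ∀ R : ℝ, 1 ≤ R →
      (∀ η ∈ tsupport (dyadicCutoff l), R ^ 2 ≤ 1 + (2 * Real.pi * (R * η)) ^ 2) →
      ∀ (F : ℝ → ℂ) (_ : Integrable F) (hF : MemLp F q volume) (g : Lp ℂ q (volume : Measure ℝ))
        (_ : besselOp s (hF.toLp F : 𝓢'(ℝ, ℂ)) = (g : 𝓢'(ℝ, ℂ))) (u : 𝓢(ℝ, ℂ)),
        (∀ ξ, (𝓕 u) ξ = dyadicCutoff l (R⁻¹ * ξ) * (𝓕 F) ξ) →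
        eLpNorm u q volume ≤ ENNReal.ofReal (c * R ^ (-s)) * ‖g‖ₑ ∧
        eLpNorm (SchwartzMap.smulLeftCLM ℂ ψ u) 2 volume ≤ ENNReal.ofReal (c * R ^ (-s)) * ‖g‖ₑ ∧
        eLpNorm (schwartzDeriv^[m] (SchwartzMap.smulLeftCLM ℂ ψ u)) 2 volume ≤
          ENNReal.ofReal (c * R ^ m * R ^ (-s)) * ‖g‖ₑ := by
    intro l
    obtain ⟨c₁, hc₁, h₁⟩ := eLpNorm_frequency_piece_le (dyadicCutoff_contDiff l)
      (dyadicCutoff_hasCompactSupport l) hs.le q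
    obtain ⟨c₂, hc₂, h₂⟩ := eLpNorm_iterate_deriv_localized_piece_le hs.le hq 0
      (dyadicCutoff_contDiff l) (dyadicCutoff_hasCompactSupport l) ψ hψc
    obtain ⟨c₃, hc₃, h₃⟩ := eLpNorm_iterate_deriv_localized_piece_le hs.le hq m
      (dyadicCutoff_contDiff l) (dyadicCutoff_hasCompactSupport l) ψ hψc
    refine ⟨c₁ + c₂ + c₃, by positivity, fun R hR hsupp F hFi hF g hg u hu => ⟨?_, ?_, ?_⟩⟩
    · refine (h₁ R hR hsupp F hFi hF g hg u hu).trans ?_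
      gcongr
      linarith
    · refine (h₂ R hR hsupp F hFi hF g hg u hu).trans ?_
      rw [pow_zero, mul_one]
      gcongr
      linarith
    · refine (h₃ R hR hsupp F hFi hF g hg u hu).trans ?_
      gcongr
      linarith
  -- After rescaling there are only two cutoff profiles, one for l = 0 and one for all l ≥ 1, so the
  -- constants do not depend on l.
  obtain ⟨c₀, hc₀, hlow⟩ := hcut 0
  obtain ⟨c₁, hc₁, hhigh⟩ := hcut 1
  set W := weightConst k m with hW
  have hW0 : 0 < W := weightConst_pos k m
  set c := c₀ + c₁ with hc
  refine ⟨C₀ * c + W * c, by positivity, fun F hFm hFb hFs hF g hg => ?_⟩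
  have hmom : ∀ n : ℕ, Integrable fun x => ‖x‖ ^ n * ‖F x‖ := by
    intro n
    obtain ⟨M, hM⟩ := hFb
    have hM0 : 0 ≤ M := (norm_nonneg _).trans (hM 0)
    have hi : IntegrableOn (fun x : ℝ => ‖x‖ ^ n * M) (Set.Icc (b + γ) (e - γ)) :=
      Continuous.integrableOn_Icc (by fun_prop)
    refine ((integrable_indicator_iff measurableSet_Icc).2 hi).mono'
      (by fun_prop) (Filter.Eventually.of_forall fun x => ?_)
    rw [Real.norm_of_nonneg (by positivity)]
    by_cases hx : x ∈ Set.Icc (b + γ) (e - γ)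
    · rw [Set.indicator_of_mem hx]
      have := hM x
      gcongr
    · rw [Set.indicator_of_notMem hx, Function.notMem_support.1 fun h => hx (hFs h)]
      simp
  have hFi : Integrable F := by
    have := hmom 0
    simp only [pow_zero, one_mul] at this
    exact (integrable_norm_iff hFm.aestronglyMeasurable).1 this
  obtain ⟨u, hu⟩ := exists_frequency_pieces hmom
  have hR1 : ∀ l : ℕ, (1 : ℝ) ≤ 2 ^ l := fun l => one_le_pow₀ one_le_two
  have hpiece : ∀ l : ℕ, eLpNorm (u l) q volume ≤ ENNReal.ofReal (c * ((2 : ℝ) ^ l) ^ (-s)) * ‖g‖ₑ ∧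
      eLpNorm (SchwartzMap.smulLeftCLM ℂ ψ (u l)) 2 volume ≤
        ENNReal.ofReal (c * ((2 : ℝ) ^ l) ^ (-s)) * ‖g‖ₑ ∧
      eLpNorm (schwartzDeriv^[m] (SchwartzMap.smulLeftCLM ℂ ψ (u l))) 2 volume ≤
          ENNReal.ofReal (c * ((2 : ℝ) ^ l) ^ m * ((2 : ℝ) ^ l) ^ (-s)) * ‖g‖ₑ := by
    intro l
    cases l with
    | zero =>
      obtain ⟨h1, h2, h3⟩ := hlow (2 ^ 0) (hR1 0)
        (fun η hη => sq_le_of_mem_tsupport_dyadicCutoff 0 hη) F hFi hF g hg (u 0) (hu 0)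
      have : c₀ ≤ c := by linarith
      refine ⟨h1.trans ?_, h2.trans ?_, h3.trans ?_⟩ <;> gcongr
    | succ l =>
      obtain ⟨h1, h2, h3⟩ := hhigh (2 ^ (l + 1)) (hR1 _)
        (fun η hη => sq_le_of_mem_tsupport_dyadicCutoff (l + 1) hη) F hFi hF g hg (u (l + 1))
        (hu (l + 1))
      have : c₁ ≤ c := by linarith
      refine ⟨h1.trans ?_, h2.trans ?_, h3.trans ?_⟩ <;> gcongr
  have hψu : ∀ l x, SchwartzMap.smulLeftCLM ℂ ψ (u l) x = ψ x * u l x := fun l x => by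
    rw [SchwartzMap.smulLeftCLM_apply_apply ψ.hasTemperateGrowth, smul_eq_mul]
  have hGq : ∀ l, eLpNorm (SchwartzMap.smulLeftCLM ℂ ψ (u l)) q volume ≤
      ENNReal.ofReal ((C₀ * c + W * c) * ((2 : ℝ) ^ l) ^ (-s) * ‖g‖) := by
    intro l
    rw [show ⇑(SchwartzMap.smulLeftCLM ℂ ψ (u l)) = fun x => ψ x * u l x from funext (hψu l)]
    refine (h₀ _ (u l).continuous.aestronglyMeasurable).trans ?_
    refine (mul_le_mul_right (hpiece l).1 _).trans ?_
    rw [← ofReal_norm, ← mul_assoc, ← ENNReal.ofReal_mul hC₀.le, ← ENNReal.ofReal_mul (by positivity)]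
    refine ENNReal.ofReal_le_ofReal ?_
    have : 0 ≤ W * c * ((2 : ℝ) ^ l) ^ (-s) * ‖g‖ := by positivity
    linarith
  have hgeo : Summable fun l : ℕ => (C₀ * c + W * c) * ((2 : ℝ) ^ l) ^ (-s) * ‖g‖ := by
    have h1 : (2 : ℝ) ^ (-s) < 1 :=
      Real.rpow_lt_one_of_one_lt_of_neg one_lt_two (by linarith)
    have h2 := summable_geometric_of_lt_one (by positivity) h1
    refine ((h2.mul_left (C₀ * c + W * c)).mul_right ‖g‖).congr fun l => ?_
    rw [← Real.rpow_natCast, ← Real.rpow_natCast, ← Real.rpow_mul two_pos.le,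
      ← Real.rpow_mul two_pos.le, mul_comm (-s)]
  refine ⟨fun l => SchwartzMap.smulLeftCLM ℂ ψ (u l), fun l x hx => hψs fun h0 => hx ?_, hGq,
    fun l => ?_, tendsto_eLpNorm_sub_sum hF hgeo hGq (fun l => by positivity) fun φ hφ hφc => ?_⟩
  · rw [hψu, h0, zero_mul]
  · set R := (2 : ℝ) ^ l with hR
    have hR0 : 0 < R := by positivity
    -- The weighted estimate requires B > 0 while ‖g‖ may vanish. It is proved for every larger
    -- positive B, and B then decreases to the bound.
    have hB : ∀ B : ℝ, c * R ^ (-s) * ‖g‖ ≤ B → 0 < B →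
        (Integrable fun ξ : ℝ => ‖(𝓕 (SchwartzMap.smulLeftCLM ℂ ψ (u l))) ξ‖ *
          (1 + |2 * Real.pi * ξ|) ^ k) ∧
        ∫ ξ : ℝ, ‖(𝓕 (SchwartzMap.smulLeftCLM ℂ ψ (u l))) ξ‖ * (1 + |2 * Real.pi * ξ|) ^ k ≤
          W * R ^ (k + 1 / 2) * B := by
      intro B hle hB0
      refine integral_norm_fourier_mul_weight_le hk hm2 hR0 (Or.inl (hR1 l)) hB0 _
        (integral_norm_sq_le_of_eLpNorm_le hB0.le ((hpiece l).2.1.trans ?_))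
        (integral_norm_sq_le_of_eLpNorm_le (by positivity) ((hpiece l).2.2.trans ?_))
      · rw [← ofReal_norm, ← ENNReal.ofReal_mul (by positivity)]
        exact ENNReal.ofReal_le_ofReal hle
      · rw [← ofReal_norm, ← ENNReal.ofReal_mul (by positivity)]
        refine ENNReal.ofReal_le_ofReal ?_
        calc c * R ^ m * R ^ (-s) * ‖g‖ = c * R ^ (-s) * ‖g‖ * R ^ m := by ring
          _ ≤ B * R ^ m := by gcongr
    refine ⟨(hB (c * R ^ (-s) * ‖g‖ + 1) (by linarith) (by positivity)).1, ?_⟩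
    have hlim : ∫ ξ : ℝ, ‖(𝓕 (SchwartzMap.smulLeftCLM ℂ ψ (u l))) ξ‖ *
        (1 + |2 * Real.pi * ξ|) ^ k ≤ W * R ^ (k + 1 / 2) * (c * R ^ (-s) * ‖g‖) := by
      refine le_of_forall_pos_le_add fun ε hε => ?_
      refine (hB (c * R ^ (-s) * ‖g‖ + ε / (W * R ^ (k + 1 / 2)))
        (le_add_of_nonneg_right (by positivity)) (by positivity)).2.trans_eq ?_
      field_simp
    refine hlim.trans ?_
    have e1 : R ^ (k + 1 / 2 - s) = R ^ (k + 1 / 2) * R ^ (-s) := by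
      rw [← Real.rpow_add hR0]; congr 1
    have e2 : 0 ≤ C₀ * c * R ^ (k + 1 / 2 - s) * ‖g‖ := by positivity
    rw [e1] at e2 ⊢
    linear_combination e2
  · have hφψc : HasCompactSupport fun x => (φ x : ℂ) * ψ x := hψc.mul_left
    have hφψs : ContDiff ℝ ∞ fun x => (φ x : ℂ) * ψ x :=
      (Complex.ofRealCLM.contDiff.comp hφ).mul (ψ.smooth ⊤)
    -- The bump is moved from the pieces to the test function. On the limit it has no effect,
    -- because ψ = 1 on the support of F.
    obtain ⟨v, hv⟩ : ∃ v : 𝓢(ℝ, ℂ), ⇑v = fun x => (φ x : ℂ) * ψ x :=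
      ⟨hφψc.toSchwartzMap hφψs, rfl⟩
    have h1 := tendsto_integral_mul_sum_pieces hFi hu v
    have e1 : ∫ x, v x * F x = ∫ x, φ x • F x := by
      refine integral_congr_ae (Filter.Eventually.of_forall fun x => ?_)
      simp only [hv, Complex.real_smul]
      by_cases hx : x ∈ Set.Icc (b + γ) (e - γ)
      · rw [hψ1 x hx, mul_one]
      · rw [Function.notMem_support.1 fun h => hx (hFs h)]
        simp
    rw [e1] at h1
    refine h1.congr fun L => integral_congr_ae (Filter.Eventually.of_forall fun x => ?_)
    simp only [hv, Complex.real_smul, SchwartzMap.sum_apply, hψu, ← Finset.mul_sum, mul_assoc]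

end DyadicDecomposition

end SpectralMultiplier
end

noncomputable section

namespace SpectralMultiplier

/-! ### Extension of operators from L² ∩ L^p to L^p -/

section Extension

open Filter (Tendsto atTop)
open Topology

variable {X : Type*} [MeasurableSpace X] {μ : Measure X} {p : ℝ≥0∞}

/-- Lower semicontinuity of the `L^p` norm with respect to convergence in `L²`. -/
theorem eLpNorm_le_of_tendsto_Lp {u : ℕ → Lp ℂ 2 μ} {v : Lp ℂ 2 μ} (h : Tendsto u atTop (𝓝 v))
    {B : ℝ≥0∞} (hB : ∀ j, eLpNorm (u j) p μ ≤ B) : eLpNorm v p μ ≤ B := by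
  obtain ⟨ns, -, hns⟩ := (tendstoInMeasure_of_tendsto_Lp h).exists_seq_tendsto_ae
  refine (Lp.eLpNorm_lim_le_liminf_eLpNorm (p := p) (fun j => Lp.aestronglyMeasurable (u (ns j))) _
    hns).trans ?_
  exact (Filter.liminf_le_liminf (Filter.Eventually.of_forall fun j => hB (ns j))).trans
    (by simp)

theorem tendsto_cutOp {s : ℕ → Set X} (hs : ∀ j, MeasurableSet (s j)) (hm : Monotone s)
    (hU : ∀ x, ∃ j, x ∈ s j) (f : Lp ℂ 2 μ) : Tendsto (fun j => cutOp μ (s j) f) atTop (𝓝 f) := by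
  rw [Lp.tendsto_Lp_iff_tendsto_eLpNorm']
  have hf := (Lp.memLp f).2
  have e : ∀ u : X → ℂ, eLpNorm u 2 μ = (∫⁻ x, ‖u x‖ₑ ^ (2 : ℝ) ∂μ) ^ (1 / 2 : ℝ) := fun u => by
    rw [eLpNorm_eq_lintegral_rpow_enorm_toReal (by norm_num) (by norm_num)]
    norm_num
  have h1 : Tendsto (fun j => ∫⁻ x, ‖(⇑(cutOp μ (s j) f) - ⇑f) x‖ₑ ^ (2 : ℝ) ∂μ) atTop (𝓝 0) := by
    have h2 : Tendsto (fun j => ∫⁻ x, ((s j)ᶜ.indicator (fun x => ‖f x‖ₑ ^ (2 : ℝ)) x) ∂μ) atTop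
        (𝓝 (∫⁻ _, 0 ∂μ)) := by
      refine tendsto_lintegral_of_dominated_convergence' (fun x => ‖f x‖ₑ ^ (2 : ℝ)) (fun j => ?_)
        (fun j => Filter.Eventually.of_forall fun x => Set.indicator_le_self _ _ _) ?_ ?_
      · exact ((Lp.aestronglyMeasurable f).enorm.pow_const 2).indicator (hs j).compl
      · intro h
        rw [e, h, ENNReal.top_rpow_of_pos (by norm_num)] at hf
        exact lt_irrefl _ hf
      · refine Filter.Eventually.of_forall fun x => tendsto_const_nhds.congr' ?_
        obtain ⟨j₀, hj₀⟩ := hU x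
        filter_upwards [Filter.eventually_ge_atTop j₀] with j hj
        rw [Set.indicator_of_notMem]
        exact fun h => h (hm hj hj₀)
    rw [lintegral_zero] at h2
    refine h2.congr fun j => lintegral_congr_ae ?_
    filter_upwards [cutOp_ae (hs j) f] with x hx
    rw [Pi.sub_apply, hx]
    by_cases hxs : x ∈ s j
    · simp [hxs]
    · simp [hxs]
  have h3 := h1.ennrpow_const (1 / 2 : ℝ)
  rw [ENNReal.zero_rpow_of_pos (by norm_num)] at h3
  exact h3.congr fun j => (e _).symm

/-- A simple function in L^p with p finite is supported on a set of finite measure, hence lies in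
L². -/
theorem denseRange_Lp_inter (hp : p ≠ ∞) [Fact (1 ≤ p)] (f : Lp ℂ p μ) {ε : ℝ} (hε : 0 < ε) :
    ∃ g : Lp ℂ p μ, MemLp g 2 μ ∧ dist f g < ε := by
  have hp0 : p ≠ 0 := (zero_lt_one.trans_le (Fact.out : 1 ≤ p)).ne'
  obtain ⟨_, hg, g, rfl⟩ := Metric.dense_iff.1
    (Lp.simpleFunc.denseRange (E := ℂ) (μ := μ) hp) f ε hε
  refine ⟨g, ?_, by rw [dist_comm]; exact hg⟩
  have h1 : MemLp (Lp.simpleFunc.toSimpleFunc g) p μ := Lp.simpleFunc.memLp g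
  have h2 : MemLp (Lp.simpleFunc.toSimpleFunc g) 2 μ :=
    (SimpleFunc.memLp_iff_finMeasSupp (by norm_num) (by norm_num)).2
      ((SimpleFunc.memLp_iff_finMeasSupp hp0 hp).1 h1)
  exact h2.ae_eq (Lp.simpleFunc.toSimpleFunc_eq_toFun g)

/-- An operator on `L²` that is bounded for the `L^p` norm extends to `L^p`. -/
theorem exists_extends (hp : p ≠ ∞) [Fact (1 ≤ p)] (T : Lp ℂ 2 μ →L[ℂ] Lp ℂ 2 μ) {c : ℝ}
    (hc : 0 ≤ c) (hT : ∀ f, eLpNorm (T f) p μ ≤ ENNReal.ofReal c * eLpNorm f p μ) :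
    ∃ S : Lp ℂ p μ →L[ℂ] Lp ℂ p μ, Extends S T ∧ ‖S‖ ≤ c := by
  -- L² ∩ L^p is realized as the pairs of classes that represent the same function. Its projection
  -- to L^p has dense range, so the bounded map from it to L^p extends.
  let V : Submodule ℂ (Lp ℂ 2 μ × Lp ℂ p μ) :=
    { carrier := {w | w.1 =ᵐ[μ] w.2}
      add_mem' := by
        intro w w' h h'
        filter_upwards [h, h', Lp.coeFn_add w.1 w'.1, Lp.coeFn_add w.2 w'.2] with x h1 h2 h3 h4
        rw [Prod.fst_add, Prod.snd_add, h3, h4, Pi.add_apply, Pi.add_apply, h1, h2]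
      zero_mem' := by
        filter_upwards [Lp.coeFn_zero ℂ 2 μ, Lp.coeFn_zero ℂ p μ] with x h1 h2
        rw [Prod.fst_zero, Prod.snd_zero, h1, h2]
      smul_mem' := by
        intro a w h
        filter_upwards [h, Lp.coeFn_smul a w.1, Lp.coeFn_smul a w.2] with x h1 h3 h4
        rw [Prod.smul_fst, Prod.smul_snd, h3, h4, Pi.smul_apply, Pi.smul_apply, h1] }
  have hle : ∀ w : V, eLpNorm (T w.1.1) p μ ≤ ENNReal.ofReal c * ‖w.1.2‖ₑ := fun w => by
    have h1 : (w.1.1 : X → ℂ) =ᵐ[μ] w.1.2 := w.2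
    rw [Lp.enorm_def, ← eLpNorm_congr_ae h1]
    exact hT _
  have hmem : ∀ w : V, MemLp (T w.1.1) p μ := fun w =>
    ⟨Lp.aestronglyMeasurable _, (hle w).trans_lt (ENNReal.mul_lt_top ENNReal.ofReal_lt_top
      enorm_lt_top)⟩
  let f : V →ₗ[ℂ] Lp ℂ p μ :=
    { toFun := fun w => (hmem w).toLp _
      map_add' := by
        intro w w'
        apply Lp.ext
        filter_upwards [(hmem (w + w')).coeFn_toLp, (hmem w).coeFn_toLp, (hmem w').coeFn_toLp,
          Lp.coeFn_add ((hmem w).toLp _) ((hmem w').toLp _), Lp.coeFn_add (T w.1.1) (T w'.1.1)]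
          with x h1 h2 h3 h4 h5
        rw [h1, h4, Pi.add_apply, h2, h3, ← Pi.add_apply, ← h5, Submodule.coe_add, Prod.fst_add,
          map_add]
      map_smul' := by
        intro a w
        apply Lp.ext
        filter_upwards [(hmem (a • w)).coeFn_toLp, (hmem w).coeFn_toLp,
          Lp.coeFn_smul a ((hmem w).toLp _), Lp.coeFn_smul a (T w.1.1)] with x h1 h2 h4 h5
        rw [h1, RingHom.id_apply, h4, Pi.smul_apply, h2, ← Pi.smul_apply, ← h5,
          Submodule.coe_smul, Prod.smul_fst, map_smul] }
  let e : V →ₗ[ℂ] Lp ℂ p μ := LinearMap.snd ℂ _ _ ∘ₗ V.subtype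
  have hdense : DenseRange e := by
    rw [DenseRange, Metric.dense_iff]
    intro u ε hε
    obtain ⟨g, hg, hug⟩ := denseRange_Lp_inter hp u hε
    refine ⟨g, ?_, ⟨⟨(hg.toLp g, g), hg.coeFn_toLp⟩, rfl⟩⟩
    rw [Metric.mem_ball, dist_comm]
    exact hug
  have hnorm : ∀ w : V, ‖f w‖ ≤ c * ‖e w‖ := by
    intro w
    have h1 : ‖f w‖ₑ ≤ ENNReal.ofReal c * ‖e w‖ₑ := by
      rw [Lp.enorm_def, show f w = (hmem w).toLp _ from rfl, eLpNorm_congr_ae (hmem w).coeFn_toLp]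
      exact hle w
    rw [← ofReal_norm, ← ofReal_norm, ← ENNReal.ofReal_mul hc] at h1
    exact (ENNReal.ofReal_le_ofReal_iff (by positivity)).1 h1
  refine ⟨f.extendOfNorm e, fun φ h2 hpφ => ?_, LinearMap.opNorm_extendOfNorm_le hdense hc hnorm⟩
  let w : V := ⟨(h2.toLp φ, hpφ.toLp φ), h2.coeFn_toLp.trans hpφ.coeFn_toLp.symm⟩
  have h1 := LinearMap.extendOfNorm_eq hdense ⟨c, hnorm⟩ w
  have h3 : e w = hpφ.toLp φ := rfl
  rw [h3] at h1
  rw [h1]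
  exact (hmem w).coeFn_toLp

end Extension

/-! ### The Sobolev norm in terms of its representing function -/

section Sobolev

theorem eq_of_toTemperedDistribution_eq {q : ℝ≥0∞} [Fact (1 ≤ q)]
    {g g' : Lp ℂ q (volume : Measure ℝ)} (h : (g : 𝓢'(ℝ, ℂ)) = (g' : 𝓢'(ℝ, ℂ))) : g = g' := by
  have h1 := Lp.ker_toTemperedDistributionCLM_eq_bot (F := ℂ) (μ := (volume : Measure ℝ)) (p := q)
  have h2 := LinearMap.ker_eq_bot.1 h1
  exact h2 h

theorem sobolevNorm_eq {s : ℝ} {q : ℝ≥0∞} [Fact (1 ≤ q)] {F : ℝ → ℂ} (hF : MemLp F q volume)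
    {g : Lp ℂ q (volume : Measure ℝ)}
    (hg : besselOp s (hF.toLp F : 𝓢'(ℝ, ℂ)) = (g : 𝓢'(ℝ, ℂ))) : sobolevNorm s q F = ‖g‖ₑ := by
  refine le_antisymm (iInf_le_of_le hF (iInf_le_of_le g (iInf_le _ hg))) ?_
  refine le_iInf fun hF' => le_iInf fun g' => le_iInf fun hg' => ?_
  rw [eq_of_toTemperedDistribution_eq (hg.symm.trans hg')]

theorem exists_of_sobolevNorm_lt_top {s : ℝ} {q : ℝ≥0∞} [Fact (1 ≤ q)] {F : ℝ → ℂ}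
    (h : sobolevNorm s q F < ∞) : ∃ (hF : MemLp F q volume) (g : Lp ℂ q (volume : Measure ℝ)),
      besselOp s (hF.toLp F : 𝓢'(ℝ, ℂ)) = (g : 𝓢'(ℝ, ℂ)) := by
  obtain ⟨hF, h1⟩ := iInf_lt_iff.1 h
  obtain ⟨g, h2⟩ := iInf_lt_iff.1 h1
  obtain ⟨hg, -⟩ := iInf_lt_iff.1 h2
  exact ⟨hF, g, hg⟩

end Sobolev

end SpectralMultiplier
end

noncomputable section

namespace SpectralMultiplier

/-! ### Optimal scales and summation of the dyadic pieces -/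

section Multiplier

open scoped FourierTransform
open Filter (Tendsto atTop)
open Topology

variable {X : Type*} [MetricSpace X] [TopologicalSpace.SeparableSpace X] [MeasurableSpace X]
  [BorelSpace X] {μ : Measure X}

omit [MetricSpace X] [TopologicalSpace.SeparableSpace X] [BorelSpace X] in
theorem eLpNorm_sum_Lp_le {ι : Type*} {p : ℝ≥0∞} (hp : 1 ≤ p) (s : Finset ι) (f : ι → Lp ℂ 2 μ) :
    eLpNorm (∑ i ∈ s, f i : Lp ℂ 2 μ) p μ ≤ ∑ i ∈ s, eLpNorm (f i) p μ := by
  classical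
  induction s using Finset.induction_on with
  | empty => rw [Finset.sum_empty, eLpNorm_congr_ae (Lp.coeFn_zero ℂ 2 μ)]; simp
  | insert i s hi ih =>
    rw [Finset.sum_insert hi, Finset.sum_insert hi, eLpNorm_congr_ae (Lp.coeFn_add _ _)]
    exact (eLpNorm_add_le (Lp.aestronglyMeasurable _) (Lp.aestronglyMeasurable _) hp).trans
      (add_le_add le_rfl ih)

namespace BlockData

variable {A : Lp ℂ 2 μ →L[ℂ] Lp ℂ 2 μ} {p : ℝ≥0∞} {n D a τ C : ℝ} {S : Set X} {Q : S → Set X}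
  (h : BlockData A p n D a τ C Q)
include h

/-- The contribution of one dyadic piece, at the optimal scale. -/
theorem eLpNorm_dyadic_piece_le {k s M c B R : ℝ} (hk : 1 ≤ k) (hkn : n / 2 < k) (hka : k < a)
    (hM : 0 ≤ M) (hc : 0 ≤ c) (hB : 0 ≤ B) (hR : 1 ≤ R) (G : 𝓢(ℝ, ℂ))
    (hG : ∀ f : X → ℂ, MemLp f p μ →
      ∀ hf : MemLp (fun z => (volPow μ τ (sigma p) z : ℂ) * f z) 2 μ,
        ‖borelCalculus A G (A (hf.toLp _))‖ₑ ≤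
          ENNReal.ofReal (M * (c * R ^ (-s) * B)) * eLpNorm f p μ)
    (hi : Integrable fun ξ : ℝ => ‖(𝓕 G) ξ‖ * (1 + |2 * Real.pi * ξ|) ^ k)
    (hβ : ∫ ξ : ℝ, ‖(𝓕 G) ξ‖ * (1 + |2 * Real.pi * ξ|) ^ k ≤ c * R ^ (k + 1 / 2 - s) * B)
    (f : Lp ℂ 2 μ) :
    eLpNorm (borelCalculus A G (A f)) p μ ≤
      ENNReal.ofReal (calcConst p n D a C k * (M + 1) * c * B *
        R ^ (n * sigma p * (1 + 1 / (2 * k)) - s)) * eLpNorm f p μ := by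
  have hR0 : 0 < R := by linarith
  -- With this ρ one has ρ^{-k} R^{k+1/2} = 1, so the local and the weighted contributions are both
  -- of order R^{-s}.
  have h1 := h.eLpNorm_calculus_le hk hkn hka (ρ := R ^ (1 + 1 / (2 * k)))
    (Real.one_le_rpow hR (by positivity)) (by positivity) G hG hi hβ f
  refine h1.trans_eq ?_
  congr 2
  have e1 : (R ^ (1 + 1 / (2 * k))) ^ (-k) * (c * R ^ (k + 1 / 2 - s) * B)
      = c * R ^ (-s) * B := by
    have : (R ^ (1 + 1 / (2 * k))) ^ (-k) * R ^ (k + 1 / 2 - s) = R ^ (-s) := by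
      rw [← Real.rpow_mul hR0.le, ← Real.rpow_add hR0]
      congr 1
      field_simp
      ring
    linear_combination c * B * this
  have e2 : (R ^ (1 + 1 / (2 * k))) ^ (n * sigma p) * R ^ (-s)
      = R ^ (n * sigma p * (1 + 1 / (2 * k)) - s) := by
    rw [← Real.rpow_mul hR0.le, ← Real.rpow_add hR0]
    congr 1
    ring
  rw [e1, ← e2]
  ring

/-- The `L^p` bound for `F(A) A` from a dyadic decomposition of `F`. -/
theorem eLpNorm_le_of_dyadic_decomposition {k s c B b e : ℝ} (hk : 1 ≤ k) (hkn : n / 2 < k)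
    (hka : k < a) (hs : n * sigma p * (1 + 1 / (2 * k)) < s) (hc : 0 ≤ c) (hB : 0 ≤ B)
    {N : (ℝ → ℂ) → ℝ≥0∞} {M : ℝ≥0}
    (hM : ∀ F : ℝ → ℂ, Measurable F → (∃ M : ℝ, ∀ t, ‖F t‖ ≤ M) →
      Function.support F ⊆ Set.Icc b e → ∀ f : X → ℂ, MemLp f p μ →
      ∀ hf : MemLp (fun z => (volPow μ τ (sigma p) z : ℂ) * f z) 2 μ,
        ‖borelCalculus A F (A (hf.toLp _))‖ₑ ≤ M * N F * eLpNorm f p μ)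
    {F : ℝ → ℂ} (hF : Measurable F) (hFb : ∃ M : ℝ, ∀ t, ‖F t‖ ≤ M)
    (hFs : Function.support F ⊆ Set.Icc b e) {G : ℕ → 𝓢(ℝ, ℂ)}
    (hGs : ∀ l, Function.support (G l) ⊆ Set.Icc b e)
    (hGN : ∀ l, N (G l) ≤ ENNReal.ofReal (c * ((2 : ℝ) ^ l) ^ (-s) * B))
    (hGF : ∀ l, (Integrable fun ξ : ℝ => ‖(𝓕 (G l)) ξ‖ * (1 + |2 * Real.pi * ξ|) ^ k) ∧
      ∫ ξ : ℝ, ‖(𝓕 (G l)) ξ‖ * (1 + |2 * Real.pi * ξ|) ^ k ≤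
        c * ((2 : ℝ) ^ l) ^ (k + 1 / 2 - s) * B)
    (hlim : Tendsto (fun L : ℕ => N fun x => F x - ∑ l ∈ Finset.range (L + 1), G l x) atTop (𝓝 0))
    (f : Lp ℂ 2 μ) :
    eLpNorm (borelCalculus A F (A f)) p μ ≤
      ENNReal.ofReal (calcConst p n D a C k * (M + 1) * c *
        (1 - 2 ^ (n * sigma p * (1 + 1 / (2 * k)) - s))⁻¹ * B) * eLpNorm f p μ := by
  have hτ := h.scale_pos
  have hK0 : 0 ≤ calcConst p n D a C k := by
    have h1 := locConst_pos (p := p) h.doubling hkn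
    have h2 := h.dataConst_pos hka
    have h3 := h.doubling.one_le
    unfold calcConst
    positivity
  set r : ℝ := 2 ^ (n * sigma p * (1 + 1 / (2 * k)) - s) with hr
  have hr0 : 0 < r := by positivity
  have hr1 : r < 1 := Real.rpow_lt_one_of_one_lt_of_neg one_lt_two (by linarith)
  set K := calcConst p n D a C k * (M + 1) * c * B with hK
  have hKB : 0 ≤ K := by positivity
  have hGb : ∀ l, ∃ M : ℝ, ∀ t, ‖G l t‖ ≤ M := fun l =>
    ⟨_, fun t => (SchwartzMap.norm_le_seminorm ℝ (G l) t)⟩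
  have hpiece : ∀ l (f : Lp ℂ 2 μ), eLpNorm (borelCalculus A (G l) (A f)) p μ ≤
      ENNReal.ofReal (K * r ^ l) * eLpNorm f p μ := by
    intro l f
    have h1 := h.eLpNorm_dyadic_piece_le (s := s) (M := M) hk hkn hka M.2 hc hB
      (one_le_pow₀ one_le_two : (1 : ℝ) ≤ 2 ^ l) (G l) (fun φ hφ hφ2 => by
        refine (hM (G l) (G l).continuous.measurable (hGb l) (hGs l) φ hφ hφ2).trans ?_
        refine mul_le_mul_left ?_ _
        rw [ENNReal.ofReal_mul M.coe_nonneg, ENNReal.ofReal_coe_nnreal]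
        exact mul_le_mul_right (hGN l) _) (hGF l).1 (hGF l).2 f
    refine h1.trans_eq ?_
    congr 2
    rw [hK, hr, ← Real.rpow_natCast, ← Real.rpow_natCast, ← Real.rpow_mul two_pos.le,
      ← Real.rpow_mul two_pos.le, mul_comm (l : ℝ)]
  -- For f supported in a ball the restriction estimate controls the L² norm directly, so smallness
  -- of the remainder in the norm N gives convergence in L². The constant must not depend on the
  -- ball, and it does not: it comes from the pieces alone.
  have hball : ∀ (z : X) (R : ℝ) (f : Lp ℂ 2 μ), (∀ᵐ x ∂μ, x ∉ Metric.ball z R → f x = 0) →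
      eLpNorm (borelCalculus A F (A f)) p μ ≤
        ENNReal.ofReal (K * (1 - r)⁻¹) * eLpNorm f p μ := by
    intro z R f hf
    set ρ := max 1 (R / τ) with hρ
    have hf' : ∀ᵐ x ∂μ, x ∉ Metric.ball z (ρ * τ) → f x = 0 := by
      filter_upwards [hf] with x hx hxb
      refine hx fun hxR => hxb (Metric.ball_subset_ball ?_ hxR)
      rw [← div_le_iff₀ hτ]
      exact le_max_right _ _
    have hfp := h.eLpNorm_lt_top_of_ball z f hf
    set u : ℕ → Lp ℂ 2 μ := fun L => ∑ l ∈ Finset.range (L + 1), borelCalculus A (G l) (A f) with hu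
    have hdiff : ∀ L : ℕ, borelCalculus A (fun x => F x - ∑ l ∈ Finset.range (L + 1), G l x) (A f)
        = borelCalculus A F (A f) - u L := by
      intro L
      have hm : ∀ l ∈ Finset.range (L + 1), Measurable (G l) := fun l _ =>
        (G l).continuous.measurable
      have hb : ∃ M : ℝ, ∀ t, ‖∑ l ∈ Finset.range (L + 1), G l t‖ ≤ M := by
        choose M hM using hGb
        exact ⟨∑ l ∈ Finset.range (L + 1), M l, fun t =>
          (norm_sum_le _ _).trans (Finset.sum_le_sum fun l _ => hM l t)⟩
      rw [borelCalculus_sub A hF (Finset.measurable_sum _ hm) hFb hb,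
        borelCalculus_sum A _ hm fun l _ => hGb l, ContinuousLinearMap.sub_apply,
        ContinuousLinearMap.sum_apply]
    have hconv : Tendsto u atTop (𝓝 (borelCalculus A F (A f))) := by
      rw [tendsto_iff_edist_tendsto_0]
      set c' : ℝ := D ^ sigma p * 2 ^ (n * sigma p) *
        (ρ ^ (n * sigma p) * ballVol μ z (ρ * τ) ^ (-sigma p)) with hc'
      have hup : Tendsto (fun L : ℕ => (M * N fun x => F x - ∑ l ∈ Finset.range (L + 1), G l x) *
          (ENNReal.ofReal c' * eLpNorm f p μ)) atTop (𝓝 0) := by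
        have h1 := ENNReal.Tendsto.const_mul hlim (Or.inr (ENNReal.coe_ne_top (r := M)))
        rw [mul_zero] at h1
        have h2 := ENNReal.Tendsto.mul_const h1
          (Or.inr (ENNReal.mul_ne_top (ENNReal.ofReal_ne_top (r := c')) hfp.ne))
        rwa [zero_mul] at h2
      refine tendsto_of_tendsto_of_tendsto_of_le_of_le' tendsto_const_nhds hup
        (Filter.Eventually.of_forall fun _ => zero_le) ?_
      -- N is extended-valued, and the restriction lemma takes a real constant; finiteness is
      -- available for large L only, which suffices for the limit.
      have hfin := hlim.eventually_lt_const (u := ∞) ENNReal.zero_lt_top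
      filter_upwards [hfin] with L hL
      set H : ℝ → ℂ := fun x => F x - ∑ l ∈ Finset.range (L + 1), G l x with hH
      have hHm : Measurable H := hF.sub (Finset.measurable_sum _ fun l _ =>
        (G l).continuous.measurable)
      have hHb : ∃ M : ℝ, ∀ t, ‖H t‖ ≤ M := by
        obtain ⟨M₀, hM₀⟩ := hFb
        choose M hM using hGb
        exact ⟨M₀ + ∑ l ∈ Finset.range (L + 1), M l, fun t => (norm_sub_le _ _).trans
          (add_le_add (hM₀ t) ((norm_sum_le _ _).trans (Finset.sum_le_sum fun l _ => hM l t)))⟩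
      have hHs : Function.support H ⊆ Set.Icc b e := by
        intro x hx
        by_contra hxb
        refine hx ?_
        rw [hH]
        simp only
        rw [Function.notMem_support.1 fun h0 => hxb (hFs h0), Finset.sum_eq_zero, sub_zero]
        exact fun l _ => Function.notMem_support.1 fun h0 => hxb (hGs l h0)
      have hα : M * N H = ENNReal.ofReal (M * (N H).toReal) := by
        rw [ENNReal.ofReal_mul M.coe_nonneg, ENNReal.ofReal_coe_nnreal, ENNReal.ofReal_toReal hL.ne]
      have h1 := h.enorm_apply_le_of_restriction (T := borelCalculus A H ∘L A) (le_max_left 1 (R / τ))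
        (α := M * (N H).toReal) (by positivity) (fun φ hφ hφ2 => by
          rw [← hα]
          exact hM H hHm hHb hHs φ hφ hφ2) z f hf'
      rw [edist_comm, edist_eq_enorm_sub, ← hdiff]
      refine h1.trans_eq ?_
      rw [hα, ← mul_assoc (ENNReal.ofReal (M * (N H).toReal)),
        ← ENNReal.ofReal_mul (mul_nonneg M.coe_nonneg ENNReal.toReal_nonneg), hc']
      congr 2
      ring
    refine eLpNorm_le_of_tendsto_Lp hconv fun L => ?_
    have hsum := hasSum_geometric_of_lt_one hr0.le hr1
    calc eLpNorm (u L) p μ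
        ≤ ∑ l ∈ Finset.range (L + 1), eLpNorm (borelCalculus A (G l) (A f)) p μ := by
          exact eLpNorm_sum_Lp_le h.one_le _ _
      _ ≤ ∑ l ∈ Finset.range (L + 1), ENNReal.ofReal (K * r ^ l) * eLpNorm f p μ :=
          Finset.sum_le_sum fun l _ => hpiece l f
      _ = ENNReal.ofReal (∑ l ∈ Finset.range (L + 1), K * r ^ l) * eLpNorm f p μ := by
          rw [← Finset.sum_mul, ENNReal.ofReal_sum_of_nonneg fun l _ => by positivity]
      _ ≤ _ := by
          refine mul_le_mul_left (ENNReal.ofReal_le_ofReal ?_) _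
          rw [← Finset.mul_sum]
          exact mul_le_mul_of_nonneg_left
            (sum_le_hasSum _ (fun l _ => by positivity) hsum) hKB
  have hfinal : eLpNorm (borelCalculus A F (A f)) p μ ≤
      ENNReal.ofReal (K * (1 - r)⁻¹) * eLpNorm f p μ := by
    rcases isEmpty_or_nonempty X with hX | ⟨⟨z⟩⟩
    · rw [show (borelCalculus A F (A f) : X → ℂ) = 0 from funext fun x => isEmptyElim x]
      simp
    -- A general f is approximated in L² by its restrictions to growing balls, whose L^p norms do
    -- not exceed that of f.
    · have hconv := tendsto_cutOp (μ := μ) (s := fun j : ℕ => Metric.ball z j)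
        (fun j => measurableSet_ball)
        (fun i j hij => Metric.ball_subset_ball (by exact_mod_cast hij))
        (fun x => exists_nat_gt (dist x z)) f
      have hconv' := ((borelCalculus A F ∘L A).continuous.tendsto f).comp hconv
      refine eLpNorm_le_of_tendsto_Lp hconv' fun j => ?_
      refine (hball z j (cutOp μ (Metric.ball z j) f) ?_).trans ?_
      · filter_upwards [cutOp_ae (measurableSet_ball (x := z) (ε := (j : ℝ))) f] with x hx hxb
        rw [hx, Set.indicator_of_notMem hxb]
      · refine mul_le_mul_right ?_ _
        rw [eLpNorm_congr_ae (cutOp_ae (measurableSet_ball (x := z) (ε := (j : ℝ))) f)]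
        exact eLpNorm_indicator_le _
  refine hfinal.trans_eq ?_
  rw [hK]
  congr 2
  ring

end BlockData

end Multiplier

end SpectralMultiplier
end

noncomputable section

namespace SpectralMultiplier

/-! ### The admissible order and the multiplier theorem -/

section Main

open Filter (Tendsto atTop)
open Topology

variable {X : Type*} [MetricSpace X] [TopologicalSpace.SeparableSpace X] [MeasurableSpace X]
  [BorelSpace X] {μ : Measure X}

/-- For a continuous function the set where it exceeds its essential supremum is open and null,
hence empty. -/
theorem iSup_enorm_eq_eLpNorm_top {F : ℝ → ℂ} (hF : Continuous F) :
    ⨆ t, ‖F t‖ₑ = eLpNorm F ∞ volume := by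
  refine le_antisymm (iSup_le fun t => ?_) ?_
  · by_contra! ht
    have h1 : ∀ᵐ x, ‖F x‖ₑ ≤ eLpNorm F ∞ volume := by
      rw [eLpNorm_exponent_top]
      exact ae_le_eLpNormEssSup
    have ho : IsOpen {x | eLpNorm F ∞ volume < ‖F x‖ₑ} :=
      isOpen_lt continuous_const hF.enorm
    refine (ho.measure_pos volume ⟨t, ht⟩).ne' ?_
    rw [ae_iff] at h1
    simpa only [not_le] using h1
  · rw [eLpNorm_exponent_top]
    exact eLpNormEssSup_le_of_ae_enorm_bound
      (Filter.Eventually.of_forall fun t => le_iSup (fun t => ‖F t‖ₑ) t)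

theorem lqNorm_eq_eLpNorm {q : ℝ≥0∞} {F : ℝ → ℂ} (hF : q = ∞ → Continuous F) :
    lqNorm q F = eLpNorm F q volume := by
  unfold lqNorm
  split_ifs with hq
  · rw [hq, iSup_enorm_eq_eLpNorm_top (hF hq)]
  · rfl

/-- An order `k` of decay that is admissible for both the kernel and the smoothness. -/
theorem exists_order {p : ℝ≥0∞} (hp1 : 1 ≤ p) (hp2 : p < 2) {n a s : ℝ} (hn : 0 < n)
    (ha : (⌊n / 2⌋ : ℝ) + 1 < a)
    (hs : n * (1 / p.toReal - 1 / 2) + n / (4 * (⌊a⌋ : ℝ)) < s) :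
    ∃ k, 1 ≤ k ∧ n / 2 < k ∧ k < a ∧ n * sigma p * (1 + 1 / (2 * k)) < s := by
  have hσ := sigma_pos hp1 hp2
  have hσ2 := sigma_le_half hp1 hp2
  have hfl := Int.lt_floor_add_one (n / 2)
  have hna : n / 2 < a := by linarith
  have h0 : (0 : ℝ) ≤ ⌊n / 2⌋ := by
    exact_mod_cast Int.floor_nonneg.2 (by positivity : (0 : ℝ) ≤ n / 2)
  have h1a : 1 < a := by linarith
  have hfa : (1 : ℝ) ≤ ⌊a⌋ := by
    exact_mod_cast Int.le_floor.2 (by exact_mod_cast h1a.le)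
  have hfa2 := Int.floor_le a
  change n * sigma p + _ < s at hs
  -- From σ ≤ 1/2 and [a] ≤ a one gets nσ/(2a) ≤ n/(4[a]), so the assumption on s is strict already
  -- at k = a. This leaves room for an order k slightly below a.
  have h2 : n * sigma p / (2 * a) < s - n * sigma p := by
    have h3 : n * sigma p / (2 * a) ≤ n / (4 * (⌊a⌋ : ℝ)) := by
      rw [div_le_div_iff₀ (by linarith) (by linarith)]
      have := mul_le_mul hσ2 hfa2 (by linarith) (by norm_num)
      nlinarith
    linarith
  have hd : 0 < s - n * sigma p := lt_trans (by positivity) h2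
  have h3 : n * sigma p / (2 * (s - n * sigma p)) < a := by
    rw [div_lt_iff₀ (by linarith)] at h2 ⊢
    linarith
  obtain ⟨k, hk1, hk2⟩ := exists_between (max_lt h1a (max_lt hna h3))
  have hk3 := (le_max_left _ _).trans_lt hk1
  have hk4 := ((le_max_left _ _).trans (le_max_right _ _)).trans_lt hk1
  have hk5 := ((le_max_right _ _).trans (le_max_right _ _)).trans_lt hk1
  refine ⟨k, hk3.le, hk4, hk2, ?_⟩
  rw [div_lt_iff₀ (by linarith)] at hk5
  have h4 : n * sigma p / (2 * k) < s - n * sigma p := by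
    rw [div_lt_iff₀ (by linarith)]
    linarith
  have : n * sigma p * (1 + 1 / (2 * k)) = n * sigma p + n * sigma p / (2 * k) := by ring
  linarith

theorem continuous_sub_sum {F : ℝ → ℂ} (hF : Continuous F) (G : ℕ → 𝓢(ℝ, ℂ)) (L : ℕ) :
    Continuous fun x => F x - ∑ l ∈ Finset.range L, G l x :=
  hF.sub (continuous_finsetSum _ fun l _ => (G l).continuous)

/-- The multiplier theorem for a norm `N` that agrees with the `L^q` norm on Schwartz functions and on
the remainders of the decomposition of `F`. -/
theorem BlockData.exists_multiplier {A : Lp ℂ 2 μ →L[ℂ] Lp ℂ 2 μ} {p : ℝ≥0∞} {n D a τ C : ℝ}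
    {S : Set X} {Q : S → Set X} (h : BlockData A p n D a τ C Q) [Fact (1 ≤ p)]
    {q : ℝ≥0∞} [Fact (1 ≤ q)] (hq : 2 ≤ q) {s k R₁ R₂ γ : ℝ} (hk : 1 ≤ k) (hkn : n / 2 < k)
    (hka : k < a) (hs : n * sigma p * (1 + 1 / (2 * k)) < s) (hR : R₁ < R₂) (hγ : 0 < γ)
    {N : (ℝ → ℂ) → ℝ≥0∞} (hN : RestrictionEstimate A p τ R₁ R₂ N) :
    ∃ K : ℝ≥0, ∀ F : ℝ → ℂ, Measurable F → (∃ M : ℝ, ∀ t, ‖F t‖ ≤ M) →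
      Function.support F ⊆ Set.Icc (R₁ + γ) (R₂ - γ) → sobolevNorm s q F < ⊤ →
      (∀ G : 𝓢(ℝ, ℂ), N G = eLpNorm G q volume) →
      (∀ (G : ℕ → 𝓢(ℝ, ℂ)) (L : ℕ), N (fun x => F x - ∑ l ∈ Finset.range L, G l x) =
        eLpNorm (fun x => F x - ∑ l ∈ Finset.range L, G l x) q volume) →
      ∃ S : Lp ℂ p μ →L[ℂ] Lp ℂ p μ, Extends S (A ∘L borelCalculus A F) ∧
        ‖S‖ₑ ≤ K * sobolevNorm s q F := by
  have hn := h.doubling.exponent_pos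
  have hσ := h.sigma_pos
  have hs0 : 0 < s := lt_of_le_of_lt (by positivity) hs
  obtain ⟨c, hc, hdec⟩ := exists_dyadic_decomposition hs0 hq (by linarith : 0 ≤ k) hR hγ
  obtain ⟨M, hM⟩ := hN
  set K : ℝ := calcConst p n D a C k * (M + 1) * c *
    (1 - 2 ^ (n * sigma p * (1 + 1 / (2 * k)) - s))⁻¹ with hK
  refine ⟨K.toNNReal, fun F hF hFb hFs hFn hNG hNF => ?_⟩
  obtain ⟨hFq, g, hg⟩ := exists_of_sobolevNorm_lt_top hFn
  obtain ⟨G, hGs, hGN, hGF, hlim⟩ := hdec F hF hFb hFs hFq g hg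
  have hFs' : Function.support F ⊆ Set.Icc R₁ R₂ :=
    hFs.trans (Set.Icc_subset_Icc (by linarith) (by linarith))
  have hbound := h.eLpNorm_le_of_dyadic_decomposition hk hkn hka hs hc.le (norm_nonneg g) hM hF
    hFb hFs' hGs (fun l => (hNG (G l)).le.trans (hGN l)) hGF (by simpa only [hNF] using hlim)
  have hT : ∀ f, eLpNorm ((A ∘L borelCalculus A F) f) p μ ≤
      ENNReal.ofReal (max K 0 * ‖g‖) * eLpNorm f p μ := by
    intro f
    -- The estimates concern F(A)A, which equals AF(A) since A commutes with its Borel calculus.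
    rw [ContinuousLinearMap.comp_apply, ← borelCalculus_comm h.selfAdjoint hF hFb]
    refine (hbound f).trans (mul_le_mul_left (ENNReal.ofReal_le_ofReal ?_) _)
    exact mul_le_mul_of_nonneg_right (le_max_left _ _) (norm_nonneg g)
  obtain ⟨T, hT1, hT2⟩ := exists_extends (h.lt_two.trans_le le_top).ne (A ∘L borelCalculus A F)
    (by positivity) hT
  refine ⟨T, hT1, ?_⟩
  rw [sobolevNorm_eq hFq hg, ← ofReal_norm_eq_enorm, ← ofReal_norm_eq_enorm]
  refine (ENNReal.ofReal_le_ofReal hT2).trans_eq ?_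
  rw [ENNReal.ofReal_mul (le_max_right _ _), ← Real.coe_toNNReal', ENNReal.ofReal_coe_nnreal]

end Main

end SpectralMultiplier

end

theorem theorem4p1 {X : Type*} [MetricSpace X] [TopologicalSpace.SeparableSpace X]
    [MeasurableSpace X] [BorelSpace X] (μ : MeasureTheory.Measure X)
    (n : ℝ) (hn : 0 < n) (hμ : SpectralMultiplier.IsDoublingMeasure μ n)
    (p q : ENNReal) [Fact (1 ≤ p)] [Fact (1 ≤ q)] (hp : p < 2) (hq : 2 ≤ q)
    (A : MeasureTheory.Lp ℂ 2 μ →L[ℂ] MeasureTheory.Lp ℂ 2 μ) (hA : IsSelfAdjoint A)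
    (a τ : ℝ) (ha : (⌊n / 2⌋ : ℝ) + 1 < a) (hτ : 0 < τ)
    (hPVE : SpectralMultiplier.PVE A p n a τ)
    (R₁ R₂ : ℝ) (hR : R₁ < R₂) (hST : SpectralMultiplier.ST A p q τ R₁ R₂)
    (γ : ℝ) (hγ : 0 < γ)
    (s : ℝ) (hs : n * (1 / p.toReal - 1 / 2) + n / (4 * (⌊a⌋ : ℝ)) < s) :
    ∃ C : NNReal, ∀ F : ℝ → ℂ, Measurable F → (∃ M : ℝ, ∀ t, ‖F t‖ ≤ M) →
      Function.support F ⊆ Set.Icc (R₁ + γ) (R₂ - γ) →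
      SpectralMultiplier.sobolevNorm s q F < ⊤ →
      (q = ⊤ → Continuous F ∨ SpectralMultiplier.RestrictionEstimate A p τ R₁ R₂
        (fun G => MeasureTheory.eLpNorm G ⊤ MeasureTheory.volume)) →
      ∃ S : MeasureTheory.Lp ℂ p μ →L[ℂ] MeasureTheory.Lp ℂ p μ,
        SpectralMultiplier.Extends S (A ∘L SpectralMultiplier.borelCalculus A F) ∧
        ‖S‖ₑ ≤ C * SpectralMultiplier.sobolevNorm s q F := by
  open SpectralMultiplier in
  obtain ⟨D, hD⟩ := hμ.exists_isDoublingWith hn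
  obtain ⟨C, hC, hPVE⟩ := hPVE
  obtain ⟨S, hS⟩ := exists_isNet X hτ
  obtain ⟨Q, hQ, hQS⟩ := hS.exists_partition hτ
  have h : BlockData A p n D a τ C Q := ⟨hD, hτ, Fact.out, hp, hC, hA, hPVE, hS, hQ, hQS⟩
  obtain ⟨k, hk, hkn, hka, hks⟩ := exists_order h.one_le hp hn ha hs
  -- The constant must not depend on F, so the alternative is decided before F is given. If the
  -- estimate with the essential supremum holds, it serves for every F; otherwise F is continuous
  -- whenever q = ∞, and so are the remainders, for which supremum and essential supremum agree.
  by_cases hess : q = ⊤ ∧ RestrictionEstimate A p τ R₁ R₂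
      (fun G => MeasureTheory.eLpNorm G ⊤ MeasureTheory.volume)
  · obtain ⟨rfl, hess⟩ := hess
    obtain ⟨K, hK⟩ := h.exists_multiplier (q := ⊤) hq hk hkn hka hks hR hγ hess
    exact ⟨K, fun F hF hFb hFs hFn _ => hK F hF hFb hFs hFn (fun _ => rfl) fun _ _ => rfl⟩
  · obtain ⟨K, hK⟩ := h.exists_multiplier hq hk hkn hka hks hR hγ hST
    refine ⟨K, fun F hF hFb hFs hFn hFc => hK F hF hFb hFs hFn
      (fun G => lqNorm_eq_eLpNorm fun _ => G.continuous) fun G L => lqNorm_eq_eLpNorm fun hq' => ?_⟩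
    exact continuous_sub_sum ((hFc hq').resolve_right fun h' => hess ⟨hq', h'⟩) G L
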